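/- **Setting.** Let $I=[a,b]$, $a<b$, and let $(I_j)_j$, $I_j=(p_j,q_j)$, be a countable family of pairwise disjoint open subintervals of $I$, $D=\bigcup_j I_j$. A map $f:D\to I$ is a *cusp map* with constants $C,\epsilon>0$ if $f$ is a $C^1$ diffeomorphism of each $I_j$ onto its image, if $\lim_{x\to p_j^+}Df(x)$ and $\lim_{x\to q_j^-}Df(x)$ exist and are $0$ or $\pm\infty$, and if on each $I_j$ one has $|Df(x)-Df(x')|\le C|x-x'|^\epsilon$ whenever $|Df(x)|,|Df(x')|\le 2$ and $|1/Df(x)-1/Df(x')|\le C|x-x'|^\epsilon$ whenever $|Df(x)|,|Df(x')|\ge 1/2$. It is *piecewise monotone* if $D$ is covered by a finite collection $\mathcal Q$ of pairwise disjoint intervals on each of which $f$ is monotone (a finite partition into intervals of monotonicity). Let $f$ be a piecewise monotone cusp map and $\mu$ an ergodic $f$-invariant probability measure with $\log|Df|\in L^1(\mu)$ and $\chi=\int\log|Df|\,d\mu>0$. Let $Y=\{y=(y_0y_1\dots): y_{i+1}\in D,\ f(y_{i+1})=y_i\}$, $\Pi y=y_0$, $F^{-1}(y_0y_1\dots)=(y_1y_2\dots)$,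 $F$ the inverse of $F^{-1}$, and let $\bar\mu$ be the $F$-invariant measure on $Y$ with $\Pi_*\bar\mu=\mu$; it exists (natural extension). Let $0<\eta<\chi$. An *unstable family* consists of measurable real functions $\alpha,\rho,\gamma$ on $Y$ and sets $V_y\subset Y$ such that for $\bar\mu$-almost every $y$ the following *unstable properties* hold: $0<\alpha(y)<\frac12$; $y\in V_y$; $\Pi V_y=B(\Pi y,\alpha(y))$; for each $n>0$, $f^n:\Pi F^{-n}V_y\to\Pi V_y$ is a diffeomorphism; for all $y'\in V_y$ the sum $S(y,y')=\sum_{i\ge1}\big|\log|Df(\Pi F^{-i}y')|-\log|Df(\Pi F^{-i}y)|\big|$ satisfies $S(y,y')<\log2$ and $S(y,y')\le\gamma(y)|\Pi y-\Pi y'|^\epsilon$; and $\rho(y)>0$ with $\rho(y)^{-1}e^{n(\chi-\eta)}<|Df^n(\Pi F^{-n}y)|<\rho(y)e^{n(\chi+\eta)}$ for all $n>0$. Let $\mathcal Q$ be a finite partition into intervals of monotonicity such that every $I_j$ is contained in one element of $\mathcal Q$. (Such a $\mathcal Q$ exists.) A *good partition* for $\mathcal Q$ and an unstable family consists of a non-empty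 open interval $U\subset I$, constants $K,\varepsilon>0$ and $\mathcal P=\{U,I\setminus U\}\vee\mathcal Q$ such that - $U$ is regularly returning: $f^n(\partial U)\cap U=\emptyset$ for all $n>0$; and $U$ is contained in an element of $\mathcal Q$; - $\bar\mu(A)>0$, where $A$ is the set of $y\in Y$ that have the unstable properties and satisfy $\Pi y\in U$, $\alpha(y)\ge|U|$, $\rho(y)<K$, $\gamma(y)<K$ and $\mathrm{dist}(\Pi y,\partial U)>2\varepsilon|U|$; - $\mathcal P$ is generating for $(f,\mu)$; - for $\mu$-almost every $x$ there are $n_1<n_2<\dots$ such that, $\mathcal P_n(x)$ being the element of $\bigvee_{i=0}^nf^{-i}\mathcal P$ containing $x$, $f^{n_j}:\mathcal P_{n_j}(x)\to U$ is a diffeomorphism with distortion bounded by $\log 2$, $\mathrm{dist}(x,\partial\mathcal P_{n_j}(x))>\varepsilon|\mathcal P_{n_j}(x)|$, $\lim j/n_j>0$ and $\lim n_j/n_{j+1}=1$. **Proposition.** For every such $\eta$ and $\mathcal Q$: if $\mu$ is non-atomic, an unstable family with a good partition exists. For every unstable family and every good partition $\mathcal P$, let $\xi=\bigvee_{i\ge0}F^i(\Pi^{-1}\mathcal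 P)$ and let $\xi(y)$ be the element of $\xi$ containing $y$. Then: 1. $\xi$ is increasing ($F^{-1}\xi$ refines $\xi$) and generating (modulo a null set, $\bigvee_{n\ge0}F^{-n}\xi$ is the partition into points); 2. the entropy of $\mu$ is $h_\mu=H(F^{-1}\xi\,|\,\xi)$; 3. for $\bar\mu$-almost every $y$ and all $k\ge0$, $\Pi$ maps $F^{-k}(\xi(y))$ injectively into an element of $\mathcal Q$ (an interval of monotonicity of $f$); 4. for $\bar\mu$-almost every $y$, the limit $\Delta(y,y')=\lim_{n\to\infty}\dfrac{Df^n(\Pi F^{-n}y)}{Df^n(\Pi F^{-n}y')}$ exists and is positive for every $y'\in\xi(y)$, and $0<\int_{\xi(y)}\Delta(y,y')\,dy'<\infty$, where $dy'$ is the pullback of Lebesgue measure by $\Pi|_{\xi(y)}$; 5. for all $y\in A$, $\Pi\,\xi(y)=U$. -/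

import Mathlib

open Set Filter Topology MeasureTheory ProbabilityTheory
open scoped ENNReal

noncomputable section

namespace CuspPesin

/-! ### Cusp maps

A map defined on a countable disjoint union of open intervals is encoded by a total function
`f : ℝ → ℝ`; its values off the domain play no role. -/

/-- The domain of definition, the union of the open intervals `(p j, q j)`. -/
def dom {ι : Type*} (p q : ι → ℝ) : Set ℝ := ⋃ j, Ioo (p j) (q j)

/-- The domain of definition of the `n`-th iterate of a map with domain `D`. -/
def iterDom (D : Set ℝ) (f : ℝ → ℝ) (n : ℕ) : Set ℝ := {x | ∀ i < n, f^[i] x ∈ D}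

/-- `g` tends to `0`, to `+∞` or to `-∞` along `l`. -/
def TendstoZeroOrInfty (g : ℝ → ℝ) (l : Filter ℝ) : Prop :=
  Tendsto g l (𝓝 0) ∨ Tendsto g l atTop ∨ Tendsto g l atBot

/-- Basic cusp maps `f : ⋃ j, (p j, q j) → [a, b]`. A `C¹` map of an open interval is a `C¹`
diffeomorphism onto its image exactly when its derivative vanishes nowhere. -/
structure IsBasicCuspMap {ι : Type*} (a b : ℝ) (p q : ι → ℝ) (f : ℝ → ℝ) : Prop where
  nondegenerate : a < b
  lt : ∀ j, p j < q j
  subset : ∀ j, Ioo (p j) (q j) ⊆ Icc a b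
  disjoint : Pairwise fun j k => Disjoint (Ioo (p j) (q j)) (Ioo (p k) (q k))
  mapsTo : ∀ j, MapsTo f (Ioo (p j) (q j)) (Icc a b)
  contDiffOn : ∀ j, ContDiffOn ℝ 1 f (Ioo (p j) (q j))
  deriv_ne_zero : ∀ j, ∀ x ∈ Ioo (p j) (q j), deriv f x ≠ 0
  left_limit : ∀ j, TendstoZeroOrInfty (deriv f) (𝓝[>] (p j))
  right_limit : ∀ j, TendstoZeroOrInfty (deriv f) (𝓝[<] (q j))

/-- Cusp maps with constants `C` and `e`. -/
structure IsCuspMap {ι : Type*} (a b : ℝ) (p q : ι → ℝ) (f : ℝ → ℝ) (C e : ℝ) : Prop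
    extends IsBasicCuspMap a b p q f where
  C_pos : 0 < C
  e_pos : 0 < e
  holder : ∀ j, ∀ x ∈ Ioo (p j) (q j), ∀ x' ∈ Ioo (p j) (q j),
    |deriv f x| ≤ 2 → |deriv f x'| ≤ 2 → |deriv f x - deriv f x'| ≤ C * |x - x'| ^ e
  holder_inv : ∀ j, ∀ x ∈ Ioo (p j) (q j), ∀ x' ∈ Ioo (p j) (q j),
    1 / 2 ≤ |deriv f x| → 1 / 2 ≤ |deriv f x'| →
      |1 / deriv f x - 1 / deriv f x'| ≤ C * |x - x'| ^ e

/-- `𝒬` is a finite partition into intervals of monotonicity of the map `f` with domain `D`. -/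
structure IsMonotonicityPartition (D : Set ℝ) (f : ℝ → ℝ) (𝒬 : Set (Set ℝ)) : Prop where
  finite : 𝒬.Finite
  interval : ∀ Q ∈ 𝒬, Q.OrdConnected
  disjoint : 𝒬.PairwiseDisjoint id
  covers : D ⊆ ⋃₀ 𝒬
  monotone : ∀ Q ∈ 𝒬, MonotoneOn f (Q ∩ D) ∨ AntitoneOn f (Q ∩ D)

/-- Piecewise monotone maps. -/
def PiecewiseMonotone (D : Set ℝ) (f : ℝ → ℝ) : Prop :=
  ∃ 𝒬, IsMonotonicityPartition D f 𝒬

/-- A finite partition into intervals of monotonicity that does not cut any of the branch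
intervals `(p j, q j)`. -/
structure IsBranchPartition {ι : Type*} (p q : ι → ℝ) (f : ℝ → ℝ) (𝒬 : Set (Set ℝ)) : Prop
    extends IsMonotonicityPartition (dom p q) f 𝒬 where
  branch : ∀ j, ∃ Q ∈ 𝒬, Ioo (p j) (q j) ⊆ Q

/-- The Lyapunov exponent. -/
def lyapunov (f : ℝ → ℝ) (μ : Measure ℝ) : ℝ := ∫ x, Real.log |deriv f x| ∂μ

/-- `f^n` maps `W` diffeomorphically onto `V`. On its (open) domain `f^n` is `C¹` with
nonvanishing derivative, so a bijection from an open set is a diffeomorphism. -/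
structure IterDiffeo (D : Set ℝ) (f : ℝ → ℝ) (n : ℕ) (W V : Set ℝ) : Prop where
  isOpen : IsOpen W
  subset : W ⊆ iterDom D f n
  bijOn : BijOn f^[n] W V

/-! ### The natural extension -/

/-- The space of backward orbits. -/
def backwardOrbits (D : Set ℝ) (f : ℝ → ℝ) : Set (ℕ → ℝ) :=
  {y | ∀ i, y (i + 1) ∈ D ∧ f (y (i + 1)) = y i}

/-- The map `F⁻¹ : (y₀ y₁ …) ↦ (y₁ y₂ …)`. -/
def back (y : ℕ → ℝ) : ℕ → ℝ := fun i => y (i + 1)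

/-- The map `F : (y₀ y₁ …) ↦ (f y₀, y₀, y₁, …)`, meaningful when `y₀` is in the domain. -/
def forth (f : ℝ → ℝ) (y : ℕ → ℝ) : ℕ → ℝ
  | 0 => f (y 0)
  | i + 1 => y i

/-- The projection `Π : y ↦ y₀`. -/
def proj (y : ℕ → ℝ) : ℝ := y 0

/-- `ν` is the measure of the natural extension of `(f, μ)`: the `F`-invariant measure on the
space of backward orbits that projects to `μ`. -/
structure IsNaturalExtension (D : Set ℝ) (f : ℝ → ℝ) (μ : Measure ℝ) (ν : Measure (ℕ → ℝ)) :
    Prop where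
  supported : ∀ᵐ y ∂ν, y ∈ backwardOrbits D f
  invariant : MeasurePreserving (forth f) ν ν
  map_proj : ν.map proj = μ

/-! ### Entropy -/

/-- Entropy of the finite partition into the fibres of `φ`. -/
def partitionEntropy {Ω κ : Type*} [MeasurableSpace Ω] [Fintype κ] (μ : Measure Ω) (φ : Ω → κ) :
    ℝ :=
  ∑ k, Real.negMulLog (μ.real (φ ⁻¹' {k}))

/-- Entropy of `T` with respect to the finite partition into the fibres of `φ`: the limit of
`(1 / n) H (⋁_{i < n} T⁻ⁱ φ)`. -/
def mapPartitionEntropy {Ω : Type*} [MeasurableSpace Ω] (T : Ω → Ω) (μ : Measure Ω) {k : ℕ}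
    (φ : Ω → Fin k) : ℝ≥0∞ :=
  limsup (fun n : ℕ => ENNReal.ofReal
    (partitionEntropy μ (fun x => fun i : Fin n => φ (T^[i] x)) / n)) atTop

/-- The (Kolmogorov–Sinai) entropy of `T` with respect to `μ`. -/
def entropy {Ω : Type*} [MeasurableSpace Ω] (T : Ω → Ω) (μ : Measure Ω) : ℝ≥0∞ :=
  ⨆ (k : ℕ) (φ : Ω → Fin k) (_ : Measurable φ), mapPartitionEntropy T μ φ

/-- The σ-algebra of the measurable sets that are unions of classes of the partition `r`. -/
abbrev partitionSigma {Ω : Type*} [MeasurableSpace Ω] (r : Setoid Ω) : MeasurableSpace Ω :=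
  MeasurableSpace.comap (Quotient.mk r) inferInstance

/-- The conditional entropy `H(η / ξ) = -∫ log p(y, η(y)) dν(y)` of a partition `η` given a
partition `ξ`, where `p(y, ·)` is the system of conditional measures of `ν` along `ξ`. -/
def condPartitionEntropy {Ω : Type*} [MeasurableSpace Ω] [StandardBorelSpace Ω]
    (ν : Measure Ω) [IsFiniteMeasure ν] (η ξ : Setoid Ω) : ℝ≥0∞ :=
  ∫⁻ y, (-(ENNReal.log (condExpKernel ν (partitionSigma ξ) y {y' | η y y'}))).toENNReal ∂ν

/-! ### Unstable manifolds -/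

/-- The terms `|log |Df(Π F⁻ⁱ y')| - log |Df(Π F⁻ⁱ y)||` of the distortion sum, where `i ≥ 1` is
written as `i + 1`. -/
def distortionTerm (f : ℝ → ℝ) (y y' : ℕ → ℝ) (i : ℕ) : ℝ :=
  |Real.log (|deriv f (y' (i + 1))|) - Real.log (|deriv f (y (i + 1))|)|

/-- The set `V` is an unstable manifold of the backward orbit `y`, of size `r`: it projects onto
the ball `B(Π y, r)`, its backward images project diffeomorphically, and distortion along
it is bounded by `log 2`. -/
structure IsUnstableManifold (D : Set ℝ) (f : ℝ → ℝ) (y : ℕ → ℝ) (r : ℝ) (V : Set (ℕ → ℝ)) :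
    Prop where
  subset : V ⊆ backwardOrbits D f
  mem : y ∈ V
  proj_eq : proj '' V = Metric.ball (proj y) r
  diffeo : ∀ n : ℕ, 0 < n → IterDiffeo D f n (proj '' (back^[n] '' V)) (proj '' V)
  summable : ∀ y' ∈ V, Summable (distortionTerm f y y')
  distortion : ∀ y' ∈ V, ∑' i, distortionTerm f y y' i < Real.log 2

/-- At the backward orbit `y`, the functions `α`, `ρ`, `γ` and the sets `V` describe an unstable
manifold of size `α y`, with exponential rates `χ ± η` controlled by `ρ y` and Hölder control
`γ y` of the distortion. -/
structure UnstableAt (D : Set ℝ) (f : ℝ → ℝ) (e χ η : ℝ) (α ρ γ : (ℕ → ℝ) → ℝ)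
    (V : (ℕ → ℝ) → Set (ℕ → ℝ)) (y : ℕ → ℝ) : Prop where
  size_pos : 0 < α y
  size_lt : α y < 1 / 2
  manifold : IsUnstableManifold D f y (α y) (V y)
  rho_pos : 0 < ρ y
  rate_lower : ∀ n : ℕ, 0 < n → (ρ y)⁻¹ * Real.exp (n * (χ - η)) < |deriv f^[n] (y n)|
  rate_upper : ∀ n : ℕ, 0 < n → |deriv f^[n] (y n)| < ρ y * Real.exp (n * (χ + η))
  holder : ∀ y' ∈ V y, ∑' i, distortionTerm f y y' i ≤ γ y * |proj y - proj y'| ^ e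

/-- A measurable family of unstable manifolds, defined almost everywhere. -/
structure IsUnstableFamily (D : Set ℝ) (f : ℝ → ℝ) (e χ η : ℝ) (ν : Measure (ℕ → ℝ))
    (α ρ γ : (ℕ → ℝ) → ℝ) (V : (ℕ → ℝ) → Set (ℕ → ℝ)) : Prop where
  measurable_size : Measurable α
  measurable_rho : Measurable ρ
  measurable_gamma : Measurable γ
  ae : ∀ᵐ y ∂ν, UnstableAt D f e χ η α ρ γ V y

/-! ### The generating partition -/

/-- The partition `𝒫 = {U, I \ U} ∨ 𝒬`. Points outside all elements of `𝒬` (a set without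
mass) are put into classes of their own. -/
def partP (U : Set ℝ) (𝒬 : Set (Set ℝ)) : Setoid ℝ where
  r x x' := (x ∈ U ↔ x' ∈ U) ∧ ∀ Q ∈ 𝒬, (x ∈ Q ↔ x' ∈ Q)
  iseqv :=
    { refl := fun _ => ⟨Iff.rfl, fun _ _ => Iff.rfl⟩
      symm := fun h => ⟨h.1.symm, fun Q hQ => (h.2 Q hQ).symm⟩
      trans := fun h h' => ⟨h.1.trans h'.1, fun Q hQ => (h.2 Q hQ).trans (h'.2 Q hQ)⟩ }

/-- The element `𝒫_n(x)` of `𝒫_n = ⋁_{i ≤ n} f⁻ⁱ 𝒫` containing `x`. -/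
def cylinder (D : Set ℝ) (f : ℝ → ℝ) (P : Setoid ℝ) (n : ℕ) (x : ℝ) : Set ℝ :=
  {x' ∈ iterDom D f n | ∀ i ≤ n, P (f^[i] x) (f^[i] x')}

/-- The partition `P` is generating for `(f, μ)`: up to a null set, its forward itineraries
separate points. -/
def IsGenerating (f : ℝ → ℝ) (μ : Measure ℝ) (P : Setoid ℝ) : Prop :=
  ∃ X : Set ℝ, (∀ᵐ x ∂μ, x ∈ X) ∧
    ∀ x ∈ X, ∀ x' ∈ X, (∀ n : ℕ, P (f^[n] x) (f^[n] x')) → x = x'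

/-- The open interval `(u, v)` is regularly returning: no positive iterate of an end point,
where defined, lies in `(u, v)`. -/
def IsRegularlyReturning (D : Set ℝ) (f : ℝ → ℝ) (u v : ℝ) : Prop :=
  ∀ n : ℕ, 0 < n → ∀ z ∈ frontier (Ioo u v), z ∈ iterDom D f n → f^[n] z ∉ Ioo u v

/-- The set `A` of the backward orbits that start well inside `U = (u, v)` and have a large
unstable manifold with good bounds. -/
def goodSet (D : Set ℝ) (f : ℝ → ℝ) (e χ η : ℝ) (α ρ γ : (ℕ → ℝ) → ℝ)
    (V : (ℕ → ℝ) → Set (ℕ → ℝ)) (u v K ε : ℝ) : Set (ℕ → ℝ) :=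
  {y | UnstableAt D f e χ η α ρ γ V y ∧ proj y ∈ Ioo u v ∧ v - u ≤ α y ∧ ρ y < K ∧ γ y < K ∧
    2 * ε * (v - u) < Metric.infDist (proj y) (frontier (Ioo u v))}

/-- The regularly returning interval `U = (u, v)`, the constants `K`, `ε` and the partition
`𝒫 = {U, I \ U} ∨ 𝒬` form a good generating partition: `A` has positive measure, `U` is an
element of `𝒫`, `𝒫` is generating, and almost every `x` has a sequence of times `n j`, with
positive frequency, at which `𝒫_{n j}(x)` is mapped onto `U` with bounded distortion. -/
structure IsGoodPartition (a b : ℝ) (D : Set ℝ) (f : ℝ → ℝ) (μ : Measure ℝ)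
    (ν : Measure (ℕ → ℝ)) (𝒬 : Set (Set ℝ)) (e χ η : ℝ) (α ρ γ : (ℕ → ℝ) → ℝ)
    (V : (ℕ → ℝ) → Set (ℕ → ℝ)) (u v K ε : ℝ) : Prop where
  lt : u < v
  subset : Ioo u v ⊆ Icc a b
  K_pos : 0 < K
  eps_pos : 0 < ε
  returning : IsRegularlyReturning D f u v
  mem_partition : ∃ Q ∈ 𝒬, Ioo u v ⊆ Q
  goodSet_pos : 0 < ν (goodSet D f e χ η α ρ γ V u v K ε)
  generating : IsGenerating f μ (partP (Ioo u v) 𝒬)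
  returns : ∀ᵐ x ∂μ, ∃ n : ℕ → ℕ, StrictMono n ∧
    (∀ j, IterDiffeo D f (n j) (cylinder D f (partP (Ioo u v) 𝒬) (n j) x) (Ioo u v)) ∧
    (∀ j, ∀ z ∈ cylinder D f (partP (Ioo u v) 𝒬) (n j) x,
      ∀ z' ∈ cylinder D f (partP (Ioo u v) 𝒬) (n j) x,
        |Real.log (|deriv f^[n j] z|) - Real.log (|deriv f^[n j] z'|)| ≤ Real.log 2) ∧
    (∀ j, ε * Metric.diam (cylinder D f (partP (Ioo u v) 𝒬) (n j) x) <
      Metric.infDist x (frontier (cylinder D f (partP (Ioo u v) 𝒬) (n j) x))) ∧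
    (∃ L : ℝ, 0 < L ∧ Tendsto (fun j : ℕ => (j : ℝ) / n j) atTop (𝓝 L)) ∧
    Tendsto (fun j : ℕ => (n j : ℝ) / n (j + 1)) atTop (𝓝 1)

/-! ### The Pesin partition -/

/-- The partition `ξ = ⋁_{i ≥ 0} Fⁱ(Π⁻¹ P)`; the element of `Fⁱ(Π⁻¹ P)` containing `y` consists
of the `y'` such that `Π F⁻ⁱ y'` and `Π F⁻ⁱ y` are in the same element of `P`. In the order on
setoids the join of partitions is an infimum. -/
def pesin (P : Setoid ℝ) : Setoid (ℕ → ℝ) :=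
  ⨅ i : ℕ, Setoid.comap (fun y => proj (back^[i] y)) P

/-- The partition `F⁻ⁿ r`. -/
def pull (f : ℝ → ℝ) (n : ℕ) (r : Setoid (ℕ → ℝ)) : Setoid (ℕ → ℝ) :=
  Setoid.comap ((forth f)^[n]) r

/-- The element of the partition `r` of the space of backward orbits that contains `y`. -/
def atom (D : Set ℝ) (f : ℝ → ℝ) (r : Setoid (ℕ → ℝ)) (y : ℕ → ℝ) : Set (ℕ → ℝ) :=
  {y' ∈ backwardOrbits D f | r y y'}

/-- The natural Lebesgue measure on a set of backward orbits on which `Π` is injective: the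
pullback of Lebesgue measure by `Π`. -/
def leafLebesgue (S : Set (ℕ → ℝ)) : Measure S :=
  Measure.comap (fun y' : S => proj y') volume

/-- The ratios whose limit is `Δ(y, y')`. -/
def deltaSeq (f : ℝ → ℝ) (y y' : ℕ → ℝ) (n : ℕ) : ℝ :=
  deriv f^[n] (proj (back^[n] y)) / deriv f^[n] (proj (back^[n] y'))

/-- The limit `Δ(y, y')`. -/
def delta (f : ℝ → ℝ) (y y' : ℕ → ℝ) : ℝ := limUnder atTop (deltaSeq f y y')

end CuspPesin

end

/-! The natural extension is the law of a Markov chain that moves backwards from `x` to a preimage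
of `x`, drawn from the conditional law of a point given its image (`exists_isNaturalExtension`). It
inherits ergodicity from `μ`. Birkhoff's theorem along it shows that on almost every backward orbit
`|Df^n|` grows at rate `χ` and that the one-step derivatives are subexponential.

Unstable manifolds: by the two Hölder conditions `f` has small distortion on a ball around `x` whose
radius is governed by a power of `min(|Df x|, 1/|Df x|)`; as `Df` tends to `0` or `±∞` at the cusps,
such a ball cannot leave its branch (`IsCuspMap.local_distortion`). Along a typical backward orbit
these radii shrink more slowly than the pullbacks of a small ball, so the ball can be pulled back
forever, with a geometric series bounding the distortion (`exists_isUnstableManifold`). The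
distortion obtained is at most `1/4`, smaller than `log 2`; the constants of the good partition need
this room.

Good partition: a backward orbit that returns close to itself produces a periodic point nearby.
Non-atomicity leaves space to choose `U` as a gap between points of two periodic orbits, and such a
gap is regularly returning (`exists_regularlyReturning`). The use of this property is a nesting
argument: the intermediate images of a diffeomorphic pullback of `U` are connected and contain no
end point of `U`, hence each lies in one element of `𝒫`, and the pullback is a full cylinder
(`IsBranchPartition.cylinder_eq`). By ergodicity `F^n y` visits the good set `A` with positive
frequency. At each visit the cylinder of `Π y` is such a pullback; its length is exponentially
small, which also shows that `𝒫` is generating.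

Properties of `ξ`: the nesting argument along a whole backward orbit identifies `ξ(y)` with `V_y ∩
Π⁻¹ U` for `y ∈ A`, so that `Π ξ(y) = U`. Injectivity of `Π` holds because `f` is injective on the
domain points of each element of `𝒬`. For the densities, almost every `y` has some `F⁻ᵏ y ∈ A`;
beyond step `k` the distortion is at most `log 2`, so `Δ(y, ·)` is, up to a factor `2` and a
constant, the function `1/|Df^k|`, whose integral over `ξ(y)` is the length of a cylinder. For the
entropy, the increments of the block entropies are conditional entropies of the next symbol given a
finite past; they converge to `H(F⁻¹ξ | ξ)` by Lévy's theorem and to `h_μ` by the Kolmogorov–Sinai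
theorem. -/

namespace CuspPesin

/-! ### Birkhoff's ergodic theorem via the maximal inequality. -/

section Birkhoff

variable {Ω : Type*}

/-- The maximum of the Birkhoff sums of `g` of length at most `n`. -/
def maxBirkhoff (T : Ω → Ω) (g : Ω → ℝ) : ℕ → Ω → ℝ
  | 0 => fun _ => 0
  | n + 1 => fun x => max 0 (g x + maxBirkhoff T g n (T x))

lemma maxBirkhoff_nonneg (T : Ω → Ω) (g : Ω → ℝ) (n : ℕ) (x : Ω) : 0 ≤ maxBirkhoff T g n x := by
  cases n with
  | zero => exact le_rfl
  | succ n => exact le_max_left _ _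

lemma maxBirkhoff_le_succ (T : Ω → Ω) (g : Ω → ℝ) (n : ℕ) (x : Ω) :
    maxBirkhoff T g n x ≤ maxBirkhoff T g (n + 1) x := by
  induction n generalizing x with
  | zero => exact le_max_left _ _
  | succ n ih =>
    change max 0 (g x + maxBirkhoff T g n (T x)) ≤ max 0 (g x + maxBirkhoff T g (n + 1) (T x))
    have := ih (T x)
    gcongr

lemma birkhoffSum_le_maxBirkhoff (T : Ω → Ω) (g : Ω → ℝ) (n : ℕ) (x : Ω) :
    birkhoffSum T g n x ≤ maxBirkhoff T g n x := by
  induction n generalizing x with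
  | zero => simp [maxBirkhoff]
  | succ n ih =>
    rw [birkhoffSum_succ']
    exact le_max_of_le_right (by have := ih (T x); gcongr)

variable [MeasurableSpace Ω]

lemma integrable_maxBirkhoff {T : Ω → Ω} {g : Ω → ℝ} {μ : Measure Ω}
    (hT : MeasurePreserving T μ μ) (hg : Integrable g μ) (n : ℕ) :
    Integrable (maxBirkhoff T g n) μ := by
  induction n with
  | zero => exact integrable_zero _ _ _
  | succ n ih =>
    exact (integrable_zero _ _ _).sup (hg.add (hT.integrable_comp_of_integrable ih))

lemma measurable_maxBirkhoff {T : Ω → Ω} {g : Ω → ℝ} (hT : Measurable T) (hg : Measurable g)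
    (n : ℕ) : Measurable (maxBirkhoff T g n) := by
  induction n with
  | zero => exact measurable_const
  | succ n ih => exact measurable_const.max (hg.add (ih.comp hT))

/-- The maximal ergodic theorem. -/
lemma setIntegral_maxBirkhoff_nonneg {T : Ω → Ω} {g : Ω → ℝ} {μ : Measure Ω}
    (hT : MeasurePreserving T μ μ) (hgm : Measurable g) (hg : Integrable g μ) (n : ℕ) :
    0 ≤ ∫ x in {x | 0 < maxBirkhoff T g n x}, g x ∂μ := by
  have hms : MeasurableSet {x | 0 < maxBirkhoff T g n x} :=
    measurableSet_lt measurable_const (measurable_maxBirkhoff hT.measurable hgm n)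
  have hi := integrable_maxBirkhoff hT hg n
  have hiT : Integrable (fun x => maxBirkhoff T g n (T x)) μ := hT.integrable_comp_of_integrable hi
  have hint : ∫ x, maxBirkhoff T g n (T x) ∂μ = ∫ x, maxBirkhoff T g n x ∂μ := by
    conv_rhs => rw [← hT.map_eq]
    rw [integral_map hT.measurable.aemeasurable]
    rw [hT.map_eq]
    exact hi.aestronglyMeasurable
  have h1 : ∫ x, (maxBirkhoff T g n x - maxBirkhoff T g n (T x)) ∂μ = 0 := by
    rw [integral_sub hi hiT, hint, sub_self]
  rw [← integral_indicator hms]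
  -- Where the maximal sum is positive it equals `g` plus the previous maximal sum at `T x`, and
  -- maximal sums increase with `n`, so its decrease along `T` is at most `g`. Elsewhere it vanishes
  -- and the decrease is nonpositive.
  refine h1.symm.le.trans <| integral_mono (hi.sub hiT) (hg.indicator hms) fun x => ?_
  by_cases hx : x ∈ {x | 0 < maxBirkhoff T g n x}
  · rw [indicator_of_mem hx]
    cases n with
    | zero => exact absurd (show (0 : ℝ) < 0 from hx) (lt_irrefl _)
    | succ n =>
      have hx' : 0 < max 0 (g x + maxBirkhoff T g n (T x)) := hx
      have h2 : maxBirkhoff T g (n + 1) x = g x + maxBirkhoff T g n (T x) := by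
        change max 0 (g x + maxBirkhoff T g n (T x)) = _
        rcases lt_max_iff.1 hx' with h | h
        · exact absurd h (lt_irrefl _)
        · exact max_eq_right h.le
      have h3 := maxBirkhoff_le_succ T g n (T x)
      change maxBirkhoff T g (n + 1) x - maxBirkhoff T g (n + 1) (T x) ≤ g x
      linarith
  · rw [indicator_of_notMem hx]
    have h0 : maxBirkhoff T g n x ≤ 0 := not_lt.1 hx
    have := maxBirkhoff_nonneg T g n (T x)
    change maxBirkhoff T g n x - maxBirkhoff T g n (T x) ≤ 0
    linarith

/-- The set `B` of points with bounded maximal sums is invariant, so it is null or conull. If it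
were null, the maximal sums would become positive almost everywhere, and `n → ∞` in the maximal
ergodic theorem would give `0 ≤ ∫ g`. -/
lemma ae_bddAbove_birkhoffSum {T : Ω → Ω} {g : Ω → ℝ} {μ : Measure Ω} [IsProbabilityMeasure μ]
    (hT : Ergodic T μ) (hgm : Measurable g) (hg : Integrable g μ) (hneg : ∫ x, g x ∂μ < 0) :
    ∀ᵐ x ∂μ, ∃ c : ℝ, ∀ n, birkhoffSum T g n x ≤ c := by
  set B : Set Ω := {x | ∃ c : ℕ, ∀ n, maxBirkhoff T g n x ≤ c} with hB
  have hBm : MeasurableSet B := by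
    have : B = ⋃ c : ℕ, ⋂ n, {x | maxBirkhoff T g n x ≤ c} := by ext; simp [hB]
    rw [this]
    exact .iUnion fun c => .iInter fun n =>
      measurableSet_le (measurable_maxBirkhoff hT.measurable hgm n) measurable_const
  have hinv : T ⁻¹' B = B := by
    ext x
    constructor
    · rintro ⟨c, hc⟩
      obtain ⟨k, hk⟩ := exists_nat_ge (max 0 (g x + c))
      refine ⟨k, fun n => le_trans ?_ hk⟩
      cases n with
      | zero => exact le_max_left _ _
      | succ n => exact max_le_max le_rfl (by have := hc n; gcongr)
    · rintro ⟨c, hc⟩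
      obtain ⟨k, hk⟩ := exists_nat_ge ((c : ℝ) - g x)
      refine ⟨k, fun n => ?_⟩
      have := (le_max_right 0 (g x + maxBirkhoff T g n (T x))).trans (hc (n + 1))
      linarith
  have hae : ∀ᵐ x ∂μ, x ∈ B := by
    rcases hT.toPreErgodic.prob_eq_zero_or_one hBm hinv with h0 | h1
    · exfalso
      have hlim : Tendsto (fun n => ∫ x in {x | 0 < maxBirkhoff T g n x}, g x ∂μ) atTop
          (𝓝 (∫ x in ⋃ n, {x | 0 < maxBirkhoff T g n x}, g x ∂μ)) := by
        refine tendsto_setIntegral_of_monotone (fun n => measurableSet_lt measurable_const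
          (measurable_maxBirkhoff hT.measurable hgm n)) ?_ hg.integrableOn
        refine monotone_nat_of_le_succ fun n x hx => ?_
        exact lt_of_lt_of_le hx (maxBirkhoff_le_succ T g n x)
      have hge := ge_of_tendsto' hlim fun n =>
        setIntegral_maxBirkhoff_nonneg hT.toMeasurePreserving hgm hg n
      have huniv : (⋃ n, {x | 0 < maxBirkhoff T g n x} : Set Ω) =ᵐ[μ] univ := by
        rw [eventuallyEq_univ]
        have : ∀ᵐ x ∂μ, x ∉ B := measure_eq_zero_iff_ae_notMem.1 h0
        filter_upwards [this] with x hx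
        by_contra hcon
        apply hx
        refine ⟨0, fun n => ?_⟩
        by_contra hn
        exact hcon (mem_iUnion.2 ⟨n, by simpa using hn⟩)
      rw [setIntegral_congr_set huniv, setIntegral_univ] at hge
      linarith
    · exact (prob_compl_eq_zero_iff hBm).2 h1
  filter_upwards [hae] with x hx
  obtain ⟨c, hc⟩ := hx
  exact ⟨c, fun n => (birkhoffSum_le_maxBirkhoff T g n x).trans (hc n)⟩

/-- **Birkhoff's pointwise ergodic theorem** for an ergodic map. -/
theorem ae_tendsto_birkhoffSum_div {T : Ω → Ω} {g : Ω → ℝ} {μ : Measure Ω}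
    [IsProbabilityMeasure μ] (hT : Ergodic T μ) (hgm : Measurable g) (hg : Integrable g μ) :
    ∀ᵐ x ∂μ, Tendsto (fun n : ℕ => birkhoffSum T g n x / n) atTop (𝓝 (∫ x, g x ∂μ)) := by
  set m := ∫ x, g x ∂μ with hm
  -- The shift by `1/(k+1)` makes the mean strictly negative, so the centred sums are bounded above;
  -- a bounded sum disappears after division by `n`.
  have hup : ∀ k : ℕ, ∀ᵐ x ∂μ, ∃ c : ℝ, ∀ n,
      birkhoffSum T (fun x => g x - (m + 1 / (k + 1 : ℝ))) n x ≤ c := fun k => by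
    refine ae_bddAbove_birkhoffSum hT (hgm.sub_const _) (hg.sub (integrable_const _)) ?_
    rw [integral_sub hg (integrable_const _)]
    have : (0 : ℝ) < 1 / (k + 1 : ℝ) := by positivity
    simp only [integral_const, probReal_univ, smul_eq_mul, one_mul]
    linarith
  have hlo : ∀ k : ℕ, ∀ᵐ x ∂μ, ∃ c : ℝ, ∀ n,
      birkhoffSum T (fun x => (m - 1 / (k + 1 : ℝ)) - g x) n x ≤ c := fun k => by
    refine ae_bddAbove_birkhoffSum hT (hgm.const_sub _) ((integrable_const _).sub hg) ?_
    rw [integral_sub (integrable_const _) hg]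
    have : (0 : ℝ) < 1 / (k + 1 : ℝ) := by positivity
    simp only [integral_const, probReal_univ, smul_eq_mul, one_mul]
    linarith
  filter_upwards [ae_all_iff.2 hup, ae_all_iff.2 hlo] with x h1 h2
  rw [Metric.tendsto_atTop]
  intro δ hδ
  obtain ⟨k, hk⟩ := exists_nat_one_div_lt (half_pos hδ)
  obtain ⟨c₁, hc₁⟩ := h1 k
  obtain ⟨c₂, hc₂⟩ := h2 k
  obtain ⟨N, hN⟩ := exists_nat_gt (max (max c₁ c₂) 0 / (δ / 2))
  refine ⟨N + 1, fun n hn => ?_⟩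
  have hnpos : (0 : ℝ) < n := by exact_mod_cast (by omega : 0 < n)
  have hNn : (N : ℝ) ≤ n := by exact_mod_cast (by omega : N ≤ n)
  have hc : max (max c₁ c₂) 0 < n * (δ / 2) := by
    rw [div_lt_iff₀ (half_pos hδ)] at hN
    nlinarith
  have e1 : birkhoffSum T (fun x => g x - (m + 1 / (k + 1 : ℝ))) n x
      = birkhoffSum T g n x - n * (m + 1 / (k + 1 : ℝ)) := by
    simp [birkhoffSum, Finset.sum_sub_distrib]; ring
  have e2 : birkhoffSum T (fun x => (m - 1 / (k + 1 : ℝ)) - g x) n x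
      = n * (m - 1 / (k + 1 : ℝ)) - birkhoffSum T g n x := by
    simp [birkhoffSum, Finset.sum_sub_distrib]; ring
  have a1 := hc₁ n
  have a2 := hc₂ n
  rw [e1] at a1
  rw [e2] at a2
  have b1 : c₁ < n * (δ / 2) := lt_of_le_of_lt ((le_max_left _ _).trans (le_max_left _ _)) hc
  have b2 : c₂ < n * (δ / 2) := lt_of_le_of_lt ((le_max_right _ _).trans (le_max_left _ _)) hc
  have hk' : n * (1 / (k + 1 : ℝ)) < n * (δ / 2) := by gcongr
  rw [Real.dist_eq, abs_lt]
  constructor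
  · rw [lt_sub_iff_add_lt, lt_div_iff₀ hnpos]; nlinarith
  · rw [sub_lt_iff_lt_add, div_lt_iff₀ hnpos]; nlinarith

end Birkhoff

/-! ### The natural extension: existence, ergodicity, transfer to the base. -/

section NaturalExtension

lemma proj_back_iterate (y : ℕ → ℝ) (n : ℕ) : back^[n] y = fun i => y (i + n) := by
  induction n generalizing y with
  | zero => rfl
  | succ n ih =>
    rw [Function.iterate_succ_apply, ih]
    funext i
    simp only [back]
    exact congrArg y (by omega)

lemma back_iterate_apply (y : ℕ → ℝ) (n i : ℕ) : back^[n] y i = y (i + n) := by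
  rw [proj_back_iterate]

lemma proj_back_iterate_eq (y : ℕ → ℝ) (n : ℕ) : proj (back^[n] y) = y n := by
  rw [proj, back_iterate_apply, zero_add]

lemma back_forth (f : ℝ → ℝ) (y : ℕ → ℝ) : back (forth f y) = y := rfl

lemma forth_back {D : Set ℝ} {f : ℝ → ℝ} {y : ℕ → ℝ} (hy : y ∈ backwardOrbits D f) :
    forth f (back y) = y := by
  funext i
  cases i with
  | zero => exact (hy 0).2
  | succ i => rfl

lemma back_iterate_forth_iterate (f : ℝ → ℝ) (y : ℕ → ℝ) (n : ℕ) :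
    back^[n] ((forth f)^[n] y) = y :=
  Function.LeftInverse.iterate (back_forth f) n y

lemma proj_forth_iterate (f : ℝ → ℝ) (y : ℕ → ℝ) (n : ℕ) :
    proj ((forth f)^[n] y) = f^[n] (proj y) := by
  induction n generalizing y with
  | zero => rfl
  | succ n ih => rw [Function.iterate_succ_apply, ih]; rfl

lemma back_mem {D : Set ℝ} {f : ℝ → ℝ} {y : ℕ → ℝ} (hy : y ∈ backwardOrbits D f) :
    back y ∈ backwardOrbits D f := fun i => hy (i + 1)

lemma back_iterate_mem {D : Set ℝ} {f : ℝ → ℝ} {y : ℕ → ℝ} (hy : y ∈ backwardOrbits D f) (n : ℕ) :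
    back^[n] y ∈ backwardOrbits D f := by
  induction n generalizing y with
  | zero => exact hy
  | succ n ih => exact ih (back_mem hy)

lemma iterate_apply_of_mem {D : Set ℝ} {f : ℝ → ℝ} {y : ℕ → ℝ} (hy : y ∈ backwardOrbits D f)
    (n i : ℕ) : f^[n] (y (n + i)) = y i := by
  induction n generalizing i with
  | zero => simp
  | succ n ih =>
    rw [Function.iterate_succ_apply, show n + 1 + i = n + i + 1 by omega, (hy (n + i)).2, ih]

lemma mem_iterDom_of_mem {D : Set ℝ} {f : ℝ → ℝ} {y : ℕ → ℝ} (hy : y ∈ backwardOrbits D f)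
    (n : ℕ) : y n ∈ iterDom D f n := by
  intro i hi
  have := iterate_apply_of_mem hy i (n - i)
  rw [show i + (n - i) = n by omega] at this
  rw [this]
  have := (hy (n - i - 1)).1
  rwa [show n - i - 1 + 1 = n - i by omega] at this

lemma measurable_back : Measurable back := measurable_pi_lambda _ fun _ => measurable_pi_apply _

lemma measurable_proj : Measurable proj := measurable_pi_apply 0

lemma measurable_forth {f : ℝ → ℝ} (hf : Measurable f) : Measurable (forth f) := by
  refine measurable_pi_lambda _ fun i => ?_
  cases i with
  | zero => exact hf.comp (measurable_pi_apply 0)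
  | succ i => exact measurable_pi_apply i

lemma measurableSet_backwardOrbits {D : Set ℝ} (hD : MeasurableSet D) {f : ℝ → ℝ}
    (hf : Measurable f) : MeasurableSet (backwardOrbits D f) := by
  have : backwardOrbits D f = ⋂ i, ({y | y (i + 1) ∈ D} ∩ {y | f (y (i + 1)) = y i}) := by
    ext y; simp [backwardOrbits]
  rw [this]
  exact .iInter fun i => (measurable_pi_apply (i + 1) hD).inter
    (measurableSet_eq_fun (hf.comp (measurable_pi_apply (i + 1))) (measurable_pi_apply i))

/-- The backward orbit of length `n` that ends at `x`. -/
def orbitSegment (f : ℝ → ℝ) (n : ℕ) (x : ℝ) : (i : Finset.Iic n) → ℝ := fun i => f^[n - i] x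

lemma measurable_orbitSegment {f : ℝ → ℝ} (hf : Measurable f) (n : ℕ) :
    Measurable (orbitSegment f n) :=
  measurable_pi_lambda _ fun _ => hf.iterate _

/-- Two measures on sequences with the same finite-dimensional laws are equal. -/
lemma measure_eq_of_map_frestrictLe {ν ν' : Measure (ℕ → ℝ)} [IsFiniteMeasure ν]
    (h : ∀ n, ν.map (Preorder.frestrictLe n) = ν'.map (Preorder.frestrictLe n)) : ν = ν' := by
  have h1 : IsProjectiveLimit ν (fun I => ν.map I.restrict) := fun I => rfl
  have h2 : IsProjectiveLimit ν' (fun I => ν.map I.restrict) := by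
    have hpf : IsProjectiveMeasureFamily (α := fun _ : ℕ => ℝ) (fun I => ν.map I.restrict) := by
      intro I J hJI
      change ν.map J.restrict = (ν.map I.restrict).map (Finset.restrict₂ (π := fun _ : ℕ => ℝ) hJI)
      have h1 : Measurable (Finset.restrict₂ (π := fun _ : ℕ => ℝ) hJI) :=
        Finset.measurable_restrict₂ hJI
      have h2 : Measurable (I.restrict (π := fun _ : ℕ => ℝ)) := Finset.measurable_restrict I
      exact (Measure.map_map (μ := ν) h1 h2).symm
    rw [isProjectiveLimit_nat_iff hpf]
    intro n
    rw [← h n]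
    rfl
  have : ∀ I : Finset ℕ, IsFiniteMeasure (ν.map (I.restrict (π := fun _ : ℕ => ℝ))) :=
    fun I => inferInstance
  exact h1.unique h2

/-- Ionescu-Tulcea construction: `K` is the conditional law of `x` given `f x`, and `ν` is the law
of the chain with initial law `μ` and transitions `K`. Its first `n + 1` coordinates have the law of
`(f^n x, …, f x, x)` under `μ`, and all claims about `ν` are read off from these finite-dimensional
laws. -/
theorem exists_isNaturalExtension {D : Set ℝ} (hD : MeasurableSet D) {f : ℝ → ℝ} (μ : Measure ℝ)
    [IsProbabilityMeasure μ] (hf : MeasurePreserving f μ μ) (hdom : ∀ᵐ x ∂μ, x ∈ D) :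
    ∃ ν : Measure (ℕ → ℝ), IsProbabilityMeasure ν ∧ IsNaturalExtension D f μ ν := by
  have hfm := hf.measurable
  let K : Kernel ℝ ℝ := condDistrib (fun x => x) f μ
  have hK : μ ⊗ₘ K = μ.map (fun x => (f x, x)) := by
    have := compProd_map_condDistrib (mβ := inferInstance) (μ := μ) (X := f) (Y := fun x => x) aemeasurable_id
    rwa [hf.map_eq] at this
  let κ : (n : ℕ) → Kernel ((i : Finset.Iic n) → ℝ) ℝ := fun n =>
    K.comap (fun z => z ⟨n, Finset.mem_Iic.2 le_rfl⟩) (measurable_pi_apply _)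
  have : ∀ n, IsMarkovKernel (κ n) := fun n => inferInstance
  let ν : Measure (ℕ → ℝ) := Kernel.trajMeasure (X := fun _ => ℝ) μ κ
  have hν : IsProbabilityMeasure ν := inferInstance
  have law : ∀ n, ν.map (Preorder.frestrictLe n) = μ.map (orbitSegment f n) := by
    intro n
    induction n with
    | zero =>
      have h0 : ν.map (fun y => y 0) = μ := by
        have := Kernel.traj_map_frestrictLe (X := fun _ => ℝ) (κ := κ) 0 0
        change Measure.map (fun y : ℕ → ℝ => y 0)
          ((Kernel.traj (X := fun _ => ℝ) κ 0) ∘ₘ (μ.map (MeasurableEquiv.piUnique (fun _ : Finset.Iic 0 => ℝ)).symm)) = μ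
        have e0 : (fun y : ℕ → ℝ => y 0)
            = (MeasurableEquiv.piUnique (fun _ : Finset.Iic 0 => ℝ)) ∘ Preorder.frestrictLe 0 := rfl
        rw [e0, ← Measure.map_map (by fun_prop) (by fun_prop),
          Measure.map_comp _ _ (by fun_prop), this, Kernel.partialTraj_self]
        rw [Measure.id_comp, MeasurableEquiv.map_map_symm]
      rw [← h0, Measure.map_map (measurable_orbitSegment hfm 0) (by fun_prop)]
      congr 1
      funext y i
      have hi : (i : ℕ) = 0 := Nat.le_zero.1 (Finset.mem_Iic.1 i.2)
      simp [orbitSegment, hi]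
    | succ n ih =>
      have h1 := Kernel.map_frestrictLe_trajMeasure_compProd_eq_map_trajMeasure
        (X := fun _ => ℝ) (μ₀ := μ) (κ := κ) (a := n)
      change ν.map (Preorder.frestrictLe n) ⊗ₘ κ n
        = ν.map (fun x => (Preorder.frestrictLe n x, x (n + 1))) at h1
      have h2 : ν.map (Preorder.frestrictLe n) ⊗ₘ κ n
          = μ.map (fun x => (orbitSegment f n (f x), x)) := by
        rw [ih]
        have hm : Measurable (Prod.map (orbitSegment f n) (id : ℝ → ℝ)) :=
          (measurable_orbitSegment hfm n).prodMap measurable_id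
        have e1 : (fun x => (orbitSegment f n (f x), x))
          = Prod.map (orbitSegment f n) id ∘ (fun x => (f x, x)) := rfl
        rw [e1, ← Measure.map_map hm (hfm.prodMk measurable_id'), ← hK]
        refine Measure.ext_of_lintegral _ fun g hg => ?_
        rw [lintegral_map hg hm, Measure.lintegral_compProd hg,
          Measure.lintegral_compProd (f := fun z => g (Prod.map (orbitSegment f n) id z))
            (hg.comp hm), lintegral_map _ (measurable_orbitSegment hfm n)]
        · refine lintegral_congr fun x => ?_
          rw [Kernel.comap_apply]
          simp [orbitSegment]
        · exact hg.lintegral_kernel_prod_right'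
      rw [h2] at h1
      let join : ((i : Finset.Iic n) → ℝ) × ℝ → (i : Finset.Iic (n + 1)) → ℝ := fun z i =>
        if h : (i : ℕ) ≤ n then z.1 ⟨i, Finset.mem_Iic.2 h⟩ else z.2
      have hj : Measurable join := by
        refine measurable_pi_lambda _ fun i => ?_
        by_cases h : (i : ℕ) ≤ n
        · simp only [join, h, dite_true]
          fun_prop
        · simp only [join, h, dite_false]
          fun_prop
      have h3 := congrArg (Measure.map join) h1
      rw [Measure.map_map hj (f := fun x => (orbitSegment f n (f x), x)) (((measurable_orbitSegment hfm n).comp hfm).prodMk measurable_id'),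
        Measure.map_map hj (by fun_prop)] at h3
      convert h3.symm using 2
      · funext y i
        by_cases h : (i : ℕ) ≤ n
        · simp [join, h, Preorder.frestrictLe]
        · have hi : (i : ℕ) = n + 1 := by have := Finset.mem_Iic.1 i.2; omega
          simp [join, Preorder.frestrictLe, hi]
      · funext y i
        by_cases h : (i : ℕ) ≤ n
        · simp only [join, h, Function.comp, orbitSegment, dite_true]
          rw [← Function.iterate_succ_apply]
          congr 2
          omega
        · have hi : (i : ℕ) = n + 1 := by have := Finset.mem_Iic.1 i.2; omega
          simp [join, orbitSegment, hi]
  have hproj : ν.map proj = μ := by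
    have h1 : proj = (fun z : (i : Finset.Iic 0) → ℝ => z ⟨0, Finset.mem_Iic.2 le_rfl⟩) ∘
      Preorder.frestrictLe 0 := rfl
    rw [h1, ← Measure.map_map (by fun_prop) (by fun_prop), law 0,
      Measure.map_map (by fun_prop) (measurable_orbitSegment hfm 0)]
    exact Measure.map_id
  refine ⟨ν, hν, ?_, ⟨measurable_forth hfm, ?_⟩, hproj⟩
  · refine ae_all_iff.2 fun i => ?_
    have hcoord : ∀ j, Measurable fun z : (j : Finset.Iic (i + 1)) → ℝ => z j :=
      fun j => measurable_pi_apply j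
    have hms : MeasurableSet {z : (j : Finset.Iic (i + 1)) → ℝ |
        z ⟨i + 1, Finset.mem_Iic.2 le_rfl⟩ ∈ D ∧
          f (z ⟨i + 1, Finset.mem_Iic.2 le_rfl⟩) = z ⟨i, Finset.mem_Iic.2 (Nat.le_succ i)⟩} :=
      (hcoord _ hD).inter (measurableSet_eq_fun (hfm.comp (hcoord _)) (hcoord _))
    have h1 : ∀ᵐ z ∂(ν.map (Preorder.frestrictLe (i + 1))),
        z ⟨i + 1, Finset.mem_Iic.2 le_rfl⟩ ∈ D ∧
          f (z ⟨i + 1, Finset.mem_Iic.2 le_rfl⟩) = z ⟨i, Finset.mem_Iic.2 (Nat.le_succ i)⟩ := by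
      rw [law, ae_map_iff (measurable_orbitSegment hfm _).aemeasurable hms]
      filter_upwards [hdom] with x hx
      simpa [orbitSegment] using hx
    exact (ae_map_iff (by fun_prop) hms).1 h1
  · have : IsProbabilityMeasure (ν.map (forth f)) :=
      Measure.isProbabilityMeasure_map (measurable_forth hfm).aemeasurable
    refine measure_eq_of_map_frestrictLe fun n => ?_
    -- `shift` is `F` on the first `n + 1` coordinates; `orbitSegment` conjugates it to `f`, so
    -- invariance of `μ` gives invariance of `ν`.
    let shift : ((i : Finset.Iic n) → ℝ) → (i : Finset.Iic n) → ℝ := fun z i =>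
      if h : (i : ℕ) = 0 then f (z ⟨0, Finset.mem_Iic.2 (Nat.zero_le n)⟩)
      else z ⟨i - 1, Finset.mem_Iic.2 (by have := Finset.mem_Iic.1 i.2; omega)⟩
    have hsm : Measurable shift := by
      refine measurable_pi_lambda _ fun i => ?_
      by_cases h : (i : ℕ) = 0
      · simp only [shift, h, dite_true]
        exact hfm.comp (measurable_pi_apply _)
      · simp only [shift, h, dite_false]
        fun_prop
    have e1 : Preorder.frestrictLe n ∘ forth f = shift ∘ Preorder.frestrictLe (π := fun _ => ℝ) n := by
      funext y i
      obtain ⟨i, hi⟩ := i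
      cases i with
      | zero => simp [shift, Preorder.frestrictLe, forth]
      | succ i => simp [shift, Preorder.frestrictLe, forth]
    have e2 : shift ∘ orbitSegment f n = orbitSegment f n ∘ f := by
      funext x i
      obtain ⟨i, hi⟩ := i
      have hi' := Finset.mem_Iic.1 hi
      cases i with
      | zero =>
        simp only [shift, Function.comp, orbitSegment, dite_true, Nat.sub_zero]
        rw [← Function.iterate_succ_apply' f, Function.iterate_succ_apply]
      | succ i =>
        simp only [shift, Function.comp, orbitSegment, Nat.add_one_ne_zero, dite_false]
        rw [← Function.iterate_succ_apply]
        congr 2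
        omega
    rw [Measure.map_map (by fun_prop) (measurable_forth hfm), e1,
      ← Measure.map_map hsm (by fun_prop), law,
      Measure.map_map hsm (measurable_orbitSegment hfm n), e2,
      ← Measure.map_map (measurable_orbitSegment hfm n) hfm, hf.map_eq]

lemma IsNaturalExtension.measurePreserving_back {D : Set ℝ} {f : ℝ → ℝ} {μ : Measure ℝ}
    {ν : Measure (ℕ → ℝ)} (hν : IsNaturalExtension D f μ ν) : MeasurePreserving back ν ν := by
  refine ⟨measurable_back, ?_⟩
  conv_lhs => rw [← hν.invariant.map_eq]
  rw [Measure.map_map measurable_back hν.invariant.measurable]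
  exact Measure.map_id

lemma IsNaturalExtension.measurePreserving_proj {D : Set ℝ} {f : ℝ → ℝ} {μ : Measure ℝ}
    {ν : Measure (ℕ → ℝ)} (hν : IsNaturalExtension D f μ ν) : MeasurePreserving proj ν μ :=
  ⟨measurable_proj, hν.map_proj⟩

lemma IsNaturalExtension.measurePreserving_eval {D : Set ℝ} {f : ℝ → ℝ} {μ : Measure ℝ}
    {ν : Measure (ℕ → ℝ)} (hν : IsNaturalExtension D f μ ν) (n : ℕ) :
    MeasurePreserving (fun y => y n) ν μ := by
  have := hν.measurePreserving_proj.comp (hν.measurePreserving_back.iterate n)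
  convert this using 2 with y
  exact (proj_back_iterate_eq y n).symm

/-- Measurable sets of backward orbits that are invariant modulo null sets are trivial. -/
lemma IsNaturalExtension.ae_empty_or_univ {D : Set ℝ} {f : ℝ → ℝ} {μ : Measure ℝ}
    {ν : Measure (ℕ → ℝ)} [IsProbabilityMeasure ν] (hν : IsNaturalExtension D f μ ν)
    (herg : Ergodic f μ) {S : Set (ℕ → ℝ)} (hS : MeasurableSet S) (hinv : back ⁻¹' S =ᵐ[ν] S) :
    S =ᵐ[ν] (∅ : Set (ℕ → ℝ)) ∨ S =ᵐ[ν] univ := by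
  have hback := hν.measurePreserving_back
  -- A cylinder that approximates `S` depends on `y 0, …, y n`, all of which are functions of `y n`.
  -- It is therefore the preimage under `back^[n]` of a set seen by `proj` alone; since `S` is
  -- invariant under `back^[n]`, that set approximates `S` equally well.
  have happ : ∀ δ : ℝ, 0 < δ → ∃ B : Set ℝ, MeasurableSet B ∧
      ν (symmDiff S (proj ⁻¹' B)) ≤ ENNReal.ofReal δ := by
    intro δ hδ
    have hdense : ν.MeasureDense (measurableCylinders (fun _ : ℕ => ℝ)) :=
      Measure.MeasureDense.of_generateFrom_isSetAlgebra_finite ν isSetAlgebra_measurableCylinders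
        generateFrom_measurableCylinders.symm
    obtain ⟨t, ht, htS⟩ := hdense.approx S hS (measure_ne_top _ _) δ hδ
    rw [measurableCylinders_nat] at ht
    simp only [mem_iUnion, mem_singleton_iff, exists_prop] at ht
    obtain ⟨n, T, hT, rfl⟩ := ht
    refine ⟨orbitSegment f n ⁻¹' T, measurable_orbitSegment herg.measurable n hT, ?_⟩
    have hit : back^[n] ⁻¹' S =ᵐ[ν] S := hback.quasiMeasurePreserving.preimage_iterate_ae_eq n hinv
    have hcyl : MeasureTheory.cylinder (Finset.Iic n) T =ᵐ[ν] back^[n] ⁻¹' (proj ⁻¹' (orbitSegment f n ⁻¹' T)) := by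
      filter_upwards [hν.supported] with y hy
      change ((Finset.Iic n).restrict y ∈ T) = (orbitSegment f n (proj (back^[n] y)) ∈ T)
      congr 1
      funext i
      rw [proj_back_iterate_eq]
      have := iterate_apply_of_mem hy (n - i) i
      rw [Nat.sub_add_cancel (Finset.mem_Iic.1 i.2)] at this
      exact this.symm
    have hBm := measurable_proj (measurable_orbitSegment herg.measurable n hT)
    rw [← (hback.iterate n).measure_preimage (hS.symmDiff hBm).nullMeasurableSet,
      preimage_symmDiff, ← measure_congr (hit.symm.symmDiff hcyl)]
    exact htS.le
  -- The errors are summable. By Borel–Cantelli, almost every `y` is in `S` exactly when `proj y` is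
  -- in infinitely many `B k`, so `S` is a preimage under `proj` modulo a null set and ergodicity of
  -- `f` applies.
  choose B hB hSB using fun k : ℕ => happ ((1 / 2) ^ k) (by positivity)
  have hlim : ν (limsup (fun k => symmDiff S (proj ⁻¹' B k)) atTop) = 0 := by
    refine measure_limsup_atTop_eq_zero (ne_top_of_le_ne_top ?_ (ENNReal.tsum_le_tsum hSB))
    rw [← ENNReal.ofReal_tsum_of_nonneg (fun n => by positivity) summable_geometric_two]
    exact ENNReal.ofReal_ne_top
  set E : Set ℝ := {x | ∃ᶠ k in atTop, x ∈ B k} with hE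
  have hEm : MeasurableSet E := by
    have : E = limsup B atTop := by ext x; simp [hE, mem_limsup_iff_frequently_mem]
    rw [this]
    exact MeasurableSet.measurableSet_limsup hB
  have hSE : S =ᵐ[ν] proj ⁻¹' E := by
    filter_upwards [measure_eq_zero_iff_ae_notMem.1 hlim] with y hy
    rw [mem_limsup_iff_frequently_mem, not_frequently] at hy
    have hy' : ∀ᶠ k in atTop, (proj y ∈ B k ↔ y ∈ S) := by
      filter_upwards [hy] with k hk
      rw [mem_symmDiff] at hk
      simp only [mem_preimage] at hk
      tauto
    change (y ∈ S) = (∃ᶠ k in atTop, proj y ∈ B k)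
    rw [frequently_congr hy']
    simp
  have hEinv : f ⁻¹' E =ᵐ[μ] E := by
    have h1 : proj ⁻¹' (f ⁻¹' E) =ᵐ[ν] proj ⁻¹' E := by
      have a1 : forth f ⁻¹' S =ᵐ[ν] proj ⁻¹' (f ⁻¹' E) :=
        hν.invariant.quasiMeasurePreserving.preimage_ae_eq hSE
      have a2 : forth f ⁻¹' (back ⁻¹' S) =ᵐ[ν] forth f ⁻¹' S :=
        hν.invariant.quasiMeasurePreserving.preimage_ae_eq hinv
      exact a1.symm.trans (a2.symm.trans hSE)
    have h2 : ν (proj ⁻¹' symmDiff (f ⁻¹' E) E) = 0 := by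
      rw [preimage_symmDiff]; exact measure_symmDiff_eq_zero_iff.2 h1
    rw [hν.measurePreserving_proj.measure_preimage
      ((herg.measurable hEm).symmDiff hEm).nullMeasurableSet] at h2
    exact measure_symmDiff_eq_zero_iff.1 h2
  rcases herg.quasiErgodic.ae_empty_or_univ₀ hEm.nullMeasurableSet hEinv with h | h
  · exact Or.inl (hSE.trans (hν.measurePreserving_proj.quasiMeasurePreserving.preimage_ae_eq h))
  · exact Or.inr (hSE.trans (hν.measurePreserving_proj.quasiMeasurePreserving.preimage_ae_eq h))

lemma IsNaturalExtension.ergodic_back {D : Set ℝ} {f : ℝ → ℝ} {μ : Measure ℝ}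
    {ν : Measure (ℕ → ℝ)} [IsProbabilityMeasure ν] (hν : IsNaturalExtension D f μ ν)
    (herg : Ergodic f μ) : Ergodic back ν where
  toMeasurePreserving := hν.measurePreserving_back
  aeconst_set := fun _ hs h => eventuallyConst_set'.2 (hν.ae_empty_or_univ herg hs (Filter.EventuallyEq.of_eq h))

lemma IsNaturalExtension.ergodic_forth {D : Set ℝ} {f : ℝ → ℝ} {μ : Measure ℝ}
    {ν : Measure (ℕ → ℝ)} [IsProbabilityMeasure ν] (hν : IsNaturalExtension D f μ ν)
    (herg : Ergodic f μ) : Ergodic (forth f) ν where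
  toMeasurePreserving := hν.invariant
  aeconst_set := fun s hs h => eventuallyConst_set'.2 <| hν.ae_empty_or_univ herg hs <| by
    filter_upwards [hν.supported] with y hy
    change (back y ∈ s) = (y ∈ s)
    conv_lhs => rw [← h]
    rw [mem_preimage, forth_back hy]

/-- A property that holds for almost every backward orbit holds, for almost every point, for some
backward orbit of this point. -/
lemma IsNaturalExtension.ae_exists {D : Set ℝ} {f : ℝ → ℝ} {μ : Measure ℝ}
    {ν : Measure (ℕ → ℝ)} [IsProbabilityMeasure ν] (hν : IsNaturalExtension D f μ ν)
    {p : (ℕ → ℝ) → Prop} (hp : ∀ᵐ y ∂ν, p y) : ∀ᵐ x ∂μ, ∃ y, proj y = x ∧ p y := by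
  obtain ⟨N, hN, hNm, hN0⟩ := exists_measurable_superset_of_null (ae_iff.1 hp)
  -- Disintegration over `proj`: for almost every `x` the conditional measure is a probability
  -- carried by the fibre over `x` and avoiding `N`, so a suitable orbit exists.
  have h1 := compProd_map_condDistrib (mβ := inferInstance) (μ := ν) (X := proj) (Y := fun y => y) aemeasurable_id
  have hm : MeasurableSet {z : ℝ × (ℕ → ℝ) | proj z.2 = z.1 ∧ z.2 ∉ N} :=
    (measurableSet_eq_fun (measurable_proj.comp measurable_snd) measurable_fst).inter
      (measurable_snd hNm.compl)
  have h2 : ∀ᵐ z ∂(ν.map proj ⊗ₘ condDistrib (fun y => y) proj ν),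
      proj z.2 = z.1 ∧ z.2 ∉ N := by
    rw [h1, ae_map_iff (measurable_proj.prodMk measurable_id').aemeasurable hm]
    filter_upwards [measure_eq_zero_iff_ae_notMem.1 hN0] with y hy using ⟨rfl, hy⟩
  have h3 := Measure.ae_ae_of_ae_compProd h2
  rw [hν.map_proj] at h3
  filter_upwards [h3] with x hx
  obtain ⟨y, hy, hyN⟩ := hx.exists
  exact ⟨y, hy, by by_contra h; exact hyN (hN h)⟩

end NaturalExtension

/-! ### Iterates, branches, and nesting of pullbacks of a regularly returning interval. -/

section Branches

variable {ι : Type*} {a b : ℝ} {p q : ι → ℝ} {f : ℝ → ℝ} {𝒬 : Set (Set ℝ)} {u v : ℝ}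

lemma isOpen_dom : IsOpen (dom p q) := isOpen_iUnion fun _ => isOpen_Ioo

lemma mem_dom_iff {x : ℝ} : x ∈ dom p q ↔ ∃ j, x ∈ Ioo (p j) (q j) := mem_iUnion

lemma Ioo_subset_dom (j : ι) : Ioo (p j) (q j) ⊆ dom p q :=
  subset_iUnion (fun j => Ioo (p j) (q j)) j

lemma iterDom_zero (D : Set ℝ) (f : ℝ → ℝ) : iterDom D f 0 = univ := by
  ext; simp [iterDom]

lemma mem_iterDom_succ {D : Set ℝ} {f : ℝ → ℝ} {n : ℕ} {x : ℝ} :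
    x ∈ iterDom D f (n + 1) ↔ x ∈ D ∧ f x ∈ iterDom D f n := by
  constructor
  · intro h
    exact ⟨h 0 (Nat.succ_pos n), fun i hi => h (i + 1) (Nat.succ_lt_succ hi)⟩
  · rintro ⟨h0, h⟩ i hi
    cases i with
    | zero => exact h0
    | succ i => exact h i (Nat.lt_of_succ_lt_succ hi)

lemma iterDom_antitone (D : Set ℝ) (f : ℝ → ℝ) : Antitone (iterDom D f) :=
  fun _ _ hmn _ hx i hi => hx i (hi.trans_le hmn)

lemma iterate_mem_iterDom {D : Set ℝ} {f : ℝ → ℝ} {n i : ℕ} {x : ℝ} (hx : x ∈ iterDom D f n)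
    (hi : i ≤ n) : f^[i] x ∈ iterDom D f (n - i) := by
  intro k hk
  rw [← Function.iterate_add_apply]
  exact hx (k + i) (by omega)

namespace IsBasicCuspMap

variable (hf : IsBasicCuspMap a b p q f)
include hf

lemma contDiffAt {x : ℝ} (hx : x ∈ dom p q) : ContDiffAt ℝ 1 f x := by
  obtain ⟨j, hj⟩ := mem_dom_iff.1 hx
  exact (hf.contDiffOn j).contDiffAt (isOpen_Ioo.mem_nhds hj)

lemma hasStrictDerivAt {x : ℝ} (hx : x ∈ dom p q) : HasStrictDerivAt f (deriv f x) x :=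
  (hf.contDiffAt hx).hasStrictDerivAt one_ne_zero

lemma continuousAt {x : ℝ} (hx : x ∈ dom p q) : ContinuousAt f x :=
  (hf.contDiffAt hx).continuousAt

lemma deriv_ne {x : ℝ} (hx : x ∈ dom p q) : deriv f x ≠ 0 := by
  obtain ⟨j, hj⟩ := mem_dom_iff.1 hx
  exact hf.deriv_ne_zero j x hj

lemma continuousAt_deriv {x : ℝ} (hx : x ∈ dom p q) : ContinuousAt (deriv f) x := by
  obtain ⟨j, hj⟩ := mem_dom_iff.1 hx
  exact ((hf.contDiffOn j).continuousOn_deriv_of_isOpen isOpen_Ioo le_rfl).continuousAt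
    (isOpen_Ioo.mem_nhds hj)

lemma hasStrictDerivAt_iterate {n : ℕ} {x : ℝ} (hx : x ∈ iterDom (dom p q) f n) :
    HasStrictDerivAt f^[n] (∏ i ∈ Finset.range n, deriv f (f^[i] x)) x := by
  induction n generalizing x with
  | zero => simpa using hasStrictDerivAt_id x
  | succ n ih =>
    obtain ⟨h0, h1⟩ := mem_iterDom_succ.1 hx
    have := (ih h1).comp x (hf.hasStrictDerivAt h0)
    rw [Finset.prod_range_succ']
    exact this

lemma deriv_iterate {n : ℕ} {x : ℝ} (hx : x ∈ iterDom (dom p q) f n) :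
    deriv f^[n] x = ∏ i ∈ Finset.range n, deriv f (f^[i] x) :=
  (hf.hasStrictDerivAt_iterate hx).hasDerivAt.deriv

lemma hasStrictDerivAt_iterate' {n : ℕ} {x : ℝ} (hx : x ∈ iterDom (dom p q) f n) :
    HasStrictDerivAt f^[n] (deriv f^[n] x) x := by
  rw [hf.deriv_iterate hx]; exact hf.hasStrictDerivAt_iterate hx

lemma hasDerivAt_iterate {n : ℕ} {x : ℝ} (hx : x ∈ iterDom (dom p q) f n) :
    HasDerivAt f^[n] (deriv f^[n] x) x := (hf.hasStrictDerivAt_iterate' hx).hasDerivAt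

lemma deriv_iterate_ne {n : ℕ} {x : ℝ} (hx : x ∈ iterDom (dom p q) f n) :
    deriv f^[n] x ≠ 0 := by
  rw [hf.deriv_iterate hx]
  exact Finset.prod_ne_zero_iff.2 fun i hi => hf.deriv_ne (hx i (Finset.mem_range.1 hi))

lemma continuousAt_iterate {n : ℕ} {x : ℝ} (hx : x ∈ iterDom (dom p q) f n) :
    ContinuousAt f^[n] x := (hf.hasDerivAt_iterate hx).continuousAt

lemma deriv_iterate_orbit {y : ℕ → ℝ} (hy : y ∈ backwardOrbits (dom p q) f) (n : ℕ) :
    deriv f^[n] (y n) = ∏ i ∈ Finset.range n, deriv f (y (i + 1)) := by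
  rw [hf.deriv_iterate (mem_iterDom_of_mem hy n), ← Finset.prod_range_reflect]
  refine Finset.prod_congr rfl fun i hi => ?_
  have hi' := Finset.mem_range.1 hi
  have := iterate_apply_of_mem hy (n - 1 - i) (i + 1)
  rw [show n - 1 - i + (i + 1) = n by omega] at this
  rw [this]

lemma log_deriv_iterate_orbit {y : ℕ → ℝ} (hy : y ∈ backwardOrbits (dom p q) f) (n : ℕ) :
    Real.log |deriv f^[n] (y n)| = ∑ i ∈ Finset.range n, Real.log |deriv f (y (i + 1))| := by
  rw [hf.deriv_iterate_orbit hy, Finset.abs_prod, Real.log_prod]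
  intro i _
  exact abs_ne_zero.2 (hf.deriv_ne (hy i).1)

lemma subset_branch_of_isPreconnected {W : Set ℝ} (hW : IsPreconnected W) (hWD : W ⊆ dom p q)
    {j : ι} (hj : (W ∩ Ioo (p j) (q j)).Nonempty) : W ⊆ Ioo (p j) (q j) := by
  refine hW.subset_left_of_subset_union isOpen_Ioo
    (v := ⋃ k : {k // k ≠ j}, Ioo (p k) (q k)) (isOpen_iUnion fun _ => isOpen_Ioo) ?_ ?_ hj
  · exact disjoint_iUnion_right.2 fun k => hf.disjoint k.2.symm
  · intro x hx
    obtain ⟨k, hk⟩ := mem_dom_iff.1 (hWD hx)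
    by_cases h : k = j
    · exact Or.inl (h ▸ hk)
    · exact Or.inr (mem_iUnion.2 ⟨⟨k, h⟩, hk⟩)

lemma exists_branch_of_isPreconnected {W : Set ℝ} (hW : IsPreconnected W) (hWD : W ⊆ dom p q)
    (hne : W.Nonempty) : ∃ j, W ⊆ Ioo (p j) (q j) := by
  obtain ⟨x, hx⟩ := hne
  obtain ⟨j, hj⟩ := mem_dom_iff.1 (hWD hx)
  exact ⟨j, hf.subset_branch_of_isPreconnected hW hWD ⟨x, hx, hj⟩⟩

lemma isPreconnected_iterate_image {n i : ℕ} {W : Set ℝ} (hW : IsPreconnected W)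
    (hWD : W ⊆ iterDom (dom p q) f n) (hi : i ≤ n) : IsPreconnected (f^[i] '' W) :=
  hW.image _ fun _ hx =>
    (hf.continuousAt_iterate (iterDom_antitone _ _ hi (hWD hx))).continuousWithinAt

/-- The source of a diffeomorphism onto a connected set is connected. -/
lemma isPreconnected_of_iterDiffeo {n : ℕ} {W V : Set ℝ} (h : IterDiffeo (dom p q) f n W V)
    (hV : IsPreconnected V) : IsPreconnected W := by
  -- By the inverse function theorem the restriction of `f^[n]` to `W` is open; being injective, it
  -- carries connectedness back from `V`.
  have hinj : Function.Injective (W.domRestrict f^[n]) := injOn_iff_injective.1 h.bijOn.injOn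
  have hopen : IsOpenMap (W.domRestrict f^[n]) := by
    rw [isOpenMap_iff_nhds_le]
    intro x
    have h1 := (hf.hasStrictDerivAt_iterate' (h.subset x.2)).map_nhds_eq
      (hf.deriv_iterate_ne (h.subset x.2))
    have h2 : map (Subtype.val : W → ℝ) (𝓝 x) = 𝓝 (x : ℝ) := h.isOpen.isOpenEmbedding_subtypeVal.map_nhds_eq x
    change 𝓝 (f^[n] x) ≤ map (f^[n] ∘ Subtype.val) (𝓝 x)
    rw [← Filter.map_map, h2, h1]
  have h1 := hV.preimage_of_isOpenMap hinj hopen (by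
    rw [Set.range_domRestrict]; exact h.bijOn.image_eq.ge)
  have h2 : W.domRestrict f^[n] ⁻¹' V = univ := by
    ext x; simpa using h.bijOn.mapsTo x.2
  rw [h2] at h1
  have := h1.image Subtype.val continuous_subtype_val.continuousOn
  simpa using this

lemma iterDiffeo_inter_preimage {n : ℕ} {W V U : Set ℝ} (h : IterDiffeo (dom p q) f n W V)
    (hU : IsOpen U) (hUV : U ⊆ V) : IterDiffeo (dom p q) f n (W ∩ f^[n] ⁻¹' U) U where
  isOpen := ContinuousOn.isOpen_inter_preimage
    (fun x hx => (hf.continuousAt_iterate (h.subset hx)).continuousWithinAt) h.isOpen hU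
  subset := inter_subset_left.trans h.subset
  bijOn := by
    refine ⟨fun x hx => hx.2, h.bijOn.injOn.mono inter_subset_left, fun z hz => ?_⟩
    obtain ⟨x, hx, rfl⟩ := h.bijOn.surjOn (hUV hz)
    exact ⟨x, ⟨hx, hz⟩, rfl⟩

end IsBasicCuspMap

lemma IsBranchPartition.eq_of_mem (hQ : IsBranchPartition p q f 𝒬) {Q Q' : Set ℝ} (h : Q ∈ 𝒬)
    (h' : Q' ∈ 𝒬) {x : ℝ} (hx : x ∈ Q) (hx' : x ∈ Q') : Q = Q' :=
  hQ.disjoint.elim_set h h' x hx hx'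

lemma IsBranchPartition.iff_of_mem (hQ : IsBranchPartition p q f 𝒬) {Q : Set ℝ} (h : Q ∈ 𝒬)
    {x x' : ℝ} (hx : x ∈ Q) (hx' : x' ∈ Q) : ∀ Q' ∈ 𝒬, (x ∈ Q' ↔ x' ∈ Q') := by
  intro Q' hQ'
  constructor
  · intro h1; rwa [hQ.eq_of_mem hQ' h h1 hx]
  · intro h1; rwa [hQ.eq_of_mem hQ' h h1 hx']

lemma IsBranchPartition.exists_mem (hQ : IsBranchPartition p q f 𝒬) {x : ℝ} (hx : x ∈ dom p q) :
    ∃ Q ∈ 𝒬, x ∈ Q := hQ.covers hx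

/-- `Q` may contain gaps of the domain, so Rolle's theorem is not available between two points with
the same image. Instead monotonicity makes `f` constant on a short interval of the domain next to
the left point, where the derivative would vanish. -/
lemma IsBranchPartition.injOn (hQ : IsBranchPartition p q f 𝒬) (hf : IsBasicCuspMap a b p q f)
    {Q : Set ℝ} (h : Q ∈ 𝒬) : InjOn f (Q ∩ dom p q) := by
  have key : ∀ x ∈ Q ∩ dom p q, ∀ x' ∈ Q ∩ dom p q, x < x' → f x ≠ f x' := by
    intro x hx x' hx' hlt heq
    obtain ⟨δ, hδ, hball⟩ := Metric.isOpen_iff.1 (isOpen_dom (p := p) (q := q)) x hx.2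
    have hconst : ∀ z ∈ Ioo x (min x' (x + δ)), f z = f x := by
      intro z hz
      have hzQ : z ∈ Q ∩ dom p q := by
        refine ⟨(hQ.interval Q h).out hx.1 hx'.1 ⟨hz.1.le, hz.2.le.trans (min_le_left _ _)⟩,
          hball ?_⟩
        rw [Metric.mem_ball, Real.dist_eq, abs_lt]
        have := hz.2.trans_le (min_le_right _ _)
        constructor <;> linarith [hz.1]
      have hzx' : z ≤ x' := hz.2.le.trans (min_le_left _ _)
      rcases hQ.monotone Q h with hm | hm
      · exact le_antisymm ((hm hzQ hx' hzx').trans heq.ge) (hm hx hzQ hz.1.le)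
      · exact le_antisymm (hm hx hzQ hz.1.le) (heq.le.trans (hm hzQ hx' hzx'))
    have hmin : x < min x' (x + δ) := lt_min hlt (by linarith)
    obtain ⟨z, hz⟩ := exists_between hmin
    have hzD : z ∈ dom p q := hball (by
      rw [Metric.mem_ball, Real.dist_eq, abs_lt]
      have := hz.2.trans_le (min_le_right _ _)
      constructor <;> linarith [hz.1])
    refine hf.deriv_ne hzD ?_
    have : f =ᶠ[𝓝 z] fun _ => f x := by
      filter_upwards [isOpen_Ioo.mem_nhds hz] with w hw using hconst w hw
    rw [this.deriv_eq]
    simp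
  intro x hx x' hx' heq
  rcases lt_trichotomy x x' with hlt | hlt | hlt
  · exact absurd heq (key x hx x' hx' hlt)
  · exact hlt
  · exact absurd heq.symm (key x' hx' x hx hlt)

/-- The whole branches of both points lie in `Q`, where `f` is monotone in one sense. The common
sign makes the ratios in `deltaSeq` positive. -/
lemma IsBranchPartition.deriv_mul_pos (hQ : IsBranchPartition p q f 𝒬)
    (hf : IsBasicCuspMap a b p q f) {Q : Set ℝ} (h : Q ∈ 𝒬) {x x' : ℝ} (hx : x ∈ Q)
    (hx' : x' ∈ Q) (hxD : x ∈ dom p q) (hxD' : x' ∈ dom p q) : 0 < deriv f x * deriv f x' := by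
  have hsub : ∀ z ∈ Q, z ∈ dom p q → ∃ j, z ∈ Ioo (p j) (q j) ∧ Ioo (p j) (q j) ⊆ Q ∩ dom p q := by
    intro z hz hzD
    obtain ⟨j, hj⟩ := mem_dom_iff.1 hzD
    obtain ⟨Q', hQ', hjQ⟩ := hQ.branch j
    rw [hQ.eq_of_mem hQ' h (hjQ hj) hz] at hjQ
    exact ⟨j, hj, subset_inter hjQ (Ioo_subset_dom j)⟩
  obtain ⟨j, hj, hjs⟩ := hsub x hx hxD
  obtain ⟨j', hj', hjs'⟩ := hsub x' hx' hxD'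
  have e1 : derivWithin f (Ioo (p j) (q j)) x = deriv f x :=
    derivWithin_of_isOpen isOpen_Ioo hj
  have e2 : derivWithin f (Ioo (p j') (q j')) x' = deriv f x' :=
    derivWithin_of_isOpen isOpen_Ioo hj'
  refine lt_of_le_of_ne ?_ (mul_ne_zero (hf.deriv_ne hxD) (hf.deriv_ne hxD')).symm
  rcases hQ.monotone Q h with hm | hm
  · exact mul_nonneg (e1 ▸ (hm.mono hjs).derivWithin_nonneg) (e2 ▸ (hm.mono hjs').derivWithin_nonneg)
  · exact mul_nonneg_of_nonpos_of_nonpos (e1 ▸ (hm.mono hjs).derivWithin_nonpos)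
      (e2 ▸ (hm.mono hjs').derivWithin_nonpos)

/-- Points of the domain in one class of the partition with the same image are equal. -/
lemma IsBranchPartition.eq_of_partP (hQ : IsBranchPartition p q f 𝒬)
    (hf : IsBasicCuspMap a b p q f) {U : Set ℝ} {x x' : ℝ} (hP : partP U 𝒬 x x')
    (hx : x ∈ dom p q) (hx' : x' ∈ dom p q) (h : f x = f x') : x = x' := by
  obtain ⟨Q, hQm, hxQ⟩ := hQ.exists_mem hx
  exact hQ.injOn hf hQm ⟨hxQ, hx⟩ ⟨(hP.2 Q hQm).1 hxQ, hx'⟩ h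

lemma IsBranchPartition.eq_of_itinerary (hQ : IsBranchPartition p q f 𝒬)
    (hf : IsBasicCuspMap a b p q f) {U : Set ℝ} {n : ℕ} {x x' : ℝ}
    (hx : x ∈ iterDom (dom p q) f n) (hx' : x' ∈ iterDom (dom p q) f n)
    (hP : ∀ i < n, partP U 𝒬 (f^[i] x) (f^[i] x')) (h : f^[n] x = f^[n] x') : x = x' := by
  induction n generalizing x x' with
  | zero => exact h
  | succ n ih =>
    obtain ⟨h0, h1⟩ := mem_iterDom_succ.1 hx
    obtain ⟨h0', h1'⟩ := mem_iterDom_succ.1 hx'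
    exact hQ.eq_of_partP hf (hP 0 n.succ_pos) h0 h0'
      (ih h1 h1' (fun i hi => hP (i + 1) (Nat.succ_lt_succ hi)) h)

lemma subset_Ioo_of_isPreconnected {W : Set ℝ} (hW : IsPreconnected W)
    (hfr : ∀ z ∈ W, z ∉ frontier (Ioo u v)) (h : (W ∩ Ioo u v).Nonempty) : W ⊆ Ioo u v := by
  refine hW.subset_left_of_subset_union isOpen_Ioo (v := (closure (Ioo u v))ᶜ)
    isClosed_closure.isOpen_compl
    (disjoint_compl_right_iff_subset.2 subset_closure) (fun z hz => ?_) h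
  by_cases hzc : z ∈ closure (Ioo u v)
  · left
    by_contra hzU
    exact hfr z hz (by rw [isOpen_Ioo.frontier_eq]; exact ⟨hzc, hzU⟩)
  · exact Or.inr hzc

/-- Pullbacks of a regularly returning interval are contained in elements of the iterated
partitions. -/
lemma IsBranchPartition.partP_iterate (hQ : IsBranchPartition p q f 𝒬)
    (hf : IsBasicCuspMap a b p q f) (hret : IsRegularlyReturning (dom p q) f u v)
    (hU : ∃ Q ∈ 𝒬, Ioo u v ⊆ Q) {n : ℕ} {W : Set ℝ} (hW : IsPreconnected W)
    (hWD : W ⊆ iterDom (dom p q) f n) (hWU : MapsTo f^[n] W (Ioo u v)) {x x' : ℝ} (hx : x ∈ W)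
    (hx' : x' ∈ W) {i : ℕ} (hi : i ≤ n) : partP (Ioo u v) 𝒬 (f^[i] x) (f^[i] x') := by
  rcases hi.eq_or_lt with rfl | hlt
  · obtain ⟨Q, hQm, hUQ⟩ := hU
    exact ⟨iff_of_true (hWU hx) (hWU hx'), hQ.iff_of_mem hQm (hUQ (hWU hx)) (hUQ (hWU hx'))⟩
  · have hpc := hf.isPreconnected_iterate_image hW hWD hi
    obtain ⟨j, hj⟩ := hf.exists_branch_of_isPreconnected hpc
      (by rintro _ ⟨z, hz, rfl⟩; exact hWD hz i hlt) ⟨_, mem_image_of_mem _ hx⟩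
    obtain ⟨Q, hQm, hjQ⟩ := hQ.branch j
    -- An end point of `U` in the image at time `i` would be mapped into `U` after `n - i > 0`
    -- further steps, contrary to regular return.
    have hfr : ∀ z ∈ f^[i] '' W, z ∉ frontier (Ioo u v) := by
      rintro _ ⟨z, hz, rfl⟩ hzf
      refine hret (n - i) (by omega) _ hzf (iterate_mem_iterDom (hWD hz) hi) ?_
      rw [← Function.iterate_add_apply, Nat.sub_add_cancel hi]
      exact hWU hz
    refine ⟨⟨fun h => ?_, fun h => ?_⟩, hQ.iff_of_mem hQm (hjQ (hj (mem_image_of_mem _ hx)))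
      (hjQ (hj (mem_image_of_mem _ hx')))⟩
    · exact subset_Ioo_of_isPreconnected hpc hfr ⟨_, mem_image_of_mem _ hx, h⟩
        (mem_image_of_mem _ hx')
    · exact subset_Ioo_of_isPreconnected hpc hfr ⟨_, mem_image_of_mem _ hx', h⟩
        (mem_image_of_mem _ hx)

/-- A diffeomorphic pullback of a regularly returning interval is an element of the iterated
partition. -/
lemma IsBranchPartition.cylinder_eq (hQ : IsBranchPartition p q f 𝒬)
    (hf : IsBasicCuspMap a b p q f) (hret : IsRegularlyReturning (dom p q) f u v)
    (hU : ∃ Q ∈ 𝒬, Ioo u v ⊆ Q) {n : ℕ} {W : Set ℝ}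
    (hW : IterDiffeo (dom p q) f n W (Ioo u v)) {x : ℝ} (hx : x ∈ W) :
    cylinder (dom p q) f (partP (Ioo u v) 𝒬) n x = W := by
  have hWc := hf.isPreconnected_of_iterDiffeo hW isPreconnected_Ioo
  refine Subset.antisymm (fun x' hx' => ?_) fun x' hx' => ⟨hW.subset hx', fun i hi =>
    hQ.partP_iterate hf hret hU hWc hW.subset hW.bijOn.mapsTo hx hx' hi⟩
  have h1 : f^[n] x' ∈ Ioo u v := (hx'.2 n le_rfl).1.1 (hW.bijOn.mapsTo hx)
  -- `w` is the point of `W` with the same image as `x'`; the two share their itinerary, hence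
  -- coincide.
  obtain ⟨w, hw, hwx⟩ := hW.bijOn.surjOn h1
  have : w = x' := by
    refine hQ.eq_of_itinerary hf (U := Ioo u v) (hW.subset hw) hx'.1 (fun i hi => ?_) hwx
    exact (partP _ _).trans ((partP _ _).symm (hQ.partP_iterate hf hret hU hWc hW.subset
      hW.bijOn.mapsTo hx hw hi.le)) (hx'.2 i hi.le)
  rwa [← this]

end Branches

/-! ### Elements of the Pesin partition and their description over the good set. -/

section Pesin

variable {ι : Type*} {a b : ℝ} {p q : ι → ℝ} {f : ℝ → ℝ} {𝒬 : Set (Set ℝ)} {u v : ℝ}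

lemma pesin_iff (P : Setoid ℝ) (y y' : ℕ → ℝ) : pesin P y y' ↔ ∀ i, P (y i) (y' i) := by
  have : pesin P y y' ↔ ∀ i, P (proj (back^[i] y)) (proj (back^[i] y')) := by
    exact (Setoid.sInf_iff (S := range fun i : ℕ => Setoid.comap (fun y => proj (back^[i] y)) P)).trans
      forall_mem_range
  simpa only [proj_back_iterate_eq] using this

lemma pesin_back {P : Setoid ℝ} {y y' : ℕ → ℝ} (h : pesin P y y') (k : ℕ) :
    pesin P (back^[k] y) (back^[k] y') := by
  rw [pesin_iff] at h ⊢
  intro i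
  rw [back_iterate_apply, back_iterate_apply]
  exact h _

/-- Once the element of `𝒬` containing `y (i + 1)` is known, `y i` determines `y (i + 1)`; equality
propagates backwards from the base point. -/
lemma IsBranchPartition.eq_of_pesin (hQ : IsBranchPartition p q f 𝒬)
    (hf : IsBasicCuspMap a b p q f) {U : Set ℝ} {y y' : ℕ → ℝ}
    (hy : y ∈ backwardOrbits (dom p q) f) (hy' : y' ∈ backwardOrbits (dom p q) f)
    (h : pesin (partP U 𝒬) y y') (h0 : proj y = proj y') : y = y' := by
  rw [pesin_iff] at h
  funext i
  induction i with
  | zero => exact h0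
  | succ i ih =>
    exact hQ.eq_of_partP hf (h (i + 1)) (hy i).1 (hy' i).1 (by rw [(hy i).2, (hy' i).2, ih])

lemma IsBranchPartition.injOn_proj_atom (hQ : IsBranchPartition p q f 𝒬)
    (hf : IsBasicCuspMap a b p q f) {U : Set ℝ} (y : ℕ → ℝ) (k : ℕ) :
    InjOn proj (back^[k] '' atom (dom p q) f (pesin (partP U 𝒬)) y) := by
  rintro _ ⟨z, hz, rfl⟩ _ ⟨z', hz', rfl⟩ h
  exact hQ.eq_of_pesin hf (back_iterate_mem hz.1 k) (back_iterate_mem hz'.1 k)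
    (pesin_back ((pesin _).trans ((pesin _).symm hz.2) hz'.2) k) h

lemma IsBranchPartition.mapsTo_proj_atom (hQ : IsBranchPartition p q f 𝒬)
    {U : Set ℝ} {y : ℕ → ℝ} {k : ℕ} (hy : y k ∈ dom p q) :
    ∃ Q ∈ 𝒬, MapsTo proj (back^[k] '' atom (dom p q) f (pesin (partP U 𝒬)) y) Q := by
  obtain ⟨Q, hQm, hyQ⟩ := hQ.exists_mem hy
  refine ⟨Q, hQm, ?_⟩
  rintro _ ⟨z, hz, rfl⟩
  rw [proj_back_iterate_eq]
  exact (((pesin_iff _ _ _).1 hz.2 k).2 Q hQm).1 hyQ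

section GoodSet

variable {e χ η : ℝ} {α ρ γ : (ℕ → ℝ) → ℝ} {V : (ℕ → ℝ) → Set (ℕ → ℝ)} {K ε : ℝ} {y : ℕ → ℝ}

lemma Ioo_subset_ball_of_mem_goodSet (hy : y ∈ goodSet (dom p q) f e χ η α ρ γ V u v K ε) :
    Ioo u v ⊆ proj '' V y := by
  rw [hy.1.manifold.proj_eq]
  intro x hx
  have h1 := hy.2.1
  have h2 := hy.2.2.1
  rw [Metric.mem_ball, Real.dist_eq, abs_lt]
  constructor <;> linarith [hx.1, hx.2, h1.1, h1.2]

lemma mem_proj_image_iff {V : Set (ℕ → ℝ)} {n : ℕ} {x : ℝ} :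
    x ∈ proj '' (back^[n] '' V) ↔ ∃ y ∈ V, y n = x := by
  simp [image_image, proj_back_iterate_eq]

/-- The pullback of `U` along a backward orbit in the good set. -/
lemma iterDiffeo_of_mem_goodSet (hf : IsBasicCuspMap a b p q f)
    (hy : y ∈ goodSet (dom p q) f e χ η α ρ γ V u v K ε) (n : ℕ) :
    IterDiffeo (dom p q) f n (proj '' (back^[n] '' V y) ∩ f^[n] ⁻¹' Ioo u v) (Ioo u v) := by
  rcases Nat.eq_zero_or_pos n with rfl | hn
  · have h := Ioo_subset_ball_of_mem_goodSet hy
    have e1 : proj '' (back^[0] '' V y) ∩ f^[0] ⁻¹' Ioo u v = Ioo u v := by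
      simpa using inter_eq_right.2 h
    rw [e1]
    exact ⟨isOpen_Ioo, by simp [iterDom_zero], bijOn_id _⟩
  · exact hf.iterDiffeo_inter_preimage (hy.1.manifold.diffeo n hn) isOpen_Ioo
      (Ioo_subset_ball_of_mem_goodSet hy)

lemma mem_pullback (hy : y ∈ goodSet (dom p q) f e χ η α ρ γ V u v K ε) {y' : ℕ → ℝ}
    (hy' : y' ∈ V y) (hU : proj y' ∈ Ioo u v) (n : ℕ) :
    y' n ∈ proj '' (back^[n] '' V y) ∩ f^[n] ⁻¹' Ioo u v := by
  refine ⟨mem_proj_image_iff.2 ⟨y', hy', rfl⟩, ?_⟩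
  have := iterate_apply_of_mem (hy.1.manifold.subset hy') n 0
  rw [add_zero] at this
  rwa [mem_preimage, this]

lemma IsBranchPartition.pesin_of_mem (hQ : IsBranchPartition p q f 𝒬)
    (hf : IsBasicCuspMap a b p q f) (hret : IsRegularlyReturning (dom p q) f u v)
    (hU : ∃ Q ∈ 𝒬, Ioo u v ⊆ Q) (hy : y ∈ goodSet (dom p q) f e χ η α ρ γ V u v K ε)
    {y' : ℕ → ℝ} (hy' : y' ∈ V y) (hyU : proj y' ∈ Ioo u v) :
    pesin (partP (Ioo u v) 𝒬) y y' := by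
  rw [pesin_iff]
  intro n
  have h := iterDiffeo_of_mem_goodSet hf hy n
  exact hQ.partP_iterate hf hret hU (hf.isPreconnected_of_iterDiffeo h isPreconnected_Ioo)
    h.subset h.bijOn.mapsTo (mem_pullback hy hy.1.manifold.mem hy.2.1 n)
    (mem_pullback hy hy' hyU n) (Nat.zero_le n)

/-- The nesting argument puts the part of `V y` over `U` into one atom. That part already projects
onto all of `U`, and `Π` is injective on an atom, so the atom contains nothing else. -/
lemma IsBranchPartition.atom_eq_of_mem_goodSet (hQ : IsBranchPartition p q f 𝒬)
    (hf : IsBasicCuspMap a b p q f) (hret : IsRegularlyReturning (dom p q) f u v)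
    (hU : ∃ Q ∈ 𝒬, Ioo u v ⊆ Q) (hy : y ∈ goodSet (dom p q) f e χ η α ρ γ V u v K ε) :
    atom (dom p q) f (pesin (partP (Ioo u v) 𝒬)) y = V y ∩ proj ⁻¹' Ioo u v := by
  refine Subset.antisymm (fun y' hy' => ?_) fun y' hy' =>
    ⟨hy.1.manifold.subset hy'.1, hQ.pesin_of_mem hf hret hU hy hy'.1 hy'.2⟩
  have h1 : proj y' ∈ Ioo u v := ((pesin_iff _ _ _).1 hy'.2 0).1.1 hy.2.1
  obtain ⟨w, hw, hwy⟩ := Ioo_subset_ball_of_mem_goodSet hy h1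
  have h2 := hQ.pesin_of_mem hf hret hU hy hw (hwy ▸ h1)
  have : w = y' := hQ.eq_of_pesin hf (hy.1.manifold.subset hw) hy'.1
    ((pesin _).trans ((pesin _).symm h2) hy'.2) hwy
  exact ⟨this ▸ hw, h1⟩

lemma IsBranchPartition.proj_atom_of_mem_goodSet (hQ : IsBranchPartition p q f 𝒬)
    (hf : IsBasicCuspMap a b p q f) (hret : IsRegularlyReturning (dom p q) f u v)
    (hU : ∃ Q ∈ 𝒬, Ioo u v ⊆ Q) (hy : y ∈ goodSet (dom p q) f e χ η α ρ γ V u v K ε) :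
    proj '' atom (dom p q) f (pesin (partP (Ioo u v) 𝒬)) y = Ioo u v := by
  rw [hQ.atom_eq_of_mem_goodSet hf hret hU hy, image_inter_preimage]
  exact inter_eq_right.2 (Ioo_subset_ball_of_mem_goodSet hy)

end GoodSet

end Pesin

/-! ### Distortion at the scale given by the derivative. -/

section LocalDistortion

lemma abs_log_sub_log_le {s t δ : ℝ} (hs : s ≠ 0) (hδ : δ ≤ 1 / 8) (h : |t - s| ≤ δ * |s|) :
    |Real.log |t| - Real.log (|s|)| ≤ 2 * δ := by
  have hs' : 0 < |s| := abs_pos.2 hs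
  have hδ0 : 0 ≤ δ := by
    by_contra hneg
    have := (abs_nonneg _).trans h
    nlinarith
  have h1 := abs_abs_sub_abs_le_abs_sub t s
  have h2 := abs_le.1 (h1.trans h)
  have hlow : (1 - δ) * |s| ≤ |t| := by linarith [h2.1]
  have hup : |t| ≤ (1 + δ) * |s| := by linarith [h2.2]
  have ht : 0 < |t| := lt_of_lt_of_le (by nlinarith) hlow
  have h1δ : 0 < 1 - δ := by linarith
  rw [← Real.log_div ht.ne' hs'.ne', abs_le]
  have hq1 : 1 - δ ≤ |t| / |s| := by rwa [le_div_iff₀ hs']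
  have hq2 : |t| / |s| ≤ 1 + δ := by rwa [div_le_iff₀ hs']
  constructor
  · have h3 : Real.log (1 - δ) ≤ Real.log (|t| / |s|) := Real.log_le_log h1δ hq1
    have h4 := Real.one_sub_inv_le_log_of_pos h1δ
    have h5 : -(2 * δ) ≤ 1 - (1 - δ)⁻¹ := by
      have : (1 - δ)⁻¹ ≤ 1 + 2 * δ := by
        rw [inv_le_iff_one_le_mul₀ h1δ]
        nlinarith
      linarith
    linarith
  · have h3 : Real.log (|t| / |s|) ≤ Real.log (1 + δ) := Real.log_le_log (by positivity) hq2
    have h4 := Real.log_le_sub_one_of_pos (show (0 : ℝ) < 1 + δ by linarith)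
    linarith

lemma TendstoZeroOrInfty.not_bounded {g : ℝ → ℝ} {l : Filter ℝ} [l.NeBot]
    (h : TendstoZeroOrInfty g l) {m M : ℝ} (hm : 0 < m) (hb : ∀ᶠ z in l, m ≤ |g z| ∧ |g z| ≤ M) :
    False := by
  rcases h with h | h | h
  · have h1 := h.abs
    rw [abs_zero] at h1
    obtain ⟨z, hz, hz'⟩ := (hb.and (h1.eventually_lt_const hm)).exists
    linarith [hz.1]
  · obtain ⟨z, hz, hz'⟩ := (hb.and (h.eventually_gt_atTop M)).exists
    linarith [hz.2, le_abs_self (g z)]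
  · obtain ⟨z, hz, hz'⟩ := (hb.and (h.eventually_lt_atBot (-M))).exists
    linarith [hz.2, neg_le_abs (g z)]

variable {ι : Type*} {a b : ℝ} {p q : ι → ℝ} {f : ℝ → ℝ} {C e : ℝ}

/-- A ball on which the derivative, where defined, is bounded away from zero and infinity does not
leave the branch. -/
lemma IsBasicCuspMap.ball_subset_branch (hf : IsBasicCuspMap a b p q f) {x : ℝ} {j : ι}
    (hx : x ∈ Ioo (p j) (q j)) {r m M : ℝ} (hm : 0 < m)
    (hb : ∀ z ∈ Ioo (p j) (q j) ∩ Metric.ball x r, m ≤ |deriv f z| ∧ |deriv f z| ≤ M) :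
    Metric.ball x r ⊆ Ioo (p j) (q j) := by
  rw [Real.ball_eq_Ioo] at hb ⊢
  have h1 : p j ≤ x - r := by
    by_contra hlt
    push Not at hlt
    refine (hf.left_limit j).not_bounded (M := M) hm ?_
    filter_upwards [Ioo_mem_nhdsGT hx.1, self_mem_nhdsWithin] with z hz hz'
    exact hb z ⟨⟨hz.1, hz.2.trans hx.2⟩, by linarith [hz.1], by linarith [hz.2, hx.1]⟩
  have h2 : x + r ≤ q j := by
    by_contra hlt
    push Not at hlt
    refine (hf.right_limit j).not_bounded (M := M) hm ?_
    filter_upwards [Ioo_mem_nhdsLT hx.2, self_mem_nhdsWithin] with z hz hz'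
    exact hb z ⟨⟨hx.1.trans hz.1, hz.2⟩, by linarith [hz.1, hx.2], by linarith [hz.2]⟩
  exact Ioo_subset_Ioo h1 h2

/-- Near a point of the domain, at a scale given by the size of the derivative, the map is defined
and its derivative has controlled distortion. -/
lemma IsCuspMap.local_distortion (hf : IsCuspMap a b p q f C e) {x r τ : ℝ} (hx : x ∈ dom p q)
    (hτ0 : 0 < τ) (hτ : τ ≤ |deriv f x|) (hτ' : τ ≤ |deriv f x|⁻¹) (hr0 : 0 < r)
    (hr : 8 * C * r ^ e ≤ τ) :
    Metric.ball x r ⊆ dom p q ∧ ∀ x' ∈ Metric.ball x r,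
      |Real.log |deriv f x'| - Real.log (|deriv f x|)| ≤ 2 * (C * |x' - x| ^ e / τ) := by
  obtain ⟨j, hj⟩ := mem_dom_iff.1 hx
  have hC := hf.C_pos
  have he := hf.e_pos
  have hpow : ∀ x' ∈ Metric.ball x r, C * |x' - x| ^ e ≤ τ / 8 := by
    intro x' hx'
    rw [Metric.mem_ball, Real.dist_eq] at hx'
    have : |x' - x| ^ e ≤ r ^ e := Real.rpow_le_rpow (abs_nonneg _) hx'.le he.le
    nlinarith
  have hd : 0 < |deriv f x| := hτ0.trans_le hτ
  set S := Ioo (p j) (q j) ∩ Metric.ball x r with hS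
  have hSp : IsPreconnected S := by
    rw [hS, Real.ball_eq_Ioo, Ioo_inter_Ioo]
    exact isPreconnected_Ioo
  have hxS : x ∈ S := ⟨hj, Metric.mem_ball_self hr0⟩
  have hcont : ContinuousOn (fun z => |deriv f z|) (Ioo (p j) (q j)) := fun z hz =>
    ((hf.continuousAt_deriv (Ioo_subset_dom j hz)).abs).continuousWithinAt
  have key : ∃ m M : ℝ, 0 < m ∧ ∀ z ∈ S, (m ≤ |deriv f z| ∧ |deriv f z| ≤ M) ∧
      |Real.log |deriv f z| - Real.log (|deriv f x|)| ≤ 2 * (C * |z - x| ^ e / τ) := by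
    -- The Hölder condition for `1/Df` serves when `|Df x| ≥ 1`, the one for `Df` otherwise. Each
    -- needs an a priori bound on `|Df z|`, which a connectedness argument supplies.
    rcases le_total 1 |deriv f x| with hd1 | hd1
    · have hinv : |deriv f x|⁻¹ ≤ 1 := inv_le_one_of_one_le₀ hd1
      -- the distortion bound, under the assumption that the derivative is not small
      have hstep : ∀ z ∈ S, 1 / 2 < |deriv f z| →
          |(deriv f z)⁻¹ - (deriv f x)⁻¹| ≤ (C * |z - x| ^ e / τ) * |(deriv f x)⁻¹| := by
        intro z hz hz2
        have h1 := hf.holder_inv j z hz.1 x hj hz2.le (by linarith)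
        rw [one_div, one_div] at h1
        refine h1.trans ?_
        rw [abs_inv, div_mul_eq_mul_div, le_div_iff₀ hτ0]
        have : 0 ≤ C * |z - x| ^ e := by positivity
        nlinarith
      have hq : ∀ z ∈ S, C * |z - x| ^ e / τ ≤ 1 / 8 := by
        intro z hz
        rw [div_le_iff₀ hτ0]
        linarith [hpow z hz.2]
      have hstep2 : ∀ z ∈ S, 1 / 2 < |deriv f z| →
          8 / 9 * |deriv f x| ≤ |deriv f z| ∧ |deriv f z| ≤ 8 / 7 * |deriv f x| := by
        intro z hz hz2
        have hz0 : 0 < |deriv f z| := by linarith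
        have h1 := (hstep z hz hz2).trans (mul_le_mul_of_nonneg_right (hq z hz) (abs_nonneg _))
        have h2 := abs_le.1 ((abs_abs_sub_abs_le_abs_sub _ _).trans h1)
        rw [abs_inv, abs_inv] at h2
        have e1 : |deriv f z| * |deriv f z|⁻¹ = 1 := mul_inv_cancel₀ hz0.ne'
        have e2 : |deriv f x| * |deriv f x|⁻¹ = 1 := mul_inv_cancel₀ hd.ne'
        constructor
        · have h3 : |deriv f z|⁻¹ ≤ 9 / 8 * |deriv f x|⁻¹ := by linarith [h2.2]
          have h4 := mul_le_mul_of_nonneg_left h3 (mul_pos hz0 hd).le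
          nlinarith
        · have h3 : 7 / 8 * |deriv f x|⁻¹ ≤ |deriv f z|⁻¹ := by linarith [h2.1]
          have h4 := mul_le_mul_of_nonneg_left h3 (mul_pos hz0 hd).le
          nlinarith
      -- If `|Df|` fell to `1/2` on the connected set `S`, it would take a value in `(1/2, 8/9)`,
      -- which `hstep2` excludes as `|Df x| ≥ 1`.
      have hall : ∀ z ∈ S, 1 / 2 < |deriv f z| := by
        by_contra hcon
        push Not at hcon
        obtain ⟨w, hw, hw2⟩ := hcon
        obtain ⟨z, hz, hz1, hz2⟩ := hSp (Ioo (p j) (q j) ∩ (fun z => |deriv f z|) ⁻¹' Ioi (1 / 2))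
          (Ioo (p j) (q j) ∩ (fun z => |deriv f z|) ⁻¹' Iio (8 / 9))
          (hcont.isOpen_inter_preimage isOpen_Ioo isOpen_Ioi)
          (hcont.isOpen_inter_preimage isOpen_Ioo isOpen_Iio)
          (fun z hz => by
            rcases lt_or_ge (1 / 2) |deriv f z| with h | h
            · exact Or.inl ⟨hz.1, h⟩
            · exact Or.inr ⟨hz.1, lt_of_le_of_lt h (by norm_num)⟩)
          ⟨x, hxS, hj, show 1 / 2 < |deriv f x| by linarith⟩
          ⟨w, hw, hw.1, lt_of_le_of_lt hw2 (by norm_num)⟩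
        have h1 := (hstep2 z hz hz1.2).1
        have h2 : |deriv f z| < 8 / 9 := hz2.2
        linarith
      refine ⟨8 / 9 * |deriv f x|, 8 / 7 * |deriv f x|, by positivity, fun z hz =>
        ⟨hstep2 z hz (hall z hz), ?_⟩⟩
      have := abs_log_sub_log_le (inv_ne_zero (abs_pos.1 hd)) (hq z hz) (hstep z hz (hall z hz))
      rw [abs_inv, abs_inv, Real.log_inv, Real.log_inv, ← abs_neg] at this
      convert this using 2
      ring
    · have hstep : ∀ z ∈ S, |deriv f z| < 2 →
          |deriv f z - deriv f x| ≤ (C * |z - x| ^ e / τ) * |deriv f x| := by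
        intro z hz hz2
        refine (hf.holder j z hz.1 x hj hz2.le (by linarith)).trans ?_
        rw [div_mul_eq_mul_div, le_div_iff₀ hτ0]
        have : 0 ≤ C * |z - x| ^ e := by positivity
        nlinarith
      have hq : ∀ z ∈ S, C * |z - x| ^ e / τ ≤ 1 / 8 := by
        intro z hz
        rw [div_le_iff₀ hτ0]
        linarith [hpow z hz.2]
      have hstep2 : ∀ z ∈ S, |deriv f z| < 2 →
          7 / 8 * |deriv f x| ≤ |deriv f z| ∧ |deriv f z| ≤ 9 / 8 * |deriv f x| := by
        intro z hz hz2
        have h1 := (hstep z hz hz2).trans (mul_le_mul_of_nonneg_right (hq z hz) (abs_nonneg _))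
        have h2 := abs_le.1 ((abs_abs_sub_abs_le_abs_sub _ _).trans h1)
        constructor <;> linarith [h2.1, h2.2]
      have hall : ∀ z ∈ S, |deriv f z| < 2 := by
        by_contra hcon
        push Not at hcon
        obtain ⟨w, hw, hw2⟩ := hcon
        obtain ⟨z, hz, hz1, hz2⟩ := hSp (Ioo (p j) (q j) ∩ (fun z => |deriv f z|) ⁻¹' Iio 2)
          (Ioo (p j) (q j) ∩ (fun z => |deriv f z|) ⁻¹' Ioi (9 / 8))
          (hcont.isOpen_inter_preimage isOpen_Ioo isOpen_Iio)
          (hcont.isOpen_inter_preimage isOpen_Ioo isOpen_Ioi)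
          (fun z hz => by
            rcases lt_or_ge |deriv f z| 2 with h | h
            · exact Or.inl ⟨hz.1, h⟩
            · exact Or.inr ⟨hz.1, lt_of_lt_of_le (by norm_num) h⟩)
          ⟨x, hxS, hj, show |deriv f x| < 2 by linarith⟩
          ⟨w, hw, hw.1, lt_of_lt_of_le (by norm_num) hw2⟩
        have h1 := (hstep2 z hz hz1.2).2
        have h2 : 9 / 8 < |deriv f z| := hz2.2
        linarith
      exact ⟨7 / 8 * |deriv f x|, 9 / 8 * |deriv f x|, by positivity, fun z hz =>
        ⟨hstep2 z hz (hall z hz),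
          abs_log_sub_log_le (abs_pos.1 hd) (hq z hz) (hstep z hz (hall z hz))⟩⟩
  obtain ⟨m, M, hm, hmM⟩ := key
  have hsub := hf.ball_subset_branch hj hm (fun z hz => (hmM z hz).1)
  exact ⟨hsub.trans (Ioo_subset_dom j), fun z hz => (hmM z ⟨hsub hz, hz⟩).2⟩

/-- A differentiable injective map whose derivative is at least `m` on a ball of radius `r` has an
image that contains a ball of radius `m * r`. -/
lemma ball_subset_image_ball {f : ℝ → ℝ} {x r m : ℝ} (hm : 0 < m)
    (hd : ∀ z ∈ Metric.ball x r, DifferentiableAt ℝ f z)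
    (hb : ∀ z ∈ Metric.ball x r, m ≤ |deriv f z|) :
    Metric.ball (f x) (m * r) ⊆ f '' Metric.ball x r := by
  rw [Real.ball_eq_Ioo] at hd hb
  intro w hw
  rw [Metric.mem_ball, Real.dist_eq, ← div_lt_iff₀' hm] at hw
  -- A slightly smaller radius gives a closed interval inside the ball while keeping `|w - f x| < m
  -- * s`.
  obtain ⟨s, hs, hsr⟩ := exists_between hw
  have hs0 : 0 < s := lt_of_le_of_lt (by positivity) hs
  rw [div_lt_iff₀' hm] at hs
  have hsub : Icc (x - s) (x + s) ⊆ Ioo (x - r) (x + r) :=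
    fun z hz => ⟨by linarith [hz.1], by linarith [hz.2]⟩
  have hc : ContinuousOn f (Icc (x - s) (x + s)) := fun z hz =>
    (hd z (hsub hz)).continuousAt.continuousWithinAt
  obtain ⟨z₁, hz₁, e₁⟩ := exists_deriv_eq_slope f (show x < x + s by linarith)
    (hc.mono (Icc_subset_Icc (by linarith) le_rfl))
    (fun z hz => (hd z (hsub ⟨by linarith [hz.1], hz.2.le⟩)).differentiableWithinAt)
  obtain ⟨z₂, hz₂, e₂⟩ := exists_deriv_eq_slope f (show x - s < x by linarith)
    (hc.mono (Icc_subset_Icc le_rfl (by linarith)))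
    (fun z hz => (hd z (hsub ⟨hz.1.le, by linarith [hz.2]⟩)).differentiableWithinAt)
  have hm₁ : z₁ ∈ Ioo (x - r) (x + r) := hsub ⟨by linarith [hz₁.1], hz₁.2.le⟩
  have hm₂ : z₂ ∈ Ioo (x - r) (x + r) := hsub ⟨hz₂.1.le, by linarith [hz₂.2]⟩
  rw [eq_div_iff (by linarith)] at e₁ e₂
  have hoc : (f '' Icc (x - s) (x + s)).OrdConnected :=
    (isPreconnected_Icc.image f hc).ordConnected
  have ha : f (x - s) ∈ f '' Icc (x - s) (x + s) := mem_image_of_mem f ⟨le_rfl, by linarith⟩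
  have hb' : f (x + s) ∈ f '' Icc (x - s) (x + s) := mem_image_of_mem f ⟨by linarith, le_rfl⟩
  have hfin : w ∈ f '' Icc (x - s) (x + s) := by
    have hwx := abs_lt.1 hs
    -- By Darboux the derivative has a constant sign, so the two end values lie on opposite sides of
    -- `f x`, each at distance at least `m * s`.
    rcases hasDerivWithinAt_forall_lt_or_forall_gt_of_forall_ne
      (convex_Ioo (x - r) (x + r)) (fun z hz => (hd z hz).hasDerivAt.hasDerivWithinAt)
      (fun z hz => show deriv f z ≠ 0 from abs_pos.1 (hm.trans_le (hb z hz))) with h | h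
    · have b1 := hb z₁ hm₁
      have b2 := hb z₂ hm₂
      rw [abs_of_neg (h z₁ hm₁)] at b1
      rw [abs_of_neg (h z₂ hm₂)] at b2
      refine hoc.out hb' ha ⟨?_, ?_⟩ <;> nlinarith
    · have b1 := hb z₁ hm₁
      have b2 := hb z₂ hm₂
      rw [abs_of_pos (h z₁ hm₁)] at b1
      rw [abs_of_pos (h z₂ hm₂)] at b2
      refine hoc.out ha hb' ⟨?_, ?_⟩ <;> nlinarith
  rw [Real.ball_eq_Ioo]
  exact image_mono hsub hfin

end LocalDistortion

/-! ### Construction of the unstable manifold of a tame orbit. -/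

section UnstableManifold

variable {ι : Type*} {a b : ℝ} {p q : ι → ℝ} {f : ℝ → ℝ} {C e : ℝ}

/-- Here Rolle's theorem does apply, since a connected subset of the domain has no gaps. -/
lemma IsBasicCuspMap.injOn_of_isPreconnected (hf : IsBasicCuspMap a b p q f) {W : Set ℝ}
    (hW : IsPreconnected W) (hWD : W ⊆ dom p q) : InjOn f W := by
  have key : ∀ x ∈ W, ∀ x' ∈ W, x < x' → f x ≠ f x' := by
    intro x hx x' hx' hlt heq
    have hsub : Icc x x' ⊆ W := hW.ordConnected.out hx hx'
    obtain ⟨z, hz, hz0⟩ := exists_deriv_eq_zero hlt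
      (fun z hz => (hf.continuousAt (hWD (hsub hz))).continuousWithinAt) heq
    exact hf.deriv_ne (hWD (hsub (Ioo_subset_Icc_self hz))) hz0
  intro x hx x' hx' heq
  rcases lt_trichotomy x x' with hlt | hlt | hlt
  · exact absurd heq (key x hx x' hx' hlt)
  · exact hlt
  · exact absurd heq.symm (key x' hx' x hx hlt)

/-- Lower bound for the derivative and its inverse along a tame orbit. -/
noncomputable def tameBound (e L M : ℝ) (n : ℕ) : ℝ := M⁻¹ * Real.exp (-(L / 2 * min 1 e) * n)

/-- The backward orbit `y` expands at rate `L` and does not approach the cusps too fast. -/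
structure TameOrbit (f : ℝ → ℝ) (e L M : ℝ) (y : ℕ → ℝ) : Prop where
  rate : ∀ n : ℕ, M⁻¹ * Real.exp (n * L) ≤ |deriv f^[n] (y n)|
  low : ∀ n : ℕ, tameBound e L M (n + 1) ≤ |deriv f (y (n + 1))|
  low_inv : ∀ n : ℕ, tameBound e L M (n + 1) ≤ |deriv f (y (n + 1))|⁻¹

/-- Radii of balls with bounded distortion along a tame orbit. -/
noncomputable def pullRadius (L σ : ℝ) (n : ℕ) : ℝ := σ * Real.exp (-(L / 2) * n)

/-- The pullbacks of the ball of radius `α` along the backward orbit `y`. -/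
def pullSet (f : ℝ → ℝ) (L σ α : ℝ) (y : ℕ → ℝ) : ℕ → Set ℝ
  | 0 => Metric.ball (y 0) α
  | n + 1 => Metric.ball (y (n + 1)) (pullRadius L σ (n + 1)) ∩ f ⁻¹' pullSet f L σ α y n

/-- The rate of decay of the distortion along a tame orbit. -/
noncomputable def tameRate (e L : ℝ) : ℝ := Real.exp (-(L / 2 * e))

/-- The constant of the Hölder bound of the distortion along a tame orbit. -/
noncomputable def tameConst (C e L M : ℝ) : ℝ :=
  2 * C * (2 * M) ^ e * M * (1 - tameRate e L)⁻¹

variable {L M σ α : ℝ} {y : ℕ → ℝ}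

lemma tameRate_pos : 0 < tameRate e L := Real.exp_pos _

lemma tameRate_lt_one (he : 0 < e) (hL : 0 < L) : tameRate e L < 1 :=
by
  rw [tameRate, ← Real.exp_zero]
  exact Real.exp_lt_exp.2 (by have := mul_pos (half_pos hL) he; linarith)

lemma tameBound_pos (hM : 1 ≤ M) (n : ℕ) : 0 < tameBound e L M n := by
  unfold tameBound
  have : 0 < M := by linarith
  positivity

/-- Hypotheses on the parameters of the construction of unstable manifolds. -/
structure TameParams (C e L M σ α : ℝ) : Prop where
  L_pos : 0 < L
  one_le : 1 ≤ M
  σ_pos : 0 < σ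
  σ_le : 8 * C * σ ^ e ≤ M⁻¹
  α_pos : 0 < α
  α_le : 4 * M * α ≤ M⁻¹ * σ * Real.exp (-L)
  α_const : tameConst C e L M * α ^ e ≤ 1 / 4

lemma TameParams.pullRadius_pos (h : TameParams C e L M σ α) (n : ℕ) : 0 < pullRadius L σ n :=
  mul_pos h.σ_pos (Real.exp_pos _)

/-- This is the scale condition of `IsCuspMap.local_distortion`. Powers `e` of the radii decay like
`exp(-(L/2) e n)`, at least as fast as the derivative bound, whose exponent contains `min 1 e`. -/
lemma TameParams.pullRadius_le (h : TameParams C e L M σ α) (n : ℕ) :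
    8 * C * pullRadius L σ n ^ e ≤ tameBound e L M n := by
  rw [pullRadius, Real.mul_rpow h.σ_pos.le (Real.exp_pos _).le, ← Real.exp_mul, ← mul_assoc,
    tameBound]
  have hM : 0 < M⁻¹ := inv_pos.2 (by linarith [h.one_le])
  refine mul_le_mul h.σ_le (Real.exp_le_exp.2 ?_) (Real.exp_pos _).le hM.le
  have h1 : L / 2 * min 1 e ≤ L / 2 * e :=
    mul_le_mul_of_nonneg_left (min_le_right _ _) (half_pos h.L_pos).le
  have h2 := mul_le_mul_of_nonneg_right h1 n.cast_nonneg (α := ℝ)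
  linarith

/-- The pulled-back ball decays like `exp(-L n)`. The ball of radius `pullRadius` has an image of
size at least `exp(-(L/2) min(1, e) n) * exp(-(L/2) n)` up to constants; the minimum with `1`
ensures that this is not smaller. -/
lemma TameParams.tameBound_mul (h : TameParams C e L M σ α) (n : ℕ) :
    2 * M * Real.exp (-(L * n)) * α ≤ tameBound e L M (n + 1) / 2 * pullRadius L σ (n + 1) := by
  have hM : 0 < M⁻¹ := inv_pos.2 (by linarith [h.one_le])
  have h1 : L / 2 * min 1 e ≤ L / 2 :=
    (mul_le_mul_of_nonneg_left (min_le_left _ _) (half_pos h.L_pos).le).trans (mul_one _).le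
  have h2 : Real.exp (-(L / 2) * (n + 1 : ℕ)) ≤ Real.exp (-(L / 2 * min 1 e) * (n + 1 : ℕ)) := by
    refine Real.exp_le_exp.2 ?_
    have := mul_le_mul_of_nonneg_right h1 (n + 1 : ℕ).cast_nonneg (α := ℝ)
    linarith
  have h3 : Real.exp (-(L * n)) * Real.exp (-L)
      = Real.exp (-(L / 2) * (n + 1 : ℕ)) * Real.exp (-(L / 2) * (n + 1 : ℕ)) := by
    rw [← Real.exp_add, ← Real.exp_add]
    congr 1
    push_cast
    ring
  have h4 := mul_le_mul_of_nonneg_right h.α_le (Real.exp_pos (-(L * n))).le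
  have h5 : M⁻¹ * σ * Real.exp (-L) * Real.exp (-(L * n))
      = M⁻¹ * σ * (Real.exp (-(L / 2) * (n + 1 : ℕ)) * Real.exp (-(L / 2) * (n + 1 : ℕ))) := by
    rw [← h3]; ring
  have h6 : M⁻¹ * σ * (Real.exp (-(L / 2) * (n + 1 : ℕ)) * Real.exp (-(L / 2) * (n + 1 : ℕ)))
      ≤ tameBound e L M (n + 1) * pullRadius L σ (n + 1) := by
    rw [tameBound, pullRadius]
    have : M⁻¹ * Real.exp (-(L / 2 * min 1 e) * (n + 1 : ℕ)) *
        (σ * Real.exp (-(L / 2) * (n + 1 : ℕ))) = M⁻¹ * σ *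
        (Real.exp (-(L / 2 * min 1 e) * (n + 1 : ℕ)) * Real.exp (-(L / 2) * (n + 1 : ℕ))) := by ring
    rw [this]
    have := h.σ_pos
    gcongr
  linarith

/-- The distortion bound at the `n`-th step, for points that contract exponentially. -/
lemma TameParams.term_le (h : TameParams C e L M σ α) (hC : 0 < C) (he : 0 < e) (n : ℕ)
    {t d : ℝ} (ht : 0 ≤ t) (hd : 0 ≤ d) (htd : t ≤ 2 * M * Real.exp (-(L * n)) * d) :
    2 * (C * t ^ e / tameBound e L M n)
      ≤ 2 * C * (2 * M) ^ e * M * tameRate e L ^ n * d ^ e := by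
  have hM : 0 < M := by linarith [h.one_le]
  have h1 : t ^ e ≤ (2 * M) ^ e * Real.exp (-(L * n)) ^ e * d ^ e := by
    rw [← Real.mul_rpow (by positivity) (by positivity), ← Real.mul_rpow (by positivity) hd]
    exact Real.rpow_le_rpow ht htd he.le
  have h2 : Real.exp (-(L * n)) ^ e ≤ tameRate e L ^ n * Real.exp (-(L / 2 * min 1 e) * n) := by
    rw [← Real.exp_mul, tameRate, ← Real.exp_nat_mul, ← Real.exp_add]
    refine Real.exp_le_exp.2 ?_
    have h1 : L / 2 * min 1 e ≤ L / 2 * e :=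
      mul_le_mul_of_nonneg_left (min_le_right _ _) (half_pos h.L_pos).le
    have h2 := mul_le_mul_of_nonneg_right h1 n.cast_nonneg (α := ℝ)
    linarith
  have hE := Real.exp_pos (-(L / 2 * min 1 e) * n)
  have h3 : t ^ e / tameBound e L M n ≤ (2 * M) ^ e * M * tameRate e L ^ n * d ^ e := by
    rw [div_le_iff₀ (tameBound_pos h.one_le n), tameBound]
    have e1 : (2 * M) ^ e * M * tameRate e L ^ n * d ^ e *
        (M⁻¹ * Real.exp (-(L / 2 * min 1 e) * n))
        = (2 * M) ^ e * (tameRate e L ^ n * Real.exp (-(L / 2 * min 1 e) * n)) * d ^ e := by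
      field_simp
    rw [e1]
    refine h1.trans ?_
    have : 0 ≤ d ^ e := Real.rpow_nonneg hd e
    have : 0 ≤ (2 * M) ^ e := by positivity
    gcongr
  calc 2 * (C * t ^ e / tameBound e L M n) = 2 * C * (t ^ e / tameBound e L M n) := by ring
    _ ≤ 2 * C * ((2 * M) ^ e * M * tameRate e L ^ n * d ^ e) := by gcongr
    _ = _ := by ring

lemma TameParams.sum_le (h : TameParams C e L M σ α) (hC : 0 < C) (he : 0 < e) (n : ℕ) {d : ℝ}
    (hd : 0 ≤ d) :
    ∑ k ∈ Finset.range n, 2 * C * (2 * M) ^ e * M * tameRate e L ^ (k + 1) * d ^ e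
      ≤ tameConst C e L M * d ^ e := by
  have hM : 0 < M := by linarith [h.one_le]
  have hθ := tameRate_pos (e := e) (L := L)
  have hθ1 := tameRate_lt_one he h.L_pos
  have h1 : ∑ k ∈ Finset.range n, tameRate e L ^ (k + 1) ≤ (1 - tameRate e L)⁻¹ := by
    rw [← tsum_geometric_of_lt_one hθ.le hθ1]
    refine le_trans (Finset.sum_le_sum fun k _ => ?_)
      ((summable_geometric_of_lt_one hθ.le hθ1).sum_le_tsum _ fun _ _ => by positivity)
    exact pow_le_pow_of_le_one hθ.le hθ1.le (Nat.le_succ k)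
  rw [← Finset.sum_mul, ← Finset.mul_sum, tameConst]
  have := Real.rpow_nonneg hd e
  gcongr

variable (hf : IsCuspMap a b p q f C e) (hy : y ∈ backwardOrbits (dom p q) f)
  (ht : TameOrbit f e L M y) (hp : TameParams C e L M σ α)
include hf hy ht hp

lemma pullRadius_distortion (n : ℕ) :
    Metric.ball (y (n + 1)) (pullRadius L σ (n + 1)) ⊆ dom p q ∧
      ∀ x ∈ Metric.ball (y (n + 1)) (pullRadius L σ (n + 1)),
        |Real.log |deriv f x| - Real.log (|deriv f (y (n + 1))|)|
          ≤ 2 * (C * |x - y (n + 1)| ^ e / tameBound e L M (n + 1)) :=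
  hf.local_distortion (hy n).1 (tameBound_pos hp.one_le _) (ht.low n) (ht.low_inv n)
    (hp.pullRadius_pos _) (hp.pullRadius_le _)

lemma pullRadius_distortion_le (n : ℕ) {x : ℝ}
    (hx : x ∈ Metric.ball (y (n + 1)) (pullRadius L σ (n + 1))) :
    |Real.log |deriv f x| - Real.log (|deriv f (y (n + 1))|)| ≤ 1 / 4 := by
  refine ((pullRadius_distortion hf hy ht hp n).2 x hx).trans ?_
  have h1 : |x - y (n + 1)| ^ e ≤ pullRadius L σ (n + 1) ^ e :=
    Real.rpow_le_rpow (abs_nonneg _) (by rw [Metric.mem_ball, Real.dist_eq] at hx; exact hx.le)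
      hf.e_pos.le
  have h2 := hp.pullRadius_le (n + 1)
  have h3 : C * |x - y (n + 1)| ^ e / tameBound e L M (n + 1) ≤ 1 / 8 := by
    rw [div_le_iff₀ (tameBound_pos hp.one_le _)]
    have := mul_le_mul_of_nonneg_left h1 hf.C_pos.le
    linarith
  linarith

/-- Logarithmic distortion at most `1/4 < log 2` keeps the derivative on the ball above half of
`tameBound`, so one more pullback of the shrinking ball exists. -/
lemma ball_subset_image_pullRadius (n : ℕ) :
    Metric.ball (y n) (2 * M * Real.exp (-(L * n)) * α)
      ⊆ f '' Metric.ball (y (n + 1)) (pullRadius L σ (n + 1)) := by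
  have hb := (pullRadius_distortion hf hy ht hp n).1
  have h1 := ball_subset_image_ball (f := f) (x := y (n + 1)) (r := pullRadius L σ (n + 1))
    (m := tameBound e L M (n + 1) / 2) (half_pos (tameBound_pos hp.one_le _))
    (fun z hz => (hf.hasStrictDerivAt (hb hz)).hasDerivAt.differentiableAt) (fun z hz => by
      have h2 := (abs_le.1 (pullRadius_distortion_le hf hy ht hp n hz)).1
      have hd : 0 < |deriv f (y (n + 1))| := abs_pos.2 (hf.deriv_ne (hy n).1)
      have hz0 : 0 < |deriv f z| := abs_pos.2 (hf.deriv_ne (hb hz))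
      have h3 : Real.log (|deriv f (y (n + 1))| / 2) ≤ Real.log |deriv f z| := by
        rw [Real.log_div hd.ne' two_ne_zero]
        have := Real.log_two_gt_d9
        linarith
      have h4 := (Real.log_le_log_iff (by positivity) hz0).1 h3
      have := ht.low n
      linarith)
  rw [(hy n).2] at h1
  exact (Metric.ball_subset_ball (hp.tameBound_mul n)).trans h1

omit hf hy ht hp in
lemma iterate_mem_pullSet {n : ℕ} {x : ℝ} (hx : x ∈ pullSet f L σ α y n) {k : ℕ} (hk : k ≤ n) :
    f^[n - k] x ∈ pullSet f L σ α y k := by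
  induction n generalizing x with
  | zero => obtain rfl : k = 0 := by omega
            exact hx
  | succ n ih =>
    rcases hk.eq_or_lt with rfl | hlt
    · simpa using hx
    · rw [show n + 1 - k = (n - k) + 1 by omega, Function.iterate_succ_apply]
      exact ih hx.2 (by omega)

omit hf ht in
lemma mem_pullSet (n : ℕ) : y n ∈ pullSet f L σ α y n := by
  induction n with
  | zero => exact Metric.mem_ball_self hp.α_pos
  | succ n ih => exact ⟨Metric.mem_ball_self (hp.pullRadius_pos _), by rwa [mem_preimage, (hy n).2]⟩

/-- The two claims support each other. Contraction at step `n` puts the `n`-th pullback inside the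
image of the next ball, which gives the next diffeomorphism. For the next contraction, the
distortion of the `n` earlier factors is a geometric sum, at most `1/4` by the contraction already
known; the newest factor contributes at most `1/4` by the choice of the radius alone. As `1/2 < log
2`, the derivative is at least half of its value on the orbit, and the mean value theorem concludes.
-/
lemma iterDiffeo_pullSet_aux (n : ℕ) :
    IterDiffeo (dom p q) f n (pullSet f L σ α y n) (Metric.ball (y 0) α) ∧
      ∀ x ∈ pullSet f L σ α y n,
        |x - y n| ≤ 2 * M * Real.exp (-(L * n)) * |f^[n] x - y 0| := by
  induction n using Nat.strong_induction_on with
  | _ n ih =>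
  cases n with
  | zero =>
    refine ⟨⟨Metric.isOpen_ball, by simp [iterDom_zero], bijOn_id _⟩, fun x _ => ?_⟩
    have := hp.one_le
    have := abs_nonneg (x - y 0)
    simp only [Nat.cast_zero, mul_zero, neg_zero, Real.exp_zero, mul_one, Function.iterate_zero,
      id_eq]
    nlinarith
  | succ n =>
    obtain ⟨hD, hE⟩ := ih n n.lt_succ_self
    have hb := pullRadius_distortion hf hy ht hp n
    have hsub : pullSet f L σ α y n ⊆ f '' Metric.ball (y (n + 1)) (pullRadius L σ (n + 1)) := by
      refine Subset.trans (fun x hx => ?_) (ball_subset_image_pullRadius hf hy ht hp n)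
      rw [Metric.mem_ball, Real.dist_eq]
      refine (hE x hx).trans_lt ?_
      have h1 := hD.bijOn.mapsTo hx
      rw [Metric.mem_ball, Real.dist_eq] at h1
      have := hp.one_le
      gcongr
    have hbij : BijOn f (pullSet f L σ α y (n + 1)) (pullSet f L σ α y n) := by
      refine ⟨fun x hx => hx.2, (hf.injOn_of_isPreconnected
        (convex_ball _ _).isPreconnected hb.1).mono inter_subset_left, fun x hx => ?_⟩
      obtain ⟨w, hw, rfl⟩ := hsub hx
      exact ⟨w, ⟨hw, hx⟩, rfl⟩
    have hdiff : IterDiffeo (dom p q) f (n + 1) (pullSet f L σ α y (n + 1))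
        (Metric.ball (y 0) α) := by
      refine ⟨?_, fun x hx => mem_iterDom_succ.2 ⟨hb.1 hx.1, hD.subset hx.2⟩, ?_⟩
      · exact ContinuousOn.isOpen_inter_preimage
          (fun x hx => (hf.continuousAt (hb.1 hx)).continuousWithinAt) Metric.isOpen_ball hD.isOpen
      · rw [Function.iterate_succ]
        exact hD.bijOn.comp hbij
    refine ⟨hdiff, fun x hx => ?_⟩
    have hy1 := mem_pullSet hy hp (n + 1)
    have hoc : (pullSet f L σ α y (n + 1)).OrdConnected :=
      (hf.isPreconnected_of_iterDiffeo hdiff (convex_ball _ _).isPreconnected).ordConnected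
    have hM : 0 < M := by linarith [hp.one_le]
    have hrate := ht.rate (n + 1)
    have hlow : ∀ z ∈ pullSet f L σ α y (n + 1),
        |deriv f^[n + 1] (y (n + 1))| / 2 ≤ |deriv f^[n + 1] z| := by
      intro z hz
      -- The factors are indexed from the end: `f^[n - k] z` lies in the pullback number `k + 1`,
      -- around `y (k + 1)`.
      have hz1 : Real.log |deriv f^[n + 1] z| = ∑ k ∈ Finset.range (n + 1),
          Real.log |deriv f (f^[n - k] z)| := by
        rw [hf.deriv_iterate (hdiff.subset hz), ← Finset.prod_range_reflect, Finset.abs_prod,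
          Real.log_prod]
        · refine Finset.sum_congr rfl fun k _ => ?_
          rw [show n + 1 - 1 - k = n - k by omega]
        · intro k hk
          have hk' := Finset.mem_range.1 hk
          exact abs_ne_zero.2 (hf.deriv_ne (hdiff.subset hz _ (by omega)))
      have hdist : |Real.log |deriv f^[n + 1] z| - Real.log (|deriv f^[n + 1] (y (n + 1))|)|
          ≤ 1 / 2 := by
        rw [hz1, hf.log_deriv_iterate_orbit hy, ← Finset.sum_sub_distrib, Finset.sum_range_succ]
        refine (abs_add_le _ _).trans ?_
        have hlast : |Real.log |deriv f (f^[n - n] z)| - Real.log (|deriv f (y (n + 1))|)| ≤ 1 / 4 := by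
          rw [Nat.sub_self]
          exact pullRadius_distortion_le hf hy ht hp n hz.1
        have hfirst : |∑ k ∈ Finset.range n, (Real.log |deriv f (f^[n - k] z)| -
            Real.log (|deriv f (y (k + 1))|))| ≤ 1 / 4 := by
          refine (Finset.abs_sum_le_sum_abs _ _).trans ?_
          refine le_trans (Finset.sum_le_sum fun k hk => ?_)
            ((hp.sum_le hf.C_pos hf.e_pos n hp.α_pos.le).trans hp.α_const)
          have hk' := Finset.mem_range.1 hk
          have hmem := iterate_mem_pullSet hz (k := k + 1) (by omega)
          rw [show n + 1 - (k + 1) = n - k by omega] at hmem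
          have h1 := (ih (k + 1) (by omega)).2 _ hmem
          have h2 := (ih (k + 1) (by omega)).1.bijOn.mapsTo hmem
          rw [Metric.mem_ball, Real.dist_eq] at h2
          refine ((pullRadius_distortion hf hy ht hp k).2 _ hmem.1).trans
            (hp.term_le hf.C_pos hf.e_pos (k + 1) (abs_nonneg _) hp.α_pos.le (h1.trans ?_))
          gcongr
        linarith
      have hd : 0 < |deriv f^[n + 1] (y (n + 1))| :=
        abs_pos.2 (hf.deriv_iterate_ne (hdiff.subset hy1))
      have hz0 : 0 < |deriv f^[n + 1] z| := abs_pos.2 (hf.deriv_iterate_ne (hdiff.subset hz))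
      refine (Real.log_le_log_iff (by positivity) hz0).1 ?_
      rw [Real.log_div hd.ne' two_ne_zero]
      have := Real.log_two_gt_d9
      linarith [(abs_le.1 hdist).1]
    have hmvt : ∃ z ∈ pullSet f L σ α y (n + 1),
        f^[n + 1] x - f^[n + 1] (y (n + 1)) = deriv f^[n + 1] z * (x - y (n + 1)) := by
      have hcd : ∀ z ∈ pullSet f L σ α y (n + 1), DifferentiableAt ℝ f^[n + 1] z := fun z hz =>
        (hf.hasDerivAt_iterate (hdiff.subset hz)).differentiableAt
      rcases lt_trichotomy x (y (n + 1)) with hlt | heq | hlt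
      · have hs := hoc.out hx hy1
        obtain ⟨z, hz, hz1⟩ := exists_deriv_eq_slope f^[n + 1] hlt
          (fun z hz => (hcd z (hs hz)).continuousAt.continuousWithinAt)
          (fun z hz => (hcd z (hs (Ioo_subset_Icc_self hz))).differentiableWithinAt)
        refine ⟨z, hs (Ioo_subset_Icc_self hz), ?_⟩
        rw [eq_div_iff (by linarith)] at hz1
        linarith
      · exact ⟨x, hx, by rw [← heq]; ring⟩
      · have hs := hoc.out hy1 hx
        obtain ⟨z, hz, hz1⟩ := exists_deriv_eq_slope f^[n + 1] hlt
          (fun z hz => (hcd z (hs hz)).continuousAt.continuousWithinAt)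
          (fun z hz => (hcd z (hs (Ioo_subset_Icc_self hz))).differentiableWithinAt)
        refine ⟨z, hs (Ioo_subset_Icc_self hz), ?_⟩
        rw [eq_div_iff (by linarith)] at hz1
        linarith
    obtain ⟨z, hz, hzx⟩ := hmvt
    have hy0 : f^[n + 1] (y (n + 1)) = y 0 := iterate_apply_of_mem hy (n + 1) 0
    rw [hy0] at hzx
    rw [hzx, abs_mul]
    have h1 : M⁻¹ * Real.exp (L * (n + 1 : ℕ)) / 2 ≤ |deriv f^[n + 1] z| := by
      have := hlow z hz
      rw [mul_comm L]
      linarith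
    have h2 : 1 ≤ 2 * M * Real.exp (-(L * (n + 1 : ℕ))) * |deriv f^[n + 1] z| := by
      refine le_trans (le_of_eq ?_) (mul_le_mul_of_nonneg_left h1
        (by positivity : 0 ≤ 2 * M * Real.exp (-(L * (n + 1 : ℕ)))))
      rw [Real.exp_neg]
      field_simp
    nlinarith [abs_nonneg (x - y (n + 1))]

/-- The points of the pullbacks lie on backward orbits that stay in the pullbacks. -/
lemma exists_mem_pullSet {n : ℕ} {x : ℝ} (hx : x ∈ pullSet f L σ α y n) :
    ∃ y' ∈ backwardOrbits (dom p q) f, (∀ k, y' k ∈ pullSet f L σ α y k) ∧ y' n = x := by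
  have haux := iterDiffeo_pullSet_aux hf hy ht hp
  have hstep : ∀ k, ∀ z : pullSet f L σ α y k, ∃ w : pullSet f L σ α y (k + 1), f w = z := by
    rintro k ⟨z, hz⟩
    obtain ⟨w, hw, hwz⟩ := (haux (k + 1)).1.bijOn.surjOn ((haux k).1.bijOn.mapsTo hz)
    refine ⟨⟨w, hw⟩, (haux k).1.bijOn.injOn hw.2 hz ?_⟩
    rw [← hwz, Function.iterate_succ_apply]
  choose g hg using hstep
  have h0 : f^[n] x ∈ pullSet f L σ α y 0 := iterate_mem_pullSet hx (Nat.zero_le n)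
  let z : (k : ℕ) → pullSet f L σ α y k := fun k => Nat.rec ⟨f^[n] x, h0⟩ (fun k w => g k w) k
  let w : ℕ → ℝ := fun k => (z k).1
  have hz : w ∈ backwardOrbits (dom p q) f := fun i =>
    ⟨(haux (i + 1)).1.subset (z (i + 1)).2 0 i.succ_pos, hg i (z i)⟩
  refine ⟨w, hz, fun k => (z k).2, ?_⟩
  exact (haux n).1.bijOn.injOn (z n).2 hx (iterate_apply_of_mem hz n 0)

/-- `V` consists of the backward orbits that stay in the pullbacks of the ball. Their coordinates at
time `n` fill the `n`-th pullback by `exists_mem_pullSet`, and the contraction makes the distortion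
a geometric series times a power of the distance of the base points. -/
theorem exists_isUnstableManifold : ∃ V : Set (ℕ → ℝ), IsUnstableManifold (dom p q) f y α V ∧
    ∀ y' ∈ V, ∑' i, distortionTerm f y y' i ≤ tameConst C e L M * |proj y - proj y'| ^ e ∧
      ∑' i, distortionTerm f y y' i ≤ 1 / 4 := by
  have haux := iterDiffeo_pullSet_aux hf hy ht hp
  set V : Set (ℕ → ℝ) := {y' ∈ backwardOrbits (dom p q) f | ∀ k, y' k ∈ pullSet f L σ α y k} with hV
  have himage : ∀ n, proj '' (back^[n] '' V) = pullSet f L σ α y n := by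
    intro n
    ext x
    rw [mem_proj_image_iff]
    constructor
    · rintro ⟨y', hy', rfl⟩
      exact hy'.2 n
    · intro hx
      obtain ⟨y', h1, h2, h3⟩ := exists_mem_pullSet hf hy ht hp hx
      exact ⟨y', ⟨h1, h2⟩, h3⟩
  have hball : proj '' V = Metric.ball (proj y) α := by
    have := himage 0
    rwa [Function.iterate_zero, image_id] at this
  have hterm : ∀ y' ∈ V, ∀ k, distortionTerm f y y' k ≤
      2 * C * (2 * M) ^ e * M * tameRate e L ^ (k + 1) * |proj y - proj y'| ^ e := by
    intro y' hy' k
    have h1 := (haux (k + 1)).2 _ (hy'.2 (k + 1))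
    have h0 : f^[k + 1] (y' (k + 1)) = y' 0 := iterate_apply_of_mem hy'.1 (k + 1) 0
    rw [h0, abs_sub_comm (y' 0)] at h1
    exact ((pullRadius_distortion hf hy ht hp k).2 _ (hy'.2 (k + 1)).1).trans
      (hp.term_le hf.C_pos hf.e_pos (k + 1) (abs_nonneg _) (abs_nonneg _) h1)
  have hsum : ∀ y' ∈ V, Summable (distortionTerm f y y') ∧
      ∑' i, distortionTerm f y y' i ≤ tameConst C e L M * |proj y - proj y'| ^ e := by
    intro y' hy'
    have hle : ∀ n, ∑ k ∈ Finset.range n, distortionTerm f y y' k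
        ≤ tameConst C e L M * |proj y - proj y'| ^ e := fun n =>
      (Finset.sum_le_sum fun k _ => hterm y' hy' k).trans
        (hp.sum_le hf.C_pos hf.e_pos n (abs_nonneg _))
    exact ⟨summable_of_sum_range_le (fun _ => abs_nonneg _) hle,
      Real.tsum_le_of_sum_range_le (fun _ => abs_nonneg _) hle⟩
  have hquarter : ∀ y' ∈ V, ∑' i, distortionTerm f y y' i ≤ 1 / 4 := by
    intro y' hy'
    refine (hsum y' hy').2.trans (le_trans ?_ hp.α_const)
    have h1 : proj y' ∈ Metric.ball (proj y) α := hball ▸ mem_image_of_mem _ hy'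
    rw [Metric.mem_ball, Real.dist_eq, abs_sub_comm] at h1
    have hθ1 := tameRate_lt_one hf.e_pos hp.L_pos
    have hc : 0 ≤ tameConst C e L M := by
      have := hf.C_pos
      have := hp.one_le
      have : 0 ≤ (1 - tameRate e L)⁻¹ := inv_nonneg.2 (by linarith)
      unfold tameConst
      positivity
    exact mul_le_mul_of_nonneg_left (Real.rpow_le_rpow (abs_nonneg _) h1.le hf.e_pos.le) hc
  refine ⟨V, ⟨fun _ h => h.1, ⟨hy, mem_pullSet hy hp⟩, hball, fun n _ => ?_,
    fun y' hy' => (hsum y' hy').1, fun y' hy' => ?_⟩,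
    fun y' hy' => ⟨(hsum y' hy').2, hquarter y' hy'⟩⟩
  · rw [himage, hball]
    exact (haux n).1
  · have := Real.log_two_gt_d9
    linarith [hquarter y' hy']

end UnstableManifold

/-! ### Almost every backward orbit is tame: existence of unstable families. -/

section UnstableFamily

variable {ι : Type*} {a b : ℝ} {p q : ι → ℝ} {f : ℝ → ℝ} {C e : ℝ}

lemma exists_forall_le_of_eventually {u : ℕ → ℝ} {c : ℝ} (h : ∀ᶠ n in atTop, u n ≤ c) :
    ∃ B, ∀ n, u n ≤ B := by
  obtain ⟨B, hB⟩ := Filter.IsBoundedUnder.bddAbove_range (f := u) ⟨c, h⟩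
  exact ⟨B, fun n => hB (mem_range_self n)⟩

/-- Backward orbits with the exponential rates `χ ± η` and the slow approach to the cusps, all with
the constant `N`. -/
def IsRegularWith (D : Set ℝ) (f : ℝ → ℝ) (e χ η : ℝ) (N : ℕ) (y : ℕ → ℝ) : Prop :=
  y ∈ backwardOrbits D f ∧ 1 ≤ N ∧ ∀ n : ℕ,
    ((N : ℝ)⁻¹ * Real.exp (n * (χ - η)) < |deriv f^[n] (y n)| ∧
      |deriv f^[n] (y n)| < N * Real.exp (n * (χ + η))) ∧
    (tameBound e (χ - η) N (n + 1) ≤ |deriv f (y (n + 1))| ∧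
      tameBound e (χ - η) N (n + 1) ≤ |deriv f (y (n + 1))|⁻¹)

lemma measurableSet_isRegularWith {D : Set ℝ} (hD : MeasurableSet D) (hf : Measurable f)
    (e χ η : ℝ) (N : ℕ) : MeasurableSet {y | IsRegularWith D f e χ η N y} := by
  have hm : ∀ n k : ℕ, Measurable fun y : ℕ → ℝ => |deriv f^[n] (y k)| := fun n k =>
    ((measurable_deriv _).comp (measurable_pi_apply k)).abs
  have hm1 : ∀ k : ℕ, Measurable fun y : ℕ → ℝ => |deriv f (y k)| := fun k => hm 1 k
  refine (measurableSet_backwardOrbits hD hf).inter (MeasurableSet.inter (.const _) ?_)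
  have : {y : ℕ → ℝ | ∀ n : ℕ, ((N : ℝ)⁻¹ * Real.exp (n * (χ - η)) < |deriv f^[n] (y n)| ∧
      |deriv f^[n] (y n)| < N * Real.exp (n * (χ + η))) ∧
      (tameBound e (χ - η) N (n + 1) ≤ |deriv f (y (n + 1))| ∧
      tameBound e (χ - η) N (n + 1) ≤ |deriv f (y (n + 1))|⁻¹)} =
      ⋂ n : ℕ, (({y | (N : ℝ)⁻¹ * Real.exp (n * (χ - η)) < |deriv f^[n] (y n)|} ∩
      {y | |deriv f^[n] (y n)| < N * Real.exp (n * (χ + η))}) ∩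
      ({y | tameBound e (χ - η) N (n + 1) ≤ |deriv f (y (n + 1))|} ∩
      {y | tameBound e (χ - η) N (n + 1) ≤ |deriv f (y (n + 1))|⁻¹})) := by
    ext y
    simp only [mem_ofPred_eq, mem_iInter, mem_inter_iff]
  change MeasurableSet {y : ℕ → ℝ | ∀ n : ℕ, _}
  rw [this]
  exact .iInter fun n => (((measurableSet_lt measurable_const (hm n n)).inter
    (measurableSet_lt (hm n n) measurable_const)).inter
    ((measurableSet_le measurable_const (hm1 (n + 1))).inter
    (measurableSet_le measurable_const (hm1 (n + 1)).inv)))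

/-- Along almost every backward orbit, the expansion has rate `χ` and the derivative is
subexponential. -/
lemma ae_tendsto_log_deriv (hf : IsBasicCuspMap a b p q f) {μ : Measure ℝ} {ν : Measure (ℕ → ℝ)}
    [IsProbabilityMeasure ν] (hν : IsNaturalExtension (dom p q) f μ ν) (herg : Ergodic f μ)
    (hint : Integrable (fun x => Real.log |deriv f x|) μ) :
    ∀ᵐ y ∂ν, Tendsto (fun n : ℕ => Real.log |deriv f^[n] (y n)| / n) atTop (𝓝 (lyapunov f μ)) := by
  have hm : Measurable fun x => Real.log |deriv f x| :=
    Real.measurable_log.comp (measurable_deriv f).abs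
  have hev := hν.measurePreserving_eval 1
  have h1 := ae_tendsto_birkhoffSum_div (hν.ergodic_back herg) (hm.comp (measurable_pi_apply 1))
    (hev.integrable_comp_of_integrable hint)
  have h2 : ∫ y : ℕ → ℝ, ((fun x => Real.log |deriv f x|) ∘ fun y => y 1) y ∂ν = lyapunov f μ := by
    rw [lyapunov, ← hev.map_eq, integral_map hev.measurable.aemeasurable hm.aestronglyMeasurable]
    rfl
  rw [h2] at h1
  filter_upwards [h1, hν.supported] with y hy hyY
  refine hy.congr fun n => ?_
  rw [hf.log_deriv_iterate_orbit hyY]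
  simp only [birkhoffSum, Function.comp, back_iterate_apply, add_comm]

/-- Each bound holds with constant `1` for large `n`, and `N` absorbs the finitely many exceptions.
The one-step derivatives are subexponential because `S (n+1) / (n+1)` and `S n / n` have the same
limit. -/
lemma exists_isRegularWith (hf : IsBasicCuspMap a b p q f) {χ η : ℝ} (he : 0 < e) (hη : 0 < η)
    (hηχ : η < χ) {y : ℕ → ℝ} (hy : y ∈ backwardOrbits (dom p q) f)
    (h : Tendsto (fun n : ℕ => Real.log |deriv f^[n] (y n)| / n) atTop (𝓝 χ)) :
    ∃ N, IsRegularWith (dom p q) f e χ η N y := by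
  set S : ℕ → ℝ := fun n => Real.log |deriv f^[n] (y n)| with hS
  have hexp : ∀ n, Real.exp (S n) = |deriv f^[n] (y n)| := fun n =>
    Real.exp_log (abs_pos.2 (hf.deriv_iterate_ne (mem_iterDom_of_mem hy n)))
  have hexp1 : ∀ n, Real.exp (S (n + 1) - S n) = |deriv f (y (n + 1))| := by
    intro n
    have h1 : S (n + 1) - S n = Real.log |deriv f (y (n + 1))| := by
      simp only [hS]
      rw [hf.log_deriv_iterate_orbit hy, hf.log_deriv_iterate_orbit hy, Finset.sum_range_succ]
      ring
    rw [h1, Real.exp_log (abs_pos.2 (hf.deriv_ne (hy n).1))]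
  set κ := (χ - η) / 2 * min 1 e with hκ
  have hκ0 : 0 < κ := mul_pos (by linarith) (lt_min one_pos he)
  obtain ⟨B₁, hB₁⟩ := exists_forall_le_of_eventually (c := 1)
    (u := fun n : ℕ => Real.exp (n * (χ - η) - S n)) <| by
    filter_upwards [h.eventually_const_lt (show χ - η < χ by linarith), eventually_gt_atTop 0]
      with n hn hn0
    rw [Real.exp_le_one_iff]
    rw [lt_div_iff₀ (by exact_mod_cast hn0)] at hn
    linarith
  obtain ⟨B₂, hB₂⟩ := exists_forall_le_of_eventually (c := 1)
    (u := fun n : ℕ => Real.exp (S n - n * (χ + η))) <| by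
    filter_upwards [h.eventually_lt_const (show χ < χ + η by linarith), eventually_gt_atTop 0]
      with n hn hn0
    rw [Real.exp_le_one_iff]
    rw [div_lt_iff₀ (by exact_mod_cast hn0)] at hn
    linarith
  obtain ⟨B₃, hB₃⟩ := exists_forall_le_of_eventually (c := 1)
    (u := fun n : ℕ => Real.exp (|S (n + 1) - S n| - κ * (n + 1 : ℕ))) <| by
    have h1 : Tendsto (fun n : ℕ => S (n + 1) / (n + 1 : ℕ) - S n / n) atTop (𝓝 0) := by
      have := (h.comp (tendsto_add_atTop_nat 1)).sub h
      rwa [sub_self] at this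
    have h2 : Tendsto (fun n : ℕ => (S n / n) * (1 / ((n : ℝ) + 1))) atTop (𝓝 0) := by
      have := h.mul (tendsto_one_div_add_atTop_nhds_zero_nat (𝕜 := ℝ))
      rwa [mul_zero] at this
    have h3 : Tendsto (fun n : ℕ => |S (n + 1) / (n + 1 : ℕ) - S n / n +
        (S n / n) * (1 / ((n : ℝ) + 1))|) atTop (𝓝 0) := by
      simpa using (h1.add h2).abs
    filter_upwards [h3.eventually_lt_const hκ0, eventually_gt_atTop 0] with n hn hn0
    rw [Real.exp_le_one_iff]
    have hn' : (0 : ℝ) < n := by exact_mod_cast hn0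
    have e1 : S (n + 1) / (n + 1 : ℕ) - S n / n + (S n / n) * (1 / ((n : ℝ) + 1))
        = (S (n + 1) - S n) / (n + 1 : ℕ) := by
      push_cast
      field_simp
      ring
    have hpos : (0 : ℝ) < (n + 1 : ℕ) := by positivity
    rw [e1, abs_div, abs_of_pos hpos, div_lt_iff₀ hpos] at hn
    linarith
  obtain ⟨N, hN⟩ := exists_nat_gt (max (max B₁ B₂) (max B₃ 1))
  have hN1 : B₁ < N := lt_of_le_of_lt ((le_max_left _ _).trans (le_max_left _ _)) hN
  have hN2 : B₂ < N := lt_of_le_of_lt ((le_max_right _ _).trans (le_max_left _ _)) hN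
  have hN3 : B₃ < N := lt_of_le_of_lt ((le_max_left _ _).trans (le_max_right _ _)) hN
  have hN4 : (1 : ℝ) < N := lt_of_le_of_lt ((le_max_right _ _).trans (le_max_right _ _)) hN
  have hN0 : (0 : ℝ) < N := by linarith
  have htame : ∀ n, tameBound e (χ - η) N (n + 1) ≤ Real.exp (-|S (n + 1) - S n|) := by
    intro n
    have := (hB₃ n).trans hN3.le
    rw [tameBound, inv_mul_le_iff₀ hN0, ← hκ, Real.exp_neg, ← div_eq_mul_inv,
      le_div_iff₀ (Real.exp_pos _), ← Real.exp_add]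
    convert this using 2
    ring
  refine ⟨N, hy, by exact_mod_cast hN4.le, fun n => ⟨⟨?_, ?_⟩, ?_, ?_⟩⟩
  · have := (hB₁ n).trans_lt hN1
    rw [Real.exp_sub, div_lt_iff₀ (Real.exp_pos _), hexp] at this
    rwa [inv_mul_lt_iff₀ hN0]
  · have := (hB₂ n).trans_lt hN2
    rwa [Real.exp_sub, div_lt_iff₀ (Real.exp_pos _), hexp] at this
  · rw [← hexp1]
    exact (htame n).trans (Real.exp_le_exp.2 (neg_abs_le _))
  · rw [← hexp1, ← Real.exp_neg]
    exact (htame n).trans (Real.exp_le_exp.2 (neg_le_neg (le_abs_self _)))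

/-- The radii in the construction of unstable manifolds as functions of the constant. -/
noncomputable def tameSigma (C e M : ℝ) : ℝ := ((8 * C * M)⁻¹) ^ e⁻¹

/-- The size of the unstable manifolds as a function of the constant. -/
noncomputable def tameSize (C e L M : ℝ) : ℝ :=
  min (1 / 4) (min ((4 * M)⁻¹ * (M⁻¹ * tameSigma C e M * Real.exp (-L)))
    (((4 * tameConst C e L M)⁻¹) ^ e⁻¹))

lemma tameConst_pos {L M : ℝ} (hC : 0 < C) (he : 0 < e) (hL : 0 < L) (hM : 1 ≤ M) :
    0 < tameConst C e L M := by
  have : 0 < (1 - tameRate e L)⁻¹ := inv_pos.2 (by linarith [tameRate_lt_one he hL])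
  have : 0 < M := by linarith
  unfold tameConst
  positivity

lemma tameParams {L M : ℝ} (hC : 0 < C) (he : 0 < e) (hL : 0 < L) (hM : 1 ≤ M) :
    TameParams C e L M (tameSigma C e M) (tameSize C e L M) := by
  have hM0 : 0 < M := by linarith
  have hσ : 0 < tameSigma C e M := by unfold tameSigma; positivity
  have hc := tameConst_pos hC he hL hM
  have hα : 0 < tameSize C e L M := by
    unfold tameSize
    positivity
  refine ⟨hL, hM, hσ, ?_, hα, ?_, ?_⟩
  · rw [tameSigma, ← Real.rpow_mul (by positivity), inv_mul_cancel₀ he.ne', Real.rpow_one]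
    apply le_of_eq
    field_simp
  · have h1 : tameSize C e L M ≤ (4 * M)⁻¹ * (M⁻¹ * tameSigma C e M * Real.exp (-L)) :=
      (min_le_right _ _).trans (min_le_left _ _)
    rwa [← div_eq_inv_mul, le_div_iff₀' (by positivity)] at h1
  · have h1 : tameSize C e L M ≤ ((4 * tameConst C e L M)⁻¹) ^ e⁻¹ :=
      (min_le_right _ _).trans (min_le_right _ _)
    have h2 := Real.rpow_le_rpow hα.le h1 he.le
    rw [← Real.rpow_mul (by positivity), inv_mul_cancel₀ he.ne', Real.rpow_one] at h2
    refine (mul_le_mul_of_nonneg_left h2 hc.le).trans (le_of_eq ?_)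
    field_simp

/-- Unstable families exist, with distortion bounded by a small constant. -/
theorem exists_isUnstableFamily (hf : IsCuspMap a b p q f C e) {μ : Measure ℝ}
    {ν : Measure (ℕ → ℝ)} [IsProbabilityMeasure ν] [Countable ι]
    (hν : IsNaturalExtension (dom p q) f μ ν)
    (herg : Ergodic f μ) (hint : Integrable (fun x => Real.log |deriv f x|) μ) {η : ℝ}
    (hη : 0 < η) (hηχ : η < lyapunov f μ) :
    ∃ (α ρ γ : (ℕ → ℝ) → ℝ) (V : (ℕ → ℝ) → Set (ℕ → ℝ)),
      IsUnstableFamily (dom p q) f e (lyapunov f μ) η ν α ρ γ V ∧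
      ∀ᵐ y ∂ν, ∀ y' ∈ V y, ∑' i, distortionTerm f y y' i ≤ 1 / 4 := by
  classical
  set χ := lyapunov f μ with hχ
  -- The second alternative makes the search for the least `N` succeed everywhere, so `M` is a
  -- measurable function on the whole space. Size, rate and Hölder constants are functions of the
  -- integer `M y`, hence measurable too.
  let P : (ℕ → ℝ) → ℕ → Prop := fun y N =>
    IsRegularWith (dom p q) f e χ η N y ∨ ∀ N, ¬ IsRegularWith (dom p q) f e χ η N y
  have hP : ∀ y, ∃ N, P y N := by
    intro y
    by_cases h : ∃ N, IsRegularWith (dom p q) f e χ η N y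
    · exact h.imp fun N hN => Or.inl hN
    · exact ⟨0, Or.inr (not_exists.1 h)⟩
  have hreg := measurableSet_isRegularWith (isOpen_dom (p := p) (q := q)).measurableSet
    herg.measurable e χ η
  have hPm : ∀ N, MeasurableSet {y | P y N} := by
    intro N
    have : {y | P y N} = {y | IsRegularWith (dom p q) f e χ η N y} ∪
        ⋂ N, {y | IsRegularWith (dom p q) f e χ η N y}ᶜ := by
      ext y
      simp [P]
    rw [this]
    exact (hreg N).union (.iInter fun N => (hreg N).compl)
  let M : (ℕ → ℝ) → ℕ := fun y => Nat.find (hP y)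
  have hM : Measurable M := measurable_find hP hPm
  have hae : ∀ᵐ y ∂ν, IsRegularWith (dom p q) f e χ η (M y) y := by
    filter_upwards [ae_tendsto_log_deriv hf.toIsBasicCuspMap hν herg hint, hν.supported]
      with y hy hyY
    obtain ⟨N, hN⟩ := exists_isRegularWith hf.toIsBasicCuspMap hf.e_pos hη hηχ hyY hy
    rcases Nat.find_spec (hP y) with h | h
    · exact h
    · exact absurd hN (h N)
  have hL : 0 < χ - η := by linarith
  have hex : ∀ y, IsRegularWith (dom p q) f e χ η (M y) y → ∃ V : Set (ℕ → ℝ),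
      IsUnstableManifold (dom p q) f y (tameSize C e (χ - η) (M y)) V ∧
      ∀ y' ∈ V, ∑' i, distortionTerm f y y' i
        ≤ tameConst C e (χ - η) (M y) * |proj y - proj y'| ^ e ∧
        ∑' i, distortionTerm f y y' i ≤ 1 / 4 := fun y hy =>
    exists_isUnstableManifold hf hy.1 ⟨fun n => (hy.2.2 n).1.1.le, fun n => (hy.2.2 n).2.1,
      fun n => (hy.2.2 n).2.2⟩ (tameParams hf.C_pos hf.e_pos hL (by exact_mod_cast hy.2.1))
  let V : (ℕ → ℝ) → Set (ℕ → ℝ) := fun y =>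
    if h : IsRegularWith (dom p q) f e χ η (M y) y then (hex y h).choose else ∅
  have hV : ∀ y, IsRegularWith (dom p q) f e χ η (M y) y →
      IsUnstableManifold (dom p q) f y (tameSize C e (χ - η) (M y)) (V y) ∧
      ∀ y' ∈ V y, ∑' i, distortionTerm f y y' i
        ≤ tameConst C e (χ - η) (M y) * |proj y - proj y'| ^ e ∧
        ∑' i, distortionTerm f y y' i ≤ 1 / 4 := by
    intro y h
    simp only [V, h, dite_true]
    exact (hex y h).choose_spec
  refine ⟨fun y => tameSize C e (χ - η) (M y), fun y => M y,
    fun y => tameConst C e (χ - η) (M y), V,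
    ⟨(measurable_from_nat (f := fun N => tameSize C e (χ - η) N)).comp hM,
      (measurable_from_nat (f := fun N : ℕ => (N : ℝ))).comp hM,
      (measurable_from_nat (f := fun N => tameConst C e (χ - η) N)).comp hM, ?_⟩, ?_⟩
  · filter_upwards [hae] with y hy
    have hM1 : (1 : ℝ) ≤ M y := by exact_mod_cast hy.2.1
    refine ⟨(tameParams hf.C_pos hf.e_pos hL hM1).α_pos,
      (min_le_left _ _).trans_lt (by norm_num), (hV y hy).1, by linarith,
      fun n _ => (hy.2.2 n).1.1, fun n _ => (hy.2.2 n).1.2, fun y' hy' => ((hV y hy).2 y' hy').1⟩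
  · filter_upwards [hae] with y hy
    exact fun y' hy' => ((hV y hy).2 y' hy').2

end UnstableFamily

/-! ### Return times of positive density. -/

section Frequency

/-- A set of natural numbers with positive density is enumerated at linear speed, with gaps that
are small compared to the position. -/
lemma tendsto_nth_of_density {s : ℕ → Prop} [DecidablePred s] {L : ℝ} (hL : 0 < L)
    (h : Tendsto (fun n : ℕ => (Nat.count s n : ℝ) / n) atTop (𝓝 L)) :
    {n | s n}.Infinite ∧
      Tendsto (fun j : ℕ => (j : ℝ) / (Nat.nth s j + 1 : ℕ)) atTop (𝓝 L) ∧
      Tendsto (fun j : ℕ => ((Nat.nth s j + 1 : ℕ) : ℝ) / (Nat.nth s (j + 1) + 1 : ℕ)) atTop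
        (𝓝 1) := by
  have hinf : {n | s n}.Infinite := by
    intro hfin
    obtain ⟨B, hB⟩ : ∃ B, ∀ n, Nat.count s n ≤ B := by
      refine ⟨hfin.toFinset.card, fun n => ?_⟩
      rw [Nat.count_eq_card_filter_range]
      exact Finset.card_le_card fun k hk =>
        hfin.mem_toFinset.2 (Finset.mem_filter.1 hk).2
    have h0 : Tendsto (fun n : ℕ => (Nat.count s n : ℝ) / n) atTop (𝓝 0) := by
      refine squeeze_zero (fun n => by positivity) (fun n => ?_)
        (tendsto_const_div_atTop_nhds_zero_nat (B : ℝ))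
      gcongr
      exact hB n
    exact hL.ne' (tendsto_nhds_unique h h0)
  have hmono : StrictMono (Nat.nth s) := Nat.nth_strictMono hinf
  have h1 : Tendsto (fun j : ℕ => (j : ℝ) / (Nat.nth s j + 1 : ℕ)) atTop (𝓝 L) := by
    have h2 : Tendsto (fun n : ℕ => (Nat.count s n : ℝ) / n * (n / ((n : ℝ) + 1))) atTop
        (𝓝 (L * 1)) := h.mul (tendsto_natCast_div_add_atTop (1 : ℝ))
    rw [mul_one] at h2
    refine (h2.comp hmono.tendsto_atTop).congr' ?_
    filter_upwards [eventually_gt_atTop 0] with j hj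
    have hpos : (0 : ℝ) < Nat.nth s j := by
      have : j ≤ Nat.nth s j := hmono.le_apply
      exact_mod_cast lt_of_lt_of_le hj this
    simp only [Function.comp, Nat.count_nth_of_infinite hinf]
    push_cast
    field_simp
  refine ⟨hinf, h1, ?_⟩
  have h3 : Tendsto (fun j : ℕ => ((j + 1 : ℕ) : ℝ) / (Nat.nth s (j + 1) + 1 : ℕ)) atTop (𝓝 L) :=
    h1.comp (tendsto_add_atTop_nat 1)
  have h4 : Tendsto (fun j : ℕ => (j : ℝ) / ((j : ℝ) + 1)) atTop (𝓝 1) :=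
    tendsto_natCast_div_add_atTop (1 : ℝ)
  -- With `n j = nth s j + 1`, the quotient `n j / n (j+1)` is `(j+1) / n (j+1)` times `j / (j+1)`
  -- times `n j / j`.
  have h5 := (h3.mul h4).mul (h1.inv₀ hL.ne')
  rw [mul_one, mul_inv_cancel₀ hL.ne'] at h5
  refine h5.congr' ?_
  filter_upwards [eventually_gt_atTop 0] with j hj
  have hj' : (0 : ℝ) < j := by exact_mod_cast hj
  push_cast
  field_simp

end Frequency

/-! ### Size of pullbacks with bounded distortion, and the cylinders at visits to the good set. -/

section Pullback

variable {ι : Type*} {a b : ℝ} {p q : ι → ℝ} {f : ℝ → ℝ} {u v : ℝ}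

lemma IsUnstableManifold.log_deriv_sub_le (hf : IsBasicCuspMap a b p q f) {y : ℕ → ℝ} {r : ℝ}
    {V : Set (ℕ → ℝ)} (hV : IsUnstableManifold (dom p q) f y r V) {y' : ℕ → ℝ} (hy' : y' ∈ V)
    (n : ℕ) : |Real.log |deriv f^[n] (y' n)| - Real.log (|deriv f^[n] (y n)|)|
      ≤ ∑' i, distortionTerm f y y' i := by
  rw [hf.log_deriv_iterate_orbit (hV.subset hy'), hf.log_deriv_iterate_orbit (hV.subset hV.mem),
    ← Finset.sum_sub_distrib]
  exact (Finset.abs_sum_le_sum_abs _ _).trans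
    ((hV.summable y' hy').sum_le_tsum (Finset.range n) fun _ _ => abs_nonneg _)

/-- The inverse of a diffeomorphism `f^n : W → V` is differentiable. -/
lemma IsBasicCuspMap.exists_inverse (hf : IsBasicCuspMap a b p q f) {n : ℕ} {W V : Set ℝ}
    (h : IterDiffeo (dom p q) f n W V) : ∃ g : ℝ → ℝ, MapsTo g V W ∧
      (∀ z ∈ V, f^[n] (g z) = z) ∧ (∀ w ∈ W, g (f^[n] w) = w) ∧
      ∀ z ∈ V, HasDerivAt g (deriv f^[n] (g z))⁻¹ z := by
  have hinv := h.bijOn.invOn_invFunOn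
  have hmaps : MapsTo (Function.invFunOn f^[n] W) V W := h.bijOn.surjOn.mapsTo_invFunOn
  set g := Function.invFunOn f^[n] W with hg
  -- The inverse function theorem gives continuity of `g` at `z` and shows that `V` is a
  -- neighbourhood of `z`.
  have hVo : ∀ z ∈ V, ∀ N ∈ 𝓝 (g z), g ⁻¹' N ∈ 𝓝 z ∧ V ∈ 𝓝 z := by
    intro z hz N hN
    have h1 := (hf.hasStrictDerivAt_iterate' (h.subset (hmaps hz))).map_nhds_eq
      (hf.deriv_iterate_ne (h.subset (hmaps hz)))
    rw [hinv.2 hz] at h1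
    have h2 : f^[n] '' (N ∩ W) ∈ 𝓝 z := by
      rw [← h1]
      exact image_mem_map (inter_mem hN (h.isOpen.mem_nhds (hmaps hz)))
    constructor
    · filter_upwards [h2] with w hw
      obtain ⟨x, hx, rfl⟩ := hw
      rw [mem_preimage, hinv.1 hx.2]
      exact hx.1
    · filter_upwards [h2] with w hw
      obtain ⟨x, hx, rfl⟩ := hw
      exact h.bijOn.mapsTo hx.2
  refine ⟨g, hmaps, fun z hz => hinv.2 hz, fun w hw => hinv.1 hw, fun z hz => ?_⟩
  refine HasDerivAt.of_local_left_inverse (fun N hN => (hVo z hz N hN).1)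
    (hf.hasDerivAt_iterate (h.subset (hmaps hz))) (hf.deriv_iterate_ne (h.subset (hmaps hz))) ?_
  filter_upwards [(hVo z hz univ univ_mem).2] with w hw using hinv.2 hw

/-- Size estimates for diffeomorphic pullbacks with bounded distortion. -/
lemma IsBasicCuspMap.pullback_estimates (hf : IsBasicCuspMap a b p q f) {n : ℕ} {W V : Set ℝ}
    (h : IterDiffeo (dom p q) f n W V) (hV : Convex ℝ V) {m : ℝ} (hm : 0 < m)
    (hmW : ∀ w ∈ W, 3 / 4 * m ≤ |deriv f^[n] w| ∧ |deriv f^[n] w| ≤ 4 / 3 * m) :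
    (∀ w ∈ W, ∀ w' ∈ W, |w - w'| ≤ 4 / 3 * m⁻¹ * |f^[n] w - f^[n] w'|) ∧
    ∀ w ∈ W, ∀ d, Metric.ball (f^[n] w) d ⊆ V → Metric.ball w (3 / 4 * m⁻¹ * d) ⊆ W := by
  obtain ⟨g, hgm, hg1, hg2, hgd⟩ := hf.exists_inverse h
  have hgb : ∀ z ∈ V, 3 / 4 * m⁻¹ ≤ |deriv g z| ∧ |deriv g z| ≤ 4 / 3 * m⁻¹ := by
    intro z hz
    rw [(hgd z hz).deriv, abs_inv]
    obtain ⟨h1, h2⟩ := hmW _ (hgm hz)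
    have hpos : 0 < |deriv f^[n] (g z)| := lt_of_lt_of_le (by positivity) h1
    constructor
    · rw [le_inv_comm₀ (by positivity) hpos,
        show (3 / 4 * m⁻¹)⁻¹ = 4 / 3 * m by rw [mul_inv, inv_inv]; norm_num]
      exact h2
    · rw [inv_le_comm₀ hpos (by positivity),
        show (4 / 3 * m⁻¹)⁻¹ = 3 / 4 * m by rw [mul_inv, inv_inv]; norm_num]
      exact h1
  constructor
  · intro w hw w' hw'
    have := hV.norm_image_sub_le_of_norm_deriv_le (f := g) (C := 4 / 3 * m⁻¹)
      (fun z hz => (hgd z hz).differentiableAt) (fun z hz => (hgb z hz).2)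
      (h.bijOn.mapsTo hw') (h.bijOn.mapsTo hw)
    rwa [hg2 w hw, hg2 w' hw'] at this
  · intro w hw d hd
    have h1 := ball_subset_image_ball (f := g) (x := f^[n] w) (r := d) (m := 3 / 4 * m⁻¹)
      (by positivity) (fun z hz => (hgd z (hd hz)).differentiableAt)
      (fun z hz => (hgb z (hd hz)).1)
    rw [hg2 w hw] at h1
    refine h1.trans ?_
    rintro _ ⟨z, hz, rfl⟩
    exact hgm (hd hz)

/-- The constant `3/4` comes from `1 + t ≤ exp t` at `t = -1/4`, and `4/3` is its inverse. -/
lemma exp_quarter_bounds {s t : ℝ} (hs : 0 < s) (ht : 0 < t)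
    (h : |Real.log s - Real.log t| ≤ 1 / 4) : 3 / 4 * t ≤ s ∧ s ≤ 4 / 3 * t := by
  have h1 := Real.add_one_le_exp (-(1 / 4) : ℝ)
  have h2 : Real.exp (1 / 4) ≤ 4 / 3 := by
    have h3 : Real.exp (1 / 4) = (Real.exp (-(1 / 4)))⁻¹ := by rw [← Real.exp_neg, neg_neg]
    rw [h3, inv_le_comm₀ (Real.exp_pos _) (by norm_num)]
    linarith
  rw [abs_le] at h
  have e1 : s = Real.exp (Real.log s - Real.log t) * t := by
    rw [Real.exp_sub, Real.exp_log hs, Real.exp_log ht]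
    field_simp
  constructor
  · rw [e1]
    gcongr
    calc (3 / 4 : ℝ) ≤ Real.exp (-(1 / 4)) := by linarith
      _ ≤ _ := Real.exp_le_exp.2 h.1
  · rw [e1]
    gcongr
    exact (Real.exp_le_exp.2 h.2).trans h2

variable {𝒬 : Set (Set ℝ)} {e χ η : ℝ} {α ρ γ : (ℕ → ℝ) → ℝ} {V : (ℕ → ℝ) → Set (ℕ → ℝ)}
  {K ε : ℝ} {z : ℕ → ℝ}

/-- The elements of the iterated partition at the times of visits to the good set. -/
lemma IsBranchPartition.cylinder_of_mem_goodSet (hQ : IsBranchPartition p q f 𝒬)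
    (hf : IsBasicCuspMap a b p q f) (hret : IsRegularlyReturning (dom p q) f u v) (huv : u < v)
    (hU : ∃ Q ∈ 𝒬, Ioo u v ⊆ Q) (hz : z ∈ goodSet (dom p q) f e χ η α ρ γ V u v K ε)
    (hdist : ∀ y' ∈ V z, ∑' i, distortionTerm f z y' i ≤ 1 / 4) {n : ℕ} (hn : 0 < n) :
    let W := cylinder (dom p q) f (partP (Ioo u v) 𝒬) n (z n)
    IterDiffeo (dom p q) f n W (Ioo u v) ∧
    (∀ w ∈ W, ∀ w' ∈ W,
      |Real.log (|deriv f^[n] w|) - Real.log (|deriv f^[n] w'|)| ≤ Real.log 2) ∧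
    ε * Metric.diam W < Metric.infDist (z n) (frontier W) ∧
    ∀ w ∈ W, |w - z n| ≤ 4 / 3 * (K * Real.exp (-(n * (χ - η)))) * (v - u) := by
  intro W
  have hdiff := iterDiffeo_of_mem_goodSet hf hz n
  have hmem := mem_pullback hz hz.1.manifold.mem hz.2.1 n
  have hW : W = _ := hQ.cylinder_eq hf hret hU hdiff hmem
  rw [← hW] at hdiff hmem
  set m := |deriv f^[n] (z n)| with hm
  have hm0 : 0 < m := abs_pos.2 (hf.deriv_iterate_ne (hdiff.subset hmem))
  have hlog : ∀ w ∈ W, |Real.log (|deriv f^[n] w|) - Real.log m| ≤ 1 / 4 := by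
    intro w hw
    rw [hW] at hw
    obtain ⟨y', hy', rfl⟩ := mem_proj_image_iff.1 hw.1
    exact (hz.1.manifold.log_deriv_sub_le hf hy' n).trans (hdist y' hy')
  have hest := hf.pullback_estimates hdiff (convex_Ioo u v) hm0 fun w hw =>
    exp_quarter_bounds (abs_pos.2 (hf.deriv_iterate_ne (hdiff.subset hw))) hm0 (hlog w hw)
  have hfz : f^[n] (z n) ∈ Ioo u v := hdiff.bijOn.mapsTo hmem
  have hz0 : f^[n] (z n) = proj z := iterate_apply_of_mem (hz.1.manifold.subset hz.1.manifold.mem) n 0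
  have hlen : ∀ w ∈ W, ∀ w' ∈ W, |w - w'| ≤ 4 / 3 * m⁻¹ * (v - u) := by
    intro w hw w' hw'
    refine (hest.1 w hw w' hw').trans ?_
    have h1 := hdiff.bijOn.mapsTo hw
    have h2 := hdiff.bijOn.mapsTo hw'
    have : |f^[n] w - f^[n] w'| ≤ v - u := by
      rw [abs_le]; constructor <;> linarith [h1.1, h1.2, h2.1, h2.2]
    gcongr
  refine ⟨hdiff, fun w hw w' hw' => ?_, ?_, fun w hw => ?_⟩
  · have h1 := hlog w hw
    have h2 := hlog w' hw'
    rw [abs_sub_comm] at h2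
    have h3 := abs_sub_le (Real.log (|deriv f^[n] w|)) (Real.log m) (Real.log (|deriv f^[n] w'|))
    have := Real.log_two_gt_d9
    linarith
  · have hd := hz.2.2.2.2.2
    set d := Metric.infDist (proj z) (frontier (Ioo u v)) with hddef
    have hfr : frontier (Ioo u v) = {u, v} := frontier_Ioo huv
    have hdu : d ≤ proj z - u := by
      have := Metric.infDist_le_dist_of_mem (x := proj z) (show u ∈ frontier (Ioo u v) by simp [hfr])
      rwa [Real.dist_eq, abs_of_pos (by linarith [hz.2.1.1])] at this
    have hdv : d ≤ v - proj z := by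
      have := Metric.infDist_le_dist_of_mem (x := proj z) (show v ∈ frontier (Ioo u v) by simp [hfr])
      rwa [Real.dist_eq, abs_sub_comm, abs_of_pos (by linarith [hz.2.1.2])] at this
    have hball : Metric.ball (z n) (3 / 4 * m⁻¹ * d) ⊆ W := by
      refine hest.2 _ hmem d ?_
      rw [hz0, Real.ball_eq_Ioo]
      exact Ioo_subset_Ioo (by linarith) (by linarith)
    have hdiam : Metric.diam W ≤ 4 / 3 * m⁻¹ * (v - u) := by
      refine Metric.diam_le_of_forall_dist_le (by have := sub_pos.2 huv; positivity) fun w hw w' hw' => ?_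
      rw [Real.dist_eq]
      exact hlen w hw w' hw'
    have hWne : W ≠ univ := by
      intro h
      have h1 := hlen (z n + (4 / 3 * m⁻¹ * (v - u) + 1)) (h ▸ mem_univ _) (z n) hmem
      rw [add_sub_cancel_left] at h1
      linarith [le_abs_self (4 / 3 * m⁻¹ * (v - u) + 1)]
    have hfrW : (frontier W).Nonempty := nonempty_frontier_iff.2 ⟨⟨_, hmem⟩, hWne⟩
    have hinf : 3 / 4 * m⁻¹ * d ≤ Metric.infDist (z n) (frontier W) := by
      rw [Metric.le_infDist hfrW]
      intro w hw
      rw [hdiff.isOpen.frontier_eq] at hw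
      by_contra hlt
      push Not at hlt
      exact hw.2 (hball (by rwa [Metric.mem_ball, dist_comm]))
    have hminv : 0 < m⁻¹ := inv_pos.2 hm0
    rcases le_or_gt ε 0 with hε | hε
    · have hd0 : 0 < d := by
        have hcl : IsClosed (frontier (Ioo u v)) := isClosed_frontier
        refine (hcl.notMem_iff_infDist_pos ⟨u, by simp [hfr]⟩).1 ?_
        rw [hfr]
        rintro (h | h)
        · exact hz.2.1.1.ne' h
        · exact hz.2.1.2.ne h
      have h1 : ε * Metric.diam W ≤ 0 := mul_nonpos_of_nonpos_of_nonneg hε Metric.diam_nonneg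
      have h2 : 0 < 3 / 4 * m⁻¹ * d := by positivity
      linarith
    -- The distance of `z n` to the boundary exceeds `3/4 * 2 * ε * m⁻¹ * |U|`, while the diameter
    -- is at most `4/3 * m⁻¹ * |U|`; the claim follows from `3/2 > 4/3`. The factors coming from
    -- distortion `log 2` would not leave this room.
    · have h1 : ε * Metric.diam W ≤ ε * (4 / 3 * m⁻¹ * (v - u)) := by gcongr
      have h2 : 4 / 3 * m⁻¹ * (2 * ε * (v - u)) ≤ 4 / 3 * m⁻¹ * d := by gcongr
      have h3 : 0 < m⁻¹ * (ε * (v - u)) := by have := sub_pos.2 huv; positivity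
      have h4 : m⁻¹ * (2 * ε * (v - u)) ≤ m⁻¹ * d := by gcongr
      nlinarith
  · refine (hlen w hw _ hmem).trans ?_
    have hρ := hz.1.rho_pos
    have h1 := hz.1.rate_lower n hn
    have h2 : m⁻¹ ≤ K * Real.exp (-(n * (χ - η))) := by
      rw [inv_le_comm₀ hm0 (mul_pos (hρ.trans hz.2.2.2.1) (Real.exp_pos _)), mul_inv, Real.exp_neg,
        inv_inv]
      refine le_trans ?_ h1.le
      have := hz.2.2.2.1.le
      gcongr
    have := sub_pos.2 huv
    gcongr

end Pullback

/-! ### Periodic points from returns. -/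

section Periodic

variable {ι : Type*} {a b : ℝ} {p q : ι → ℝ} {f : ℝ → ℝ}

/-- A return of a backward orbit along its unstable manifold yields a periodic point. -/
lemma IsBasicCuspMap.exists_periodic_of_return (hf : IsBasicCuspMap a b p q f) {e χ η : ℝ}
    {α ρ γ : (ℕ → ℝ) → ℝ} {V : (ℕ → ℝ) → Set (ℕ → ℝ)} {y : ℕ → ℝ}
    (hy : UnstableAt (dom p q) f e χ η α ρ γ V y)
    (hdist : ∀ y' ∈ V y, ∑' i, distortionTerm f y y' i ≤ 1 / 4) {n : ℕ} (hn : 0 < n)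
    {x δ K : ℝ} (h0 : |y 0 - x| < δ) (hnx : |y n - x| < δ) (hα : 3 * δ ≤ α y) (hK : ρ y < K)
    (hsmall : 4 / 3 * (K * Real.exp (-(n * (χ - η)))) ≤ δ) :
    ∃ z ∈ Ioo (x - 2 * δ) (x + 2 * δ), z ∈ iterDom (dom p q) f n ∧ f^[n] z = z := by
  have hdiff := hy.manifold.diffeo n hn
  set W := proj '' (back^[n] '' V y) with hW
  rw [hy.manifold.proj_eq] at hdiff
  have hmem : y n ∈ W := mem_proj_image_iff.2 ⟨y, hy.manifold.mem, rfl⟩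
  set m := |deriv f^[n] (y n)| with hm
  have hm0 : 0 < m := abs_pos.2 (hf.deriv_iterate_ne (hdiff.subset hmem))
  have hest := hf.pullback_estimates hdiff (convex_ball _ _) hm0 fun w hw => by
    refine exp_quarter_bounds (abs_pos.2 (hf.deriv_iterate_ne (hdiff.subset hw))) hm0 ?_
    obtain ⟨y', hy', rfl⟩ := mem_proj_image_iff.1 hw
    exact (hy.manifold.log_deriv_sub_le hf hy' n).trans (hdist y' hy')
  have hfy : f^[n] (y n) = proj y := iterate_apply_of_mem (hy.manifold.subset hy.manifold.mem) n 0
  have hδ : 0 < δ := (abs_nonneg _).trans_lt h0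
  have hminv : m⁻¹ ≤ K * Real.exp (-(n * (χ - η))) := by
    have hρ := hy.rho_pos
    rw [inv_le_comm₀ hm0 (mul_pos (hρ.trans hK) (Real.exp_pos _)), mul_inv, Real.exp_neg, inv_inv]
    refine le_trans ?_ (hy.rate_lower n hn).le
    gcongr
  -- `W` lies within `2δ` of `x`, whereas its image covers `[x - 2δ, x + 2δ]` because `3δ ≤ α y`.
  -- Hence `f^[n] w - w` changes sign on the connected set `W`.
  have hWx : ∀ w ∈ W, |w - x| < 2 * δ := by
    intro w hw
    have h1 := hest.1 w hw _ hmem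
    have h2 := hdiff.bijOn.mapsTo hw
    rw [Metric.mem_ball, Real.dist_eq, ← hfy] at h2
    have h3 : |w - y n| ≤ δ := by
      refine h1.trans (le_trans ?_ hsmall)
      have h4 : |f^[n] w - f^[n] (y n)| ≤ 1 := by linarith [hy.size_lt]
      calc 4 / 3 * m⁻¹ * |f^[n] w - f^[n] (y n)| ≤ 4 / 3 * m⁻¹ * 1 := by gcongr
        _ ≤ _ := by rw [mul_one]; gcongr
    have := abs_sub_le w (y n) x
    linarith
  have hends : ∀ t, |t - x| ≤ 2 * δ → ∃ w ∈ W, f^[n] w = t := by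
    intro t ht
    refine hdiff.bijOn.surjOn ?_
    rw [Metric.mem_ball, Real.dist_eq]
    have h1 := abs_sub_le t x (proj y)
    have h2 : |x - proj y| < δ := by rw [abs_sub_comm]; exact h0
    linarith
  obtain ⟨w₁, hw₁, e₁⟩ := hends (x - 2 * δ) (by
    rw [sub_sub_cancel_left, abs_neg, abs_of_pos (by linarith)])
  obtain ⟨w₂, hw₂, e₂⟩ := hends (x + 2 * δ) (by
    rw [add_sub_cancel_left, abs_of_pos (by linarith)])
  have hWc := hf.isPreconnected_of_iterDiffeo hdiff (convex_ball _ _).isPreconnected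
  have hcont : ContinuousOn (fun w => f^[n] w - w) W := fun w hw =>
    ((hf.continuousAt_iterate (hdiff.subset hw)).sub continuousAt_id).continuousWithinAt
  have hoc := (hWc.image _ hcont).ordConnected
  have h1 := abs_lt.1 (hWx w₁ hw₁)
  have h2 := abs_lt.1 (hWx w₂ hw₂)
  obtain ⟨z, hz, hz0⟩ : (0 : ℝ) ∈ (fun w => f^[n] w - w) '' W := by
    refine hoc.out (mem_image_of_mem _ hw₁) (mem_image_of_mem _ hw₂) ⟨?_, ?_⟩
    · simp only [e₁]; linarith
    · simp only [e₂]; linarith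
  have h3 := abs_lt.1 (hWx z hz)
  exact ⟨z, ⟨by linarith, by linarith⟩, hdiff.subset hz, sub_eq_zero.1 hz0⟩

/-- An interval that is charged by a non-atomic measure splits into two charged intervals. -/
lemma exists_split_of_noAtoms {m : Measure ℝ} (hna : ∀ x, m {x} = 0) {s t : ℝ}
    (h : m (Ioo s t) ≠ 0) : ∃ c, m (Ioo s c) ≠ 0 ∧ m (Ioo c t) ≠ 0 := by
  obtain ⟨x₁, hx₁, h₁⟩ := exists_mem_forall_mem_nhdsWithin_pos_measure h
  have h' : m (Ioo s t \ {x₁}) ≠ 0 := by rwa [measure_sdiff_null (hna x₁)]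
  obtain ⟨x₂, hx₂, h₂⟩ := exists_mem_forall_mem_nhdsWithin_pos_measure h'
  have key : ∀ z z' : ℝ, z ∈ Ioo s t → z' ∈ Ioo s t → z < z' →
      (∀ N ∈ 𝓝 z, 0 < m N) → (∀ N ∈ 𝓝 z', 0 < m N) →
      ∃ c, m (Ioo s c) ≠ 0 ∧ m (Ioo c t) ≠ 0 := fun z z' hz hz' hlt hN hN' =>
    ⟨(z + z') / 2, (hN _ (Ioo_mem_nhds hz.1 (by linarith))).ne',
      (hN' _ (Ioo_mem_nhds (by linarith) hz'.2)).ne'⟩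
  have h₁' : ∀ N ∈ 𝓝 x₁, 0 < m N := fun N hN => h₁ N (mem_nhdsWithin_of_mem_nhds hN)
  have h₂' : ∀ N ∈ 𝓝 x₂, 0 < m N := fun N hN => h₂ N (mem_nhdsWithin_of_mem_nhds hN)
  rcases lt_or_gt_of_ne (show x₂ ≠ x₁ from hx₂.2) with hlt | hlt
  · exact key x₂ x₁ hx₂.1 hx₁ hlt h₂' h₁'
  · exact key x₁ x₂ hx₁ hx₂.1 hlt h₁' h₂'

lemma finite_orbit_of_periodic {f : ℝ → ℝ} {n : ℕ} (hn : 0 < n) {z : ℝ} (hz : f^[n] z = z) :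
    (range fun i => f^[i] z).Finite := by
  refine ((finite_Iio n).image fun i => f^[i] z).subset ?_
  rintro _ ⟨i, rfl⟩
  exact ⟨i % n, Nat.mod_lt _ hn, (Function.IsPeriodicPt.iterate_mod_apply hz i)⟩

end Periodic

/-! ### Regularly returning intervals and the good partition. -/

section GoodPartition

variable {ι : Type*} {a b : ℝ} {p q : ι → ℝ} {f : ℝ → ℝ} {e χ η : ℝ} {𝒬 : Set (Set ℝ)}
  {α ρ γ : (ℕ → ℝ) → ℝ} {V : (ℕ → ℝ) → Set (ℕ → ℝ)}
  {μ : Measure ℝ} {ν : Measure (ℕ → ℝ)} [IsProbabilityMeasure ν]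

/-- Around the points charged by a non-atomic set of backward orbits with large unstable manifolds
there are arbitrarily short regularly returning intervals charged by this set. -/
lemma exists_regularlyReturning (hf : IsBasicCuspMap a b p q f)
    (hν : IsNaturalExtension (dom p q) f μ ν) (hdom : ∀ᵐ x ∂μ, x ∈ dom p q)
    (hna : ∀ x, μ {x} = 0) (hηχ : η < χ)
    (hfam : ∀ᵐ y ∂ν, UnstableAt (dom p q) f e χ η α ρ γ V y)
    (hdist : ∀ᵐ y ∂ν, ∀ y' ∈ V y, ∑' i, distortionTerm f y y' i ≤ 1 / 4)
    {S : Set (ℕ → ℝ)} (hSm : MeasurableSet S) (hS0 : ν S ≠ 0) {r K : ℝ} (hr : 0 < r)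
    (hSα : ∀ y ∈ S, r ≤ α y) (hSρ : ∀ y ∈ S, ρ y < K) :
    ∃ u v : ℝ, u < v ∧ v - u ≤ r ∧ (∃ j, Ioo u v ⊆ Ioo (p j) (q j)) ∧
      IsRegularlyReturning (dom p q) f u v ∧ ν (S ∩ proj ⁻¹' Ioo u v) ≠ 0 := by
  set m : Measure ℝ := (ν.restrict S).map proj with hm
  have hmap : ∀ T, MeasurableSet T → m T = ν (S ∩ proj ⁻¹' T) := by
    intro T hT
    rw [hm, Measure.map_apply measurable_proj hT, Measure.restrict_apply (measurable_proj hT),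
      inter_comm]
  have hmna : ∀ x, m {x} = 0 := by
    intro x
    rw [hmap _ (measurableSet_singleton x)]
    refine measure_mono_null inter_subset_right ?_
    rw [hν.measurePreserving_proj.measure_preimage (measurableSet_singleton x).nullMeasurableSet,
      hna]
  have hmdom : m (dom p q) ≠ 0 := by
    rw [hmap _ isOpen_dom.measurableSet, measure_inter_conull]
    · exact hS0
    · have h1 := hν.measurePreserving_proj.quasiMeasurePreserving.ae hdom
      exact measure_mono_null (fun y hy => hy) (ae_iff.1 h1)
  -- periodic points in charged intervals
  have hper : ∀ s t, m (Ioo s t) ≠ 0 → ∃ z ∈ Ioo s t, ∃ n, 0 < n ∧ f^[n] z = z := by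
    intro s t hst
    obtain ⟨x, hx, hxpos⟩ := exists_mem_forall_mem_nhdsWithin_pos_measure hst
    obtain ⟨δ, hδ0, hδ⟩ : ∃ δ > 0, 3 * δ ≤ r ∧ s < x - 2 * δ ∧ x + 2 * δ < t := by
      refine ⟨min (r / 3) (min ((x - s) / 3) ((t - x) / 3)),
        lt_min (by linarith) (lt_min (by linarith [hx.1]) (by linarith [hx.2])), ?_, ?_, ?_⟩
      · linarith [min_le_left (r / 3) (min ((x - s) / 3) ((t - x) / 3))]
      · have := (min_le_right (r / 3) (min ((x - s) / 3) ((t - x) / 3))).trans (min_le_left _ _)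
        linarith [hx.1]
      · have := (min_le_right (r / 3) (min ((x - s) / 3) ((t - x) / 3))).trans (min_le_right _ _)
        linarith [hx.2]
    set E := S ∩ proj ⁻¹' Ioo (x - δ) (x + δ) with hE
    have hEm : MeasurableSet E := hSm.inter (measurable_proj measurableSet_Ioo)
    have hE0 : ν E ≠ 0 := by
      rw [hE, ← hmap _ measurableSet_Ioo]
      exact (hxpos _ (mem_nhdsWithin_of_mem_nhds (Ioo_mem_nhds (by linarith) (by linarith)))).ne'
    -- Poincaré recurrence for `F⁻¹`: an orbit in `E` comes back to `E` at arbitrarily late times,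
    -- when the pullback of its unstable manifold is within `δ` of the orbit.
    have hrec := hν.measurePreserving_back.conservative.ae_mem_imp_frequently_image_mem
      hEm.nullMeasurableSet
    obtain ⟨y, hyE, ⟨hyrec, hyU⟩, hyd⟩ := Measure.exists_mem_of_measure_ne_zero_of_ae hE0
      (ae_restrict_of_ae ((hrec.and hfam).and hdist))
    have hlim : Tendsto (fun n : ℕ => 4 / 3 * (K * Real.exp (-(n * (χ - η))))) atTop (𝓝 0) := by
      have h1 : Tendsto (fun n : ℕ => (n : ℝ) * (χ - η)) atTop atTop :=
        tendsto_natCast_atTop_atTop.atTop_mul_const (by linarith)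
      simpa using ((Real.tendsto_exp_neg_atTop_nhds_zero.comp h1).const_mul K).const_mul (4 / 3)
    obtain ⟨n, hnE, hn0, hnδ⟩ := ((hyrec hyE).and_eventually
      ((eventually_gt_atTop 0).and (hlim.eventually_lt_const hδ0))).exists
    have hn1 := hnE.2
    rw [mem_preimage, proj_back_iterate_eq] at hn1
    obtain ⟨z, hz, -, hzf⟩ := hf.exists_periodic_of_return hyU hyd hn0
      (show |y 0 - x| < δ by
        have := hyE.2; rw [abs_lt]; constructor <;> linarith [this.1, this.2, show proj y = y 0 from rfl])
      (show |y n - x| < δ by rw [abs_lt]; constructor <;> linarith [hn1.1, hn1.2])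
      (hδ.1.trans (hSα y hyE.1)) (hSρ y hyE.1) hnδ.le
    exact ⟨z, ⟨by linarith [hz.1], by linarith [hz.2]⟩, n, hn0, hzf⟩
  obtain ⟨x₀, hx₀, hx₀pos⟩ := exists_mem_forall_mem_nhdsWithin_pos_measure hmdom
  obtain ⟨j, hj⟩ := mem_dom_iff.1 hx₀
  obtain ⟨δ, hδ0, hδr, hδp, hδq⟩ : ∃ δ > 0, 2 * δ ≤ r ∧ p j ≤ x₀ - δ ∧ x₀ + δ ≤ q j := by
    refine ⟨min (r / 2) (min (x₀ - p j) (q j - x₀)),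
      lt_min (by linarith) (lt_min (by linarith [hj.1]) (by linarith [hj.2])), ?_, ?_, ?_⟩
    · linarith [min_le_left (r / 2) (min (x₀ - p j) (q j - x₀))]
    · have := (min_le_right (r / 2) (min (x₀ - p j) (q j - x₀))).trans (min_le_left _ _)
      linarith
    · have := (min_le_right (r / 2) (min (x₀ - p j) (q j - x₀))).trans (min_le_right _ _)
      linarith
  have hB : m (Ioo (x₀ - δ) (x₀ + δ)) ≠ 0 :=
    (hx₀pos _ (mem_nhdsWithin_of_mem_nhds (Ioo_mem_nhds (by linarith) (by linarith)))).ne'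
  -- Three adjacent charged intervals: periodic points are taken in the outer two, and a charged
  -- point `x₂` off their orbits in the middle one. The gap of the two orbits around `x₂` is
  -- regularly returning, because the images of its end points stay on these orbits.
  obtain ⟨c, hc1, hc2⟩ := exists_split_of_noAtoms hmna hB
  obtain ⟨c', hc3, hc4⟩ := exists_split_of_noAtoms hmna hc2
  obtain ⟨z₁, hz₁, n₁, hn₁, hp₁⟩ := hper _ _ hc1
  obtain ⟨z₃, hz₃, n₃, hn₃, hp₃⟩ := hper _ _ hc4
  set O : Set ℝ := (range fun i => f^[i] z₁) ∪ (range fun i => f^[i] z₃) with hO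
  have hOfin : O.Finite := (finite_orbit_of_periodic hn₁ hp₁).union (finite_orbit_of_periodic hn₃ hp₃)
  have hOfwd : ∀ w ∈ O, ∀ k, f^[k] w ∈ O := by
    rintro w (⟨i, rfl⟩ | ⟨i, rfl⟩) k
    · exact Or.inl ⟨k + i, Function.iterate_add_apply f k i z₁⟩
    · exact Or.inr ⟨k + i, Function.iterate_add_apply f k i z₃⟩
  have hO0 : m O = 0 := by
    rw [← biUnion_of_singleton O]
    exact (measure_biUnion_null_iff hOfin.countable).2 fun x _ => hmna x
  have hmid : m (Ioo c c' \ O) ≠ 0 := by rwa [measure_sdiff_null hO0]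
  obtain ⟨x₂, hx₂, hx₂pos⟩ := exists_mem_forall_mem_nhdsWithin_pos_measure hmid
  have hz₁x : z₁ < x₂ := hz₁.2.trans hx₂.1.1
  have hz₃x : x₂ < z₃ := hx₂.1.2.trans hz₃.1
  obtain ⟨u, ⟨huO, hux⟩, humax⟩ := exists_max_image (O ∩ Iio x₂) id (hOfin.inter_of_left _)
    ⟨z₁, Or.inl ⟨0, rfl⟩, hz₁x⟩
  obtain ⟨v, ⟨hvO, hvx⟩, hvmin⟩ := exists_min_image (O ∩ Ioi x₂) id (hOfin.inter_of_left _)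
    ⟨z₃, Or.inr ⟨0, rfl⟩, hz₃x⟩
  have hux' : u < x₂ := hux
  have hvx' : x₂ < v := hvx
  have hu1 : z₁ ≤ u := humax z₁ ⟨Or.inl ⟨0, rfl⟩, hz₁x⟩
  have hv3 : v ≤ z₃ := hvmin z₃ ⟨Or.inr ⟨0, rfl⟩, hz₃x⟩
  have hUO : ∀ w ∈ O, w ∉ Ioo u v := by
    intro w hw hwU
    rcases lt_trichotomy w x₂ with h | h | h
    · exact absurd (humax w ⟨hw, h⟩) (not_le.2 hwU.1)
    · exact hx₂.2 (h ▸ hw)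
    · exact absurd (hvmin w ⟨hw, h⟩) (not_le.2 hwU.2)
  refine ⟨u, v, hux'.trans hvx', by linarith [hz₁.1, hz₃.2], ⟨j, Ioo_subset_Ioo
    (by linarith [hz₁.1]) (by linarith [hz₃.2])⟩, ?_, ?_⟩
  · intro n _ z hz _
    rw [frontier_Ioo (hux'.trans hvx')] at hz
    rcases hz with rfl | rfl
    · exact hUO _ (hOfwd _ huO n)
    · exact hUO _ (hOfwd _ hvO n)
  · rw [← hmap _ measurableSet_Ioo]
    exact (hx₂pos _ (mem_nhdsWithin_of_mem_nhds (Ioo_mem_nhds hux' hvx'))).ne'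

/-- The good set up to a null set, in terms of measurable conditions. -/
def goodSetCore (α ρ γ : (ℕ → ℝ) → ℝ) (u v K ε : ℝ) : Set (ℕ → ℝ) :=
  {y | proj y ∈ Ioo u v ∧ v - u ≤ α y ∧ ρ y < K ∧ γ y < K ∧
    2 * ε * (v - u) < Metric.infDist (proj y) (frontier (Ioo u v))}

omit [IsProbabilityMeasure ν] in
lemma measurableSet_goodSetCore (hfam : IsUnstableFamily (dom p q) f e χ η ν α ρ γ V)
    (u v K ε : ℝ) : MeasurableSet (goodSetCore α ρ γ u v K ε) :=
  (measurable_proj measurableSet_Ioo).inter <|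
    (measurableSet_le measurable_const hfam.measurable_size).inter <|
    (measurableSet_lt hfam.measurable_rho measurable_const).inter <|
    (measurableSet_lt hfam.measurable_gamma measurable_const).inter
    (measurableSet_lt measurable_const
      ((Metric.continuous_infDist_pt _).measurable.comp measurable_proj))

lemma mem_goodSet_iff {D : Set ℝ} {u v K ε : ℝ} {y : ℕ → ℝ} :
    y ∈ goodSet D f e χ η α ρ γ V u v K ε ↔
      UnstableAt D f e χ η α ρ γ V y ∧ y ∈ goodSetCore α ρ γ u v K ε := Iff.rfl

omit [IsProbabilityMeasure ν] in
lemma goodSet_ae_eq (hfam : IsUnstableFamily (dom p q) f e χ η ν α ρ γ V) (u v K ε : ℝ) :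
    goodSet (dom p q) f e χ η α ρ γ V u v K ε =ᵐ[ν] goodSetCore α ρ γ u v K ε := by
  filter_upwards [hfam.ae] with y hy
  exact propext (mem_goodSet_iff.trans (and_iff_right hy))

/-- Almost every backward orbit visits the good set in the future with a positive frequency. -/
lemma ae_visits_goodSet (hν : IsNaturalExtension (dom p q) f μ ν) (herg : Ergodic f μ)
    (hfam : IsUnstableFamily (dom p q) f e χ η ν α ρ γ V) {u v K ε : ℝ}
    (hpos : ν (goodSet (dom p q) f e χ η α ρ γ V u v K ε) ≠ 0) :
    ∀ᵐ y ∂ν, ∃ k : ℕ → ℕ, StrictMono k ∧ (∀ j, 0 < k j) ∧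
      (∀ j, (forth f)^[k j] y ∈ goodSet (dom p q) f e χ η α ρ γ V u v K ε) ∧
      (∃ L : ℝ, 0 < L ∧ Tendsto (fun j : ℕ => (j : ℝ) / k j) atTop (𝓝 L)) ∧
      Tendsto (fun j : ℕ => (k j : ℝ) / k (j + 1)) atTop (𝓝 1) := by
  classical
  set G := goodSetCore α ρ γ u v K ε with hG
  have hGm : MeasurableSet G := measurableSet_goodSetCore hfam u v K ε
  have hGpos : 0 < ν.real G := by
    rw [measure_congr (goodSet_ae_eq hfam u v K ε)] at hpos
    exact ENNReal.toReal_pos hpos (measure_ne_top _ _)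
  have hB := ae_tendsto_birkhoffSum_div (hν.ergodic_forth herg)
    ((measurable_const (a := (1 : ℝ))).indicator hGm) ((integrable_const (1 : ℝ)).indicator hGm)
  have hq := hν.invariant.quasiMeasurePreserving
  have hall : ∀ᵐ y ∂ν, ∀ n, UnstableAt (dom p q) f e χ η α ρ γ V ((forth f)^[n] y) :=
    ae_all_iff.2 fun n => (hq.iterate n).ae hfam.ae
  -- Birkhoff's theorem is used at `forth f y` so that all visiting times are positive.
  filter_upwards [hq.ae hB, hall] with y hy hyU
  rw [integral_indicator_const _ hGm, smul_eq_mul, mul_one] at hy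
  have hcount : ∀ n : ℕ, birkhoffSum (forth f) (G.indicator fun _ => (1 : ℝ)) n (forth f y)
      = (Nat.count (fun n => (forth f)^[n + 1] y ∈ G) n : ℝ) := by
    intro n
    rw [Nat.count_eq_card_filter_range, birkhoffSum, ← Finset.sum_boole]
    refine Finset.sum_congr rfl fun i _ => ?_
    rw [← Function.iterate_succ_apply]
    rfl
  simp only [hcount] at hy
  obtain ⟨hinf, h1, h2⟩ := tendsto_nth_of_density hGpos hy
  refine ⟨fun j => Nat.nth (fun n => (forth f)^[n + 1] y ∈ G) j + 1,
    fun i j hij => Nat.succ_lt_succ (Nat.nth_strictMono hinf hij), fun j => Nat.succ_pos _,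
    fun j => ⟨hyU _, Nat.nth_mem_of_infinite hinf j⟩, ⟨_, hGpos, h1⟩, h2⟩

/-- `K` and `ε` are found by exhaustion, since `α` and the distance to the boundary of `U` are
positive. The times `n j` of `x = Π y` are the visits of `F^n y` to the good set, where the cylinder
of `x` is a pullback of `U` along an unstable manifold; `ae_exists` transfers this from `ν` to `μ`.
-/
theorem exists_isGoodPartition (hf : IsBasicCuspMap a b p q f) (hQ : IsBranchPartition p q f 𝒬)
    (hν : IsNaturalExtension (dom p q) f μ ν) (herg : Ergodic f μ)
    (hdom : ∀ᵐ x ∂μ, x ∈ dom p q) (hna : ∀ x, μ {x} = 0) (hηχ : η < χ)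
    (hfam : IsUnstableFamily (dom p q) f e χ η ν α ρ γ V)
    (hdist : ∀ᵐ y ∂ν, ∀ y' ∈ V y, ∑' i, distortionTerm f y y' i ≤ 1 / 4) :
    ∃ u v K ε : ℝ, IsGoodPartition a b (dom p q) f μ ν 𝒬 e χ η α ρ γ V u v K ε := by
  obtain ⟨N, hN⟩ : ∃ N : ℕ, ν {y | 1 / ((N : ℝ) + 1) ≤ α y ∧ ρ y < N + 1 ∧ γ y < N + 1} ≠ 0 := by
    by_contra hcon
    push Not at hcon
    obtain ⟨y, hy1, hy2⟩ := ((ae_all_iff.2 fun N =>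
      measure_eq_zero_iff_ae_notMem.1 (hcon N)).and hfam.ae).exists
    obtain ⟨N₁, hN₁⟩ := exists_nat_one_div_lt hy2.size_pos
    obtain ⟨N₂, hN₂⟩ := exists_nat_gt (max (ρ y) (γ y))
    refine hy1 (max N₁ N₂) ⟨?_, ?_, ?_⟩
    · refine le_trans ?_ hN₁.le
      gcongr
      exact le_max_left _ _
    · have := (le_max_left _ _).trans_lt hN₂
      have h2 : (N₂ : ℝ) ≤ (max N₁ N₂ : ℕ) := by exact_mod_cast le_max_right _ _
      linarith
    · have := (le_max_right _ _).trans_lt hN₂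
      have h2 : (N₂ : ℝ) ≤ (max N₁ N₂ : ℕ) := by exact_mod_cast le_max_right _ _
      linarith
  set K : ℝ := N + 1 with hK
  have hK0 : 0 < K := by positivity
  set S := {y | 1 / K ≤ α y ∧ ρ y < K ∧ γ y < K} with hS
  have hSm : MeasurableSet S := (measurableSet_le measurable_const hfam.measurable_size).inter
    ((measurableSet_lt hfam.measurable_rho measurable_const).inter
    (measurableSet_lt hfam.measurable_gamma measurable_const))
  obtain ⟨u, v, huv, hlen, ⟨j, hj⟩, hret, hpos⟩ := exists_regularlyReturning hf hν hdom hna hηχ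
    hfam.ae hdist hSm hN (r := 1 / K) (K := K) (by positivity) (fun y hy => hy.1) fun y hy => hy.2.1
  have hfr : frontier (Ioo u v) = {u, v} := frontier_Ioo huv
  obtain ⟨k, hk⟩ : ∃ k : ℕ, ν (goodSetCore α ρ γ u v K (1 / ((k : ℝ) + 1))) ≠ 0 := by
    by_contra hcon
    push Not at hcon
    refine hpos (measure_mono_null ?_ (measure_iUnion_null hcon))
    rintro y ⟨hyS, hyU⟩
    have hyU' : proj y ∈ Ioo u v := hyU
    have hd : 0 < Metric.infDist (proj y) (frontier (Ioo u v)) := by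
      refine (isClosed_frontier.notMem_iff_infDist_pos ⟨u, by simp [hfr]⟩).1 ?_
      rw [hfr]
      rintro (h | h)
      · exact hyU'.1.ne' h
      · exact hyU'.2.ne h
    have huv' : 0 < 2 * (v - u) := by linarith
    obtain ⟨k, hk⟩ := exists_nat_one_div_lt (div_pos hd huv')
    rw [lt_div_iff₀ huv'] at hk
    exact mem_iUnion.2 ⟨k, hyU', hlen.trans hyS.1, hyS.2.1, hyS.2.2, by linarith⟩
  set ε : ℝ := 1 / ((k : ℝ) + 1) with hε
  have hgood : ν (goodSet (dom p q) f e χ η α ρ γ V u v K ε) ≠ 0 := by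
    rwa [measure_congr (goodSet_ae_eq hfam u v K ε)]
  have hU : ∃ Q ∈ 𝒬, Ioo u v ⊆ Q := by
    obtain ⟨Q, hQm, hjQ⟩ := hQ.branch j
    exact ⟨Q, hQm, hj.trans hjQ⟩
  have hvisit : ∀ᵐ y ∂ν, ∃ k : ℕ → ℕ, StrictMono k ∧ (∀ j, 0 < k j) ∧
      (∀ j, ∃ z ∈ goodSet (dom p q) f e χ η α ρ γ V u v K ε, z (k j) = proj y ∧
        ∀ y' ∈ V z, ∑' i, distortionTerm f z y' i ≤ 1 / 4) ∧
      (∃ L : ℝ, 0 < L ∧ Tendsto (fun j : ℕ => (j : ℝ) / k j) atTop (𝓝 L)) ∧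
      Tendsto (fun j : ℕ => (k j : ℝ) / k (j + 1)) atTop (𝓝 1) := by
    filter_upwards [ae_visits_goodSet hν herg hfam hgood, ae_all_iff.2 fun n =>
      (hν.invariant.quasiMeasurePreserving.iterate n).ae hdist] with y hy hyd
    obtain ⟨k, h1, h2, h3, h4⟩ := hy
    refine ⟨k, h1, h2, fun j => ⟨_, h3 j, ?_, hyd _⟩, h4⟩
    rw [← proj_back_iterate_eq ((forth f)^[k j] y) (k j), back_iterate_forth_iterate]
  have hvisit' := hν.ae_exists hvisit
  refine ⟨u, v, K, ε, huv, hj.trans (hf.subset j), hK0, by positivity, hret, hU,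
    pos_iff_ne_zero.2 hgood, ⟨_, hvisit', ?_⟩, ?_⟩
  -- Generation: a point with the itinerary of `Π y` lies in all cylinders of `Π y`, whose lengths
  -- tend to `0` along the visiting times. That its own iterates are defined comes from its own
  -- visits.
  · rintro _ ⟨y, rfl, k, hk1, hk2, hk3, -⟩ _ ⟨y', rfl, k', hk1', hk2', hk3', -⟩ hit
    have hx' : ∀ n, proj y' ∈ iterDom (dom p q) f n := by
      intro n
      obtain ⟨z, hz, hzy, -⟩ := hk3' n
      rw [← hzy]
      exact iterDom_antitone _ _ (hk1'.le_apply)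
        (mem_iterDom_of_mem (hz.1.manifold.subset hz.1.manifold.mem) (k' n))
    have hle : ∀ j, |proj y' - proj y|
        ≤ 4 / 3 * (K * Real.exp (-(k j * (χ - η)))) * (v - u) := by
      intro j
      obtain ⟨z, hz, hzy, hzd⟩ := hk3 j
      have h1 := (hQ.cylinder_of_mem_goodSet hf hret huv hU hz hzd (hk2 j)).2.2.2 (proj y')
        ⟨hx' _, fun i _ => by rw [hzy]; exact hit i⟩
      rwa [hzy] at h1
    have hlim : Tendsto (fun j : ℕ => 4 / 3 * (K * Real.exp (-(k j * (χ - η)))) * (v - u)) atTop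
        (𝓝 0) := by
      have h1 : Tendsto (fun j : ℕ => (k j : ℝ) * (χ - η)) atTop atTop :=
        (tendsto_natCast_atTop_atTop.comp hk1.tendsto_atTop).atTop_mul_const (by linarith)
      simpa using (((Real.tendsto_exp_neg_atTop_nhds_zero.comp h1).const_mul K).const_mul
        (4 / 3)).mul_const (v - u)
    have h0 := ge_of_tendsto' hlim hle
    exact (sub_eq_zero.1 (abs_eq_zero.1 (le_antisymm h0 (abs_nonneg _)))).symm
  · filter_upwards [hvisit'] with x hx
    obtain ⟨y, rfl, k, hk1, hk2, hk3, hk4⟩ := hx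
    have hc : ∀ j,
        IterDiffeo (dom p q) f (k j)
          (cylinder (dom p q) f (partP (Ioo u v) 𝒬) (k j) (proj y)) (Ioo u v) ∧
        (∀ w ∈ cylinder (dom p q) f (partP (Ioo u v) 𝒬) (k j) (proj y),
          ∀ w' ∈ cylinder (dom p q) f (partP (Ioo u v) 𝒬) (k j) (proj y),
          |Real.log (|deriv f^[k j] w|) - Real.log (|deriv f^[k j] w'|)| ≤ Real.log 2) ∧
        ε * Metric.diam (cylinder (dom p q) f (partP (Ioo u v) 𝒬) (k j) (proj y)) <
          Metric.infDist (proj y)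
            (frontier (cylinder (dom p q) f (partP (Ioo u v) 𝒬) (k j) (proj y))) := fun j => by
      obtain ⟨z, hz, hzy, hzd⟩ := hk3 j
      have h1 := hQ.cylinder_of_mem_goodSet hf hret huv hU hz hzd (hk2 j)
      rw [hzy] at h1
      exact ⟨h1.1, h1.2.1, h1.2.2.1⟩
    exact ⟨k, hk1, fun j => (hc j).1, fun j => (hc j).2.1, fun j => (hc j).2.2, hk4⟩

end GoodPartition

/-! ### Monotonicity and generation of the Pesin partition. -/

section Increasing

lemma forth_iterate_apply_of_le {f : ℝ → ℝ} {z : ℕ → ℝ} {k i : ℕ} (hi : k ≤ i) :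
    (forth f)^[k] z i = z (i - k) := by
  have h := back_iterate_apply ((forth f)^[k] z) k (i - k)
  rw [back_iterate_forth_iterate, Nat.sub_add_cancel hi] at h
  exact h.symm

lemma forth_iterate_apply_of_ge {f : ℝ → ℝ} {z : ℕ → ℝ} {k i : ℕ} (hi : i ≤ k) :
    (forth f)^[k] z i = f^[k - i] (z 0) := by
  have h := proj_back_iterate_eq ((forth f)^[k] z) i
  rw [← h]
  obtain ⟨m, rfl⟩ := Nat.exists_eq_add_of_le hi
  rw [Function.iterate_add_apply, back_iterate_forth_iterate, proj_forth_iterate,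
    Nat.add_sub_cancel_left]
  rfl

lemma forth_iterate_mem {D : Set ℝ} {f : ℝ → ℝ} {z : ℕ → ℝ} (hz : z ∈ backwardOrbits D f) {k : ℕ}
    (hk : z 0 ∈ iterDom D f k) : (forth f)^[k] z ∈ backwardOrbits D f := by
  intro i
  rcases lt_or_ge i k with hi | hi
  · rw [forth_iterate_apply_of_ge hi.le, forth_iterate_apply_of_ge (Nat.succ_le_of_lt hi),
      ← Function.iterate_succ_apply' f]
    exact ⟨hk _ (by omega), by congr 2; omega⟩
  · rw [forth_iterate_apply_of_le hi, forth_iterate_apply_of_le (by omega),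
      Nat.sub_add_comm hi]
    exact hz _

lemma pull_pesin_le (f : ℝ → ℝ) (P : Setoid ℝ) : pull f 1 (pesin P) ≤ pesin P :=
  fun {y y'} h => pesin_back (y := forth f y) (y' := forth f y') h 1

lemma forth_iterate_apply_of_mem {D : Set ℝ} {f : ℝ → ℝ} {y : ℕ → ℝ} (hy : y ∈ backwardOrbits D f)
    (m i : ℕ) : (forth f)^[m] y i = f^[m] (y i) := by
  induction m generalizing i with
  | zero => rfl
  | succ m ih =>
    rw [Function.iterate_succ_apply', Function.iterate_succ_apply']
    cases i with
    | zero => exact congrArg f (ih 0)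
    | succ i =>
      rw [← Function.iterate_succ_apply' f, Function.iterate_succ_apply, (hy i).2]
      exact ih i

lemma partP_iterate_of_forall_pull {D : Set ℝ} {f : ℝ → ℝ} {P : Setoid ℝ} {y y' : ℕ → ℝ}
    (hy : y ∈ backwardOrbits D f) (hy' : y' ∈ backwardOrbits D f)
    (h : ∀ n, pull f n (pesin P) y y') (m i : ℕ) : P (f^[m] (y i)) (f^[m] (y' i)) := by
  rw [← forth_iterate_apply_of_mem hy, ← forth_iterate_apply_of_mem hy']
  exact (pesin_iff _ _ _).1 (h m) i

/-- On backward orbits `F` applies `f` to every coordinate. Agreement under all `F⁻ⁿ ξ` thus means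
that `y i` and `y' i` have the same forward itinerary for each `i`, and `P` separates them
coordinate by coordinate. -/
lemma exists_generating {D : Set ℝ} {f : ℝ → ℝ} {P : Setoid ℝ} {μ : Measure ℝ}
    {ν : Measure (ℕ → ℝ)} (hν : IsNaturalExtension D f μ ν) (hP : IsGenerating f μ P) :
    ∃ N : Set (ℕ → ℝ), (∀ᵐ y ∂ν, y ∈ N) ∧
      ∀ y ∈ N, ∀ y' ∈ N, (∀ n : ℕ, pull f n (pesin P) y y') → y = y' := by
  obtain ⟨X, hX, hsep⟩ := hP
  refine ⟨{y | y ∈ backwardOrbits D f ∧ ∀ i, y i ∈ X}, ?_, fun y hy y' hy' h => funext fun i =>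
    hsep _ (hy.2 i) _ (hy'.2 i) fun m => partP_iterate_of_forall_pull hy.1 hy'.1 h m i⟩
  filter_upwards [hν.supported, ae_all_iff.2 fun i =>
    (hν.measurePreserving_eval i).quasiMeasurePreserving.ae hX] with y h1 h2 using ⟨h1, h2⟩

end Increasing

/-! ### The densities `Δ` and their integrals. -/

section Densities

variable {ι : Type*} {a b : ℝ} {p q : ι → ℝ} {f : ℝ → ℝ} {𝒬 : Set (Set ℝ)} {e χ η u v K ε : ℝ}
  {α ρ γ : (ℕ → ℝ) → ℝ} {V : (ℕ → ℝ) → Set (ℕ → ℝ)}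
  {μ : Measure ℝ} {ν : Measure (ℕ → ℝ)} {y y' : ℕ → ℝ} {k : ℕ}

/-- Almost every backward orbit visits the good set in the past. -/
lemma ae_exists_back_mem_goodSet [IsProbabilityMeasure ν] (hν : IsNaturalExtension (dom p q) f μ ν)
    (herg : Ergodic f μ) (hfam : IsUnstableFamily (dom p q) f e χ η ν α ρ γ V)
    (hpos : ν (goodSet (dom p q) f e χ η α ρ γ V u v K ε) ≠ 0) :
    ∀ᵐ y ∂ν, ∃ k, back^[k] y ∈ goodSet (dom p q) f e χ η α ρ γ V u v K ε := by
  set G := goodSetCore α ρ γ u v K ε with hG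
  have hGm : MeasurableSet G := measurableSet_goodSetCore hfam u v K ε
  have hB := hν.ergodic_back herg
  have hSm : MeasurableSet (⋃ k, back^[k] ⁻¹' G) :=
    .iUnion fun k => (measurable_back.iterate k) hGm
  -- The set of orbits whose past visits `G` contains its preimage under `back`, so ergodicity makes
  -- it null or full; it contains `G`, which has positive measure.
  have hsub : back ⁻¹' (⋃ k, back^[k] ⁻¹' G) ⊆ ⋃ k, back^[k] ⁻¹' G := by
    intro y hy
    obtain ⟨k, hk⟩ := mem_iUnion.1 hy
    exact mem_iUnion.2 ⟨k + 1, hk⟩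
  have h1 : ∀ᵐ y ∂ν, y ∈ ⋃ k, back^[k] ⁻¹' G := by
    rcases hB.ae_empty_or_univ_of_preimage_ae_le hSm.nullMeasurableSet hsub.eventuallyLE with h | h
    · refine absurd ?_ hpos
      rw [measure_congr (goodSet_ae_eq hfam u v K ε)]
      exact measure_mono_null (subset_iUnion (fun k => back^[k] ⁻¹' G) 0) (ae_eq_empty.1 h)
    · exact (ae_eq_univ.1 h : _)
  filter_upwards [h1, ae_all_iff.2 fun k =>
    (hB.toMeasurePreserving.quasiMeasurePreserving.iterate k).ae hfam.ae] with y hy hyU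
  obtain ⟨k, hk⟩ := mem_iUnion.1 hy
  exact ⟨k, hyU k, hk⟩

/-- The logarithms of the factors of `deltaSeq`. -/
noncomputable def logRatio (f : ℝ → ℝ) (y y' : ℕ → ℝ) (i : ℕ) : ℝ :=
  Real.log (|deriv f (y (i + 1))|) - Real.log (|deriv f (y' (i + 1))|)

lemma abs_logRatio (f : ℝ → ℝ) (y y' : ℕ → ℝ) (i : ℕ) :
    |logRatio f y y' i| = distortionTerm f y y' i := abs_sub_comm _ _

lemma IsBranchPartition.deltaSeq_eq (hQ : IsBranchPartition p q f 𝒬) (hf : IsBasicCuspMap a b p q f)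
    {U : Set ℝ} (hy : y ∈ backwardOrbits (dom p q) f)
    (hy' : y' ∈ atom (dom p q) f (pesin (partP U 𝒬)) y) (n : ℕ) :
    deltaSeq f y y' n = Real.exp (∑ i ∈ Finset.range n, logRatio f y y' i) := by
  rw [deltaSeq, proj_back_iterate_eq, proj_back_iterate_eq, hf.deriv_iterate_orbit hy,
    hf.deriv_iterate_orbit hy'.1, ← Finset.prod_div_distrib, Real.exp_sum]
  refine Finset.prod_congr rfl fun i _ => ?_
  have hne := hf.deriv_ne (hy i).1
  have hne' := hf.deriv_ne (hy'.1 i).1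
  obtain ⟨Q, hQm, hyQ⟩ := hQ.exists_mem (hy i).1
  have hsign := hQ.deriv_mul_pos hf hQm hyQ ((((pesin_iff _ _ _).1 hy'.2 (i + 1)).2 Q hQm).1 hyQ)
    (hy i).1 (hy'.1 i).1
  rw [logRatio, Real.exp_sub, Real.exp_log (abs_pos.2 hne), Real.exp_log (abs_pos.2 hne'),
    ← abs_div, abs_of_pos]
  rw [show deriv f (y (i + 1)) / deriv f (y' (i + 1))
    = deriv f (y (i + 1)) * deriv f (y' (i + 1)) / deriv f (y' (i + 1)) ^ 2 by field_simp]
  exact div_pos hsign (by positivity)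

lemma IsBranchPartition.tendsto_deltaSeq (hQ : IsBranchPartition p q f 𝒬)
    (hf : IsBasicCuspMap a b p q f) {U : Set ℝ} (hy : y ∈ backwardOrbits (dom p q) f)
    (hy' : y' ∈ atom (dom p q) f (pesin (partP U 𝒬)) y) (hs : Summable (logRatio f y y')) :
    Tendsto (deltaSeq f y y') atTop (𝓝 (Real.exp (∑' i, logRatio f y y' i))) := by
  refine Tendsto.congr (fun n => (hQ.deltaSeq_eq hf hy hy' n).symm) ?_
  exact (Real.continuous_exp.tendsto _).comp hs.hasSum.tendsto_sum_nat

lemma back_mem_atom {D : Set ℝ} {P : Setoid ℝ} (hy' : y' ∈ atom D f (pesin P) y) (k : ℕ) :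
    back^[k] y' ∈ atom D f (pesin P) (back^[k] y) :=
  ⟨back_iterate_mem hy'.1 k, pesin_back hy'.2 k⟩

lemma summable_logRatio_of_back (hs : Summable (distortionTerm f (back^[k] y) (back^[k] y'))) :
    Summable (logRatio f y y') := by
  rw [← summable_nat_add_iff k]
  refine Summable.of_abs (hs.congr fun i => ?_)
  rw [abs_logRatio, distortionTerm, distortionTerm]
  simp only [back_iterate_apply, add_right_comm]

/-- The density along the Pesin partition, at an orbit whose past visits the good set. -/
lemma IsBranchPartition.delta_spec (hQ : IsBranchPartition p q f 𝒬)
    (hf : IsBasicCuspMap a b p q f) (hret : IsRegularlyReturning (dom p q) f u v)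
    (hU : ∃ Q ∈ 𝒬, Ioo u v ⊆ Q) (hy : y ∈ backwardOrbits (dom p q) f)
    (hk : back^[k] y ∈ goodSet (dom p q) f e χ η α ρ γ V u v K ε)
    (hy' : y' ∈ atom (dom p q) f (pesin (partP (Ioo u v) 𝒬)) y) :
    Tendsto (deltaSeq f y y') atTop (𝓝 (delta f y y')) ∧ 0 < delta f y y' ∧
      |deriv f^[k] (y k)| / 2 * (1 / |deriv f^[k] (y' k)|) ≤ delta f y y' ∧
      delta f y y' ≤ 2 * |deriv f^[k] (y k)| * (1 / |deriv f^[k] (y' k)|) := by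
  have hmem := back_mem_atom hy' k
  rw [hQ.atom_eq_of_mem_goodSet hf hret hU hk] at hmem
  have hsd := hk.1.manifold.summable _ hmem.1
  have hs : Summable (logRatio f y y') := summable_logRatio_of_back hsd
  have ht := hQ.tendsto_deltaSeq hf hy hy' hs
  have hδ : delta f y y' = Real.exp (∑' i, logRatio f y y' i) := ht.limUnder_eq
  -- From step `k` on both orbits run along one unstable manifold, so the tail of the product lies
  -- in `[1/2, 2]`; the first `k` factors make up the quotient of the derivatives of `f^[k]`.
  have htail : |∑' i, logRatio f y y' (i + k)| ≤ Real.log 2 := by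
    have hterm : ∀ i, |logRatio f y y' (i + k)|
        = distortionTerm f (back^[k] y) (back^[k] y') i := by
      intro i
      rw [abs_logRatio, distortionTerm, distortionTerm]
      simp only [back_iterate_apply, add_right_comm]
    have hsn : Summable fun i => ‖logRatio f y y' (i + k)‖ := by
      simpa only [Real.norm_eq_abs, hterm] using hsd
    calc |∑' i, logRatio f y y' (i + k)| ≤ ∑' i, |logRatio f y y' (i + k)| :=
          norm_tsum_le_tsum_norm hsn
      _ = ∑' i, distortionTerm f (back^[k] y) (back^[k] y') i := by simp only [hterm]
      _ ≤ Real.log 2 := (hk.1.manifold.distortion _ hmem.1).le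
  have hfac : delta f y y' = |deriv f^[k] (y k)| * (1 / |deriv f^[k] (y' k)|) *
      Real.exp (∑' i, logRatio f y y' (i + k)) := by
    rw [hδ, ← hs.sum_add_tsum_nat_add k, Real.exp_add, ← hQ.deltaSeq_eq hf hy hy' k]
    congr 1
    rw [← abs_of_pos (hQ.deltaSeq_eq hf hy hy' k ▸ Real.exp_pos _ : 0 < deltaSeq f y y' k),
      deltaSeq, proj_back_iterate_eq, proj_back_iterate_eq, abs_div, mul_one_div]
  have hc : 0 ≤ |deriv f^[k] (y k)| * (1 / |deriv f^[k] (y' k)|) := by positivity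
  have hlo : 1 / 2 ≤ Real.exp (∑' i, logRatio f y y' (i + k)) := by
    rw [← Real.exp_log (show (0 : ℝ) < 1 / 2 by norm_num), Real.exp_le_exp, one_div, Real.log_inv]
    exact (abs_le.1 htail).1
  have hhi : Real.exp (∑' i, logRatio f y y' (i + k)) ≤ 2 := by
    rw [← Real.le_log_iff_exp_le two_pos]
    exact (abs_le.1 htail).2
  refine ⟨hδ ▸ ht, hδ ▸ Real.exp_pos _, ?_, ?_⟩
  · rw [hfac]
    nlinarith [mul_le_mul_of_nonneg_left hlo hc]
  · rw [hfac]
    nlinarith [mul_le_mul_of_nonneg_left hhi hc]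

lemma measurableSet_mem_iff {S : Set ℝ} (hS : MeasurableSet S) (x : ℝ) :
    MeasurableSet {x' | x ∈ S ↔ x' ∈ S} := by
  by_cases hx : x ∈ S
  · rwa [show {x' | x ∈ S ↔ x' ∈ S} = S by ext; simp [hx]]
  · rw [show {x' | x ∈ S ↔ x' ∈ S} = Sᶜ by ext; simp [hx]]
    exact hS.compl

lemma IsBranchPartition.measurableSet_partP (hQ : IsBranchPartition p q f 𝒬) (u v x : ℝ) :
    MeasurableSet {x' | partP (Ioo u v) 𝒬 x x'} := by
  have : {x' | partP (Ioo u v) 𝒬 x x'} =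
      {x' | x ∈ Ioo u v ↔ x' ∈ Ioo u v} ∩ ⋂ Q ∈ 𝒬, {x' | x ∈ Q ↔ x' ∈ Q} := by
    ext x'
    simp only [mem_inter_iff, mem_iInter]
    rfl
  rw [this]
  exact (measurableSet_mem_iff measurableSet_Ioo x).inter <| .biInter hQ.finite.countable
    fun Q hQm => measurableSet_mem_iff (hQ.interval Q hQm).measurableSet x

lemma IsBranchPartition.measurableSet_atom (hQ : IsBranchPartition p q f 𝒬) (hfm : Measurable f)
    (u v : ℝ) (y : ℕ → ℝ) :
    MeasurableSet (atom (dom p q) f (pesin (partP (Ioo u v) 𝒬)) y) := by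
  have : atom (dom p q) f (pesin (partP (Ioo u v) 𝒬)) y =
      backwardOrbits (dom p q) f ∩ ⋂ i, {y' | partP (Ioo u v) 𝒬 (y i) (y' i)} := by
    ext y'
    simp only [mem_inter_iff, mem_iInter]
    exact and_congr_right fun _ => pesin_iff _ _ _
  rw [this]
  exact (measurableSet_backwardOrbits isOpen_dom.measurableSet hfm).inter <|
    .iInter fun i =>
      (measurable_pi_apply i : Measurable fun y : ℕ → ℝ => y i) (hQ.measurableSet_partP u v (y i))

lemma IsBranchPartition.measurableSet_cylinder (hQ : IsBranchPartition p q f 𝒬)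
    (hfm : Measurable f) (u v : ℝ) (n : ℕ) (x : ℝ) :
    MeasurableSet (cylinder (dom p q) f (partP (Ioo u v) 𝒬) n x) := by
  have : cylinder (dom p q) f (partP (Ioo u v) 𝒬) n x =
      (⋂ i < n, f^[i] ⁻¹' dom p q) ∩ ⋂ i ≤ n, f^[i] ⁻¹' {x' | partP (Ioo u v) 𝒬 (f^[i] x) x'} := by
    ext x'
    simp only [mem_inter_iff, mem_iInter]
    rfl
  rw [this]
  exact (MeasurableSet.biInter (to_countable _) fun i _ =>
    (hfm.iterate i) isOpen_dom.measurableSet).inter <| .biInter (to_countable _) fun i _ =>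
      (hfm.iterate i) (hQ.measurableSet_partP u v _)

/-- The projection of an element of the Pesin partition, when it starts in the good set after `k`
backward steps. -/
lemma IsBranchPartition.proj_atom_eq (hQ : IsBranchPartition p q f 𝒬)
    (hf : IsBasicCuspMap a b p q f) (hret : IsRegularlyReturning (dom p q) f u v)
    (hU : ∃ Q ∈ 𝒬, Ioo u v ⊆ Q) (hy : y ∈ backwardOrbits (dom p q) f)
    (hk : back^[k] y ∈ goodSet (dom p q) f e χ η α ρ γ V u v K ε) :
    proj '' atom (dom p q) f (pesin (partP (Ioo u v) 𝒬)) y =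
      f^[k] '' cylinder (dom p q) f (partP (Ioo u v) 𝒬) k (y k) := by
  have hyk := iterate_apply_of_mem hy
  have horb : ∀ z ∈ backwardOrbits (dom p q) f, ∀ i ≤ k, f^[i] (z k) = z (k - i) := by
    intro z hz i hi
    have := iterate_apply_of_mem hz i (k - i)
    rwa [Nat.add_sub_cancel' hi] at this
  ext x
  constructor
  · rintro ⟨y', hy', rfl⟩
    refine ⟨y' k, ⟨mem_iterDom_of_mem hy'.1 k, fun i hi => ?_⟩, ?_⟩
    · rw [horb y hy i hi, horb y' hy'.1 i hi]
      exact (pesin_iff _ _ _).1 hy'.2 _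
    · simpa [proj] using horb y' hy'.1 k le_rfl
  · rintro ⟨w, ⟨hwD, hw⟩, rfl⟩
    -- `y k` is in `U`, hence so is `w`. The atom of `back^[k] y` projects onto `U` and provides a
    -- lift `z` of `w`, and `F^k z` is the required orbit over `f^[k] w`.
    have hwU : w ∈ Ioo u v := ((hw 0 k.zero_le).1).1 (by
      have := hk.2.1
      rwa [proj_back_iterate_eq] at this)
    rw [← hQ.proj_atom_of_mem_goodSet hf hret hU hk] at hwU
    obtain ⟨z, hz, rfl⟩ := hwU
    refine ⟨(forth f)^[k] z, ⟨forth_iterate_mem hz.1 hwD, (pesin_iff _ _ _).2 fun i => ?_⟩,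
      proj_forth_iterate f z k⟩
    rcases le_total i k with hi | hi
    · rw [forth_iterate_apply_of_ge hi]
      have := hw (k - i) (Nat.sub_le _ _)
      rwa [horb y hy _ (Nat.sub_le _ _), Nat.sub_sub_self hi] at this
    · rw [forth_iterate_apply_of_le hi]
      have := (pesin_iff _ _ _).1 hz.2 (i - k)
      rwa [back_iterate_apply, Nat.sub_add_cancel hi] at this

lemma IsBranchPartition.measurableEmbedding_proj_atom (hQ : IsBranchPartition p q f 𝒬)
    (hf : IsBasicCuspMap a b p q f) (hfm : Measurable f) (u v : ℝ) (y : ℕ → ℝ) :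
    MeasurableEmbedding
      fun y' : atom (dom p q) f (pesin (partP (Ioo u v) 𝒬)) y => proj y' := by
  have := (hQ.measurableSet_atom hfm u v y).standardBorel
  refine (measurable_proj.comp measurable_subtype_coe).measurableEmbedding ?_
  intro z z' h
  have hinj := hQ.injOn_proj_atom hf (U := Ioo u v) y 0
  simp only [Function.iterate_zero, image_id] at hinj
  exact Subtype.ext (hinj z.2 z'.2 h)

/-- Change of variables along `f^[k]`, which maps the cylinder injectively onto `Π ξ(y)`: the
Jacobian cancels the density. Together with `delta_spec` this bounds the integral of `Δ` from both
sides. -/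
lemma IsBranchPartition.lintegral_inv_deriv (hQ : IsBranchPartition p q f 𝒬)
    (hf : IsBasicCuspMap a b p q f) (hfm : Measurable f)
    (hret : IsRegularlyReturning (dom p q) f u v)
    (hU : ∃ Q ∈ 𝒬, Ioo u v ⊆ Q) (hy : y ∈ backwardOrbits (dom p q) f)
    (hk : back^[k] y ∈ goodSet (dom p q) f e χ η α ρ γ V u v K ε) :
    ∫⁻ y' : atom (dom p q) f (pesin (partP (Ioo u v) 𝒬)) y,
      ENNReal.ofReal (1 / |deriv f^[k] (y'.1 k)|)
        ∂(leafLebesgue (atom (dom p q) f (pesin (partP (Ioo u v) 𝒬)) y)) =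
      volume (cylinder (dom p q) f (partP (Ioo u v) 𝒬) k (y k)) := by
  set S := atom (dom p q) f (pesin (partP (Ioo u v) 𝒬)) y with hS
  set W := cylinder (dom p q) f (partP (Ioo u v) 𝒬) k (y k) with hW
  have hemb := hQ.measurableEmbedding_proj_atom hf hfm u v y
  have hinj : InjOn f^[k] W := fun w hw w' hw' h => hQ.eq_of_itinerary hf hw.1 hw'.1
    (fun i hi => (partP _ _).trans ((partP _ _).symm (hw.2 i hi.le)) (hw'.2 i hi.le)) h
  have hSW : ∀ y' ∈ S, y' k ∈ W ∧ f^[k] (y' k) = proj y' := by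
    intro y' hy'
    refine ⟨⟨mem_iterDom_of_mem hy'.1 k, fun i hi => ?_⟩, ?_⟩
    · have h1 := iterate_apply_of_mem hy i (k - i)
      have h2 := iterate_apply_of_mem hy'.1 i (k - i)
      rw [Nat.add_sub_cancel' hi] at h1 h2
      rw [h1, h2]
      exact (pesin_iff _ _ _).1 hy'.2 _
    · simpa [proj] using iterate_apply_of_mem hy'.1 k 0
  let H : ℝ → ℝ≥0∞ := fun x => ENNReal.ofReal (1 / |deriv f^[k] (Function.invFunOn f^[k] W x)|)
  calc ∫⁻ y' : S, ENNReal.ofReal (1 / |deriv f^[k] (y'.1 k)|) ∂(leafLebesgue S)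
      = ∫⁻ y' : S, H (proj y') ∂(leafLebesgue S) := by
        refine lintegral_congr fun y' => ?_
        obtain ⟨h1, h2⟩ := hSW y' y'.2
        simp only [H]
        rw [← h2, hinj.leftInvOn_invFunOn h1]
    _ = ∫⁻ x in range (fun y' : S => proj y'), H x := by
        rw [← hemb.lintegral_map, leafLebesgue, hemb.map_comap]
    _ = ∫⁻ x in f^[k] '' W, H x := by
        rw [hW, ← hQ.proj_atom_eq hf hret hU hy hk, image_eq_range]
    _ = ∫⁻ w in W, ENNReal.ofReal (|deriv f^[k] w|) * H (f^[k] w) :=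
        lintegral_image_eq_lintegral_abs_deriv_mul (hQ.measurableSet_cylinder hfm u v k _)
          (fun w hw => (hf.hasDerivAt_iterate hw.1).hasDerivWithinAt) hinj H
    _ = ∫⁻ w in W, 1 := by
        refine setLIntegral_congr_fun (hQ.measurableSet_cylinder hfm u v k _) fun w hw => ?_
        simp only [H]
        rw [hinj.leftInvOn_invFunOn hw, ← ENNReal.ofReal_mul (abs_nonneg _), mul_one_div_cancel,
          ENNReal.ofReal_one]
        exact abs_ne_zero.2 (hf.deriv_iterate_ne hw.1)
    _ = volume W := setLIntegral_one _

/-- The densities along the Pesin partition are well defined, with positive finite integrals. -/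
theorem IsBranchPartition.ae_densities [IsProbabilityMeasure ν]
    (hQ : IsBranchPartition p q f 𝒬) (hf : IsBasicCuspMap a b p q f)
    (hν : IsNaturalExtension (dom p q) f μ ν) (herg : Ergodic f μ)
    (hfam : IsUnstableFamily (dom p q) f e χ η ν α ρ γ V)
    (hgood : IsGoodPartition a b (dom p q) f μ ν 𝒬 e χ η α ρ γ V u v K ε) :
    ∀ᵐ y ∂ν,
      (∀ y' ∈ atom (dom p q) f (pesin (partP (Ioo u v) 𝒬)) y,
        Tendsto (deltaSeq f y y') atTop (𝓝 (delta f y y')) ∧ 0 < delta f y y') ∧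
      0 < ∫⁻ y', ENNReal.ofReal (delta f y y')
        ∂(leafLebesgue (atom (dom p q) f (pesin (partP (Ioo u v) 𝒬)) y)) ∧
      ∫⁻ y', ENNReal.ofReal (delta f y y')
        ∂(leafLebesgue (atom (dom p q) f (pesin (partP (Ioo u v) 𝒬)) y)) < ∞ := by
  have hfm := herg.measurable
  have hret := hgood.returning
  have hU := hgood.mem_partition
  filter_upwards [hν.supported, ae_exists_back_mem_goodSet hν herg hfam hgood.goodSet_pos.ne',
    ae_all_iff.2 fun k => (hν.measurePreserving_eval k).quasiMeasurePreserving.ae hgood.returns]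
    with y hy ⟨k, hk⟩ hyret
  have hspec := fun y' hy' => hQ.delta_spec hf hret hU hy hk (y' := y') hy'
  refine ⟨fun y' hy' => ⟨(hspec y' hy').1, (hspec y' hy').2.1⟩, ?_⟩
  have hJ := hQ.lintegral_inv_deriv hf hfm hret hU hy hk
  have hd : 0 < |deriv f^[k] (y k)| := abs_pos.2 (hf.deriv_iterate_ne (mem_iterDom_of_mem hy k))
  -- A strictly increasing sequence satisfies `k ≤ n k`, so the cylinder contains the one of length
  -- `n k`, which is open and non-empty as a diffeomorphic pullback of `U`.
  have hWpos : 0 < volume (cylinder (dom p q) f (partP (Ioo u v) 𝒬) k (y k)) := by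
    obtain ⟨n, hn, hdiff, -⟩ := hyret k
    have hne : (cylinder (dom p q) f (partP (Ioo u v) 𝒬) (n k) (y k)).Nonempty := by
      rw [← image_nonempty (f := f^[n k]), (hdiff k).bijOn.image_eq]
      exact nonempty_Ioo.2 hgood.lt
    refine ((hdiff k).isOpen.measure_pos volume hne).trans_le (measure_mono fun x hx => ?_)
    exact ⟨iterDom_antitone _ _ hn.le_apply hx.1, fun i hi => hx.2 i (hi.trans hn.le_apply)⟩
  have hWfin : volume (cylinder (dom p q) f (partP (Ioo u v) 𝒬) k (y k)) < ∞ := by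
    refine (measure_mono (t := Ioo u v) fun x hx => ?_).trans_lt measure_Ioo_lt_top
    have h1 := hk.2.1
    rw [proj_back_iterate_eq] at h1
    exact (hx.2 0 k.zero_le).1.1 h1
  constructor
  · calc (0 : ℝ≥0∞) < ENNReal.ofReal (|deriv f^[k] (y k)| / 2) *
          volume (cylinder (dom p q) f (partP (Ioo u v) 𝒬) k (y k)) :=
          ENNReal.mul_pos (ENNReal.ofReal_pos.2 (by positivity)).ne' hWpos.ne'
      _ ≤ _ := by
          rw [← hJ, ← lintegral_const_mul' _ _ ENNReal.ofReal_ne_top]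
          refine lintegral_mono fun y' => ?_
          rw [← ENNReal.ofReal_mul (by positivity)]
          exact ENNReal.ofReal_le_ofReal (hspec y' y'.2).2.2.1
  · calc _ ≤ ENNReal.ofReal (2 * |deriv f^[k] (y k)|) *
          volume (cylinder (dom p q) f (partP (Ioo u v) 𝒬) k (y k)) := by
          rw [← hJ, ← lintegral_const_mul' _ _ ENNReal.ofReal_ne_top]
          refine lintegral_mono fun y' => ?_
          rw [← ENNReal.ofReal_mul (by positivity)]
          exact ENNReal.ofReal_le_ofReal (hspec y' y'.2).2.2.2
      _ < ∞ := ENNReal.mul_lt_top ENNReal.ofReal_lt_top hWfin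

end Densities

/-! ### Finite monotonicity partitions that do not cut branches. -/

section BranchPartition

variable {ι : Type*} {a b : ℝ} {p q : ι → ℝ} {f : ℝ → ℝ} {𝒬 : Set (Set ℝ)}

lemma IsBasicCuspMap.monotoneOn_or_antitoneOn_branch (hf : IsBasicCuspMap a b p q f) (j : ι) :
    MonotoneOn f (Ioo (p j) (q j)) ∨ AntitoneOn f (Ioo (p j) (q j)) := by
  have hd : ∀ x ∈ Ioo (p j) (q j), DifferentiableAt ℝ f x := fun x hx =>
    (hf.hasStrictDerivAt (Ioo_subset_dom j hx)).hasDerivAt.differentiableAt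
  have hc : ContinuousOn f (Ioo (p j) (q j)) := fun x hx =>
    (hd x hx).continuousAt.continuousWithinAt
  have hd' : DifferentiableOn ℝ f (interior (Ioo (p j) (q j))) := by
    rw [isOpen_Ioo.interior_eq]
    exact fun x hx => (hd x hx).differentiableWithinAt
  rcases hasDerivWithinAt_forall_lt_or_forall_gt_of_forall_ne (convex_Ioo (p j) (q j))
    (fun x hx => (hd x hx).hasDerivAt.hasDerivWithinAt) (hf.deriv_ne_zero j) with h | h
  · right
    refine antitoneOn_of_deriv_nonpos (convex_Ioo _ _) hc hd' fun x hx => (h x ?_).le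
    rwa [isOpen_Ioo.interior_eq] at hx
  · left
    refine monotoneOn_of_deriv_nonneg (convex_Ioo _ _) hc hd' fun x hx => (h x ?_).le
    rwa [isOpen_Ioo.interior_eq] at hx

/-- A cut branch contains points `x < x'` with `x` in some `Q` and `x'` outside it, hence it
contains `sSup Q`. Branches are disjoint, so different cut branches use different elements of the
finite set `𝒬`. -/
lemma IsBasicCuspMap.finite_cut (hf : IsBasicCuspMap a b p q f)
    (h𝒬 : IsMonotonicityPartition (dom p q) f 𝒬) :
    {j | ¬∃ Q ∈ 𝒬, Ioo (p j) (q j) ⊆ Q}.Finite := by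
  have key : ∀ j, (¬∃ Q ∈ 𝒬, Ioo (p j) (q j) ⊆ Q) → ∃ Q ∈ 𝒬, sSup Q ∈ Ioo (p j) (q j) := by
    intro j hj
    push Not at hj
    obtain ⟨m, hm⟩ := nonempty_Ioo.2 (hf.lt j)
    have hcov : ∀ x ∈ Ioo (p j) (q j), ∃ Q ∈ 𝒬, x ∈ Q := fun x hx =>
      h𝒬.covers (Ioo_subset_dom j hx)
    obtain ⟨Q, hQ, x, hx, hxQ, x', hx', hxQ', hlt⟩ : ∃ Q ∈ 𝒬, ∃ x ∈ Ioo (p j) (q j), x ∈ Q ∧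
        ∃ x' ∈ Ioo (p j) (q j), x' ∉ Q ∧ x < x' := by
      obtain ⟨Q, hQ, hmQ⟩ := hcov m hm
      obtain ⟨w, hw, hwQ⟩ := not_subset.1 (hj Q hQ)
      rcases lt_trichotomy m w with h | rfl | h
      · exact ⟨Q, hQ, m, hm, hmQ, w, hw, hwQ, h⟩
      · exact absurd hmQ hwQ
      · obtain ⟨Q', hQ', hwQ'⟩ := hcov w hw
        refine ⟨Q', hQ', w, hw, hwQ', m, hm, fun hmQ' => hwQ ?_, h⟩
        rwa [h𝒬.disjoint.elim_set hQ hQ' m hmQ hmQ']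
    have hub : ∀ z ∈ Q, z ≤ x' := fun z hz => by
      by_contra hcon
      exact hxQ' ((h𝒬.interval Q hQ).out hxQ hz ⟨hlt.le, (not_le.1 hcon).le⟩)
    exact ⟨Q, hQ, hx.1.trans_le (le_csSup ⟨x', hub⟩ hxQ),
      (csSup_le ⟨x, hxQ⟩ hub).trans_lt hx'.2⟩
  choose! F hF hFs using key
  refine Set.Finite.of_injOn (t := 𝒬) (f := F) (fun j hj => hF j hj) ?_ h𝒬.finite
  intro j hj k hk hjk
  by_contra hne
  exact disjoint_left.1 (hf.disjoint hne) (hFs j hj) (hjk ▸ hFs k hk)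

/-- The points to the left of the intervals in `s` and to the right of the other intervals in
`t`. -/
def gap (p q : ι → ℝ) (t s : Set ι) : Set ℝ := {x | (∀ j ∈ s, x ≤ p j) ∧ ∀ j ∈ t \ s, q j ≤ x}

/-- A piecewise monotone cusp map has a finite partition into intervals of monotonicity that does
not cut its branches. -/
theorem exists_isBranchPartition (hf : IsBasicCuspMap a b p q f)
    (hpm : PiecewiseMonotone (dom p q) f) : ∃ 𝒬, IsBranchPartition p q f 𝒬 := by
  obtain ⟨𝒬, h𝒬⟩ := hpm
  set t : Set ι := {j | ¬∃ Q ∈ 𝒬, Ioo (p j) (q j) ⊆ Q} with ht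
  have htfin : t.Finite := hf.finite_cut h𝒬
  have hgap : ∀ {j s x}, j ∈ t → x ∈ gap p q t s → x ∉ Ioo (p j) (q j) := by
    intro j s x hj hx hxj
    by_cases hjs : j ∈ s
    · exact (hx.1 j hjs).not_gt hxj.1
    · exact (hx.2 j ⟨hj, hjs⟩).not_gt hxj.2
  -- Each cut branch becomes an element of its own. The rest of each `Q` is divided according to the
  -- set `s` of cut branches to its right, which keeps the pieces intervals.
  refine ⟨(fun j => Ioo (p j) (q j)) '' t ∪ image2 (fun Q s => Q ∩ gap p q t s) 𝒬 (𝒫 t),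
    ⟨(htfin.image _).union (h𝒬.finite.image2 _ htfin.powerset), ?_, ?_, ?_, ?_⟩, ?_⟩
  · rintro _ (⟨j, -, rfl⟩ | ⟨Q, hQ, s, -, rfl⟩)
    · exact ordConnected_Ioo
    · refine (h𝒬.interval Q hQ).inter ⟨fun x hx x' hx' z hz => ⟨fun j hj => ?_, fun j hj => ?_⟩⟩
      · exact hz.2.trans (hx'.1 j hj)
      · exact (hx.2 j hj).trans hz.1
  · intro A hA B hB hne
    refine disjoint_left.2 fun x hxA hxB => hne ?_
    simp only [id] at hxA hxB
    rcases hA with ⟨j, hj, rfl⟩ | ⟨Q, hQ, s, hs, rfl⟩ <;>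
      rcases hB with ⟨k, hk, rfl⟩ | ⟨Q', hQ', s', hs', rfl⟩
    · by_contra hjk
      exact disjoint_left.1 (hf.disjoint fun h => hjk (by rw [h])) hxA hxB
    · exact absurd hxA (hgap hj hxB.2)
    · exact absurd hxB (hgap hk hxA.2)
    · have hsub : ∀ {s s'}, s ⊆ t → x ∈ gap p q t s → x ∈ gap p q t s' → s ⊆ s' := by
        intro s s' hs hx hx' j hj
        by_contra hjs
        exact ((hx.1 j hj).trans_lt (hf.lt j)).not_ge (hx'.2 j ⟨hs hj, hjs⟩)
      rw [h𝒬.disjoint.elim_set hQ hQ' x hxA.1 hxB.1,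
        (hsub hs hxA.2 hxB.2).antisymm (hsub hs' hxB.2 hxA.2)]
  · intro x hx
    by_cases hxt : ∃ j ∈ t, x ∈ Ioo (p j) (q j)
    · obtain ⟨j, hj, hxj⟩ := hxt
      exact ⟨_, Or.inl ⟨j, hj, rfl⟩, hxj⟩
    · push Not at hxt
      obtain ⟨Q, hQ, hxQ⟩ := h𝒬.covers hx
      refine ⟨_, Or.inr ⟨Q, hQ, {j | j ∈ t ∧ x ≤ p j}, fun j hj => hj.1, rfl⟩, hxQ,
        fun j hj => hj.2, fun j hj => ?_⟩
      by_contra hcon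
      exact hxt j hj.1 ⟨not_le.1 fun h => hj.2 ⟨hj.1, h⟩, not_le.1 hcon⟩
  · rintro _ (⟨j, -, rfl⟩ | ⟨Q, hQ, s, -, rfl⟩)
    · exact (hf.monotoneOn_or_antitoneOn_branch j).imp (fun h => h.mono inter_subset_left)
        fun h => h.mono inter_subset_left
    · have hsub : Q ∩ gap p q t s ∩ dom p q ⊆ Q ∩ dom p q := fun x hx => ⟨hx.1.1, hx.2⟩
      exact (h𝒬.monotone Q hQ).imp (fun h => h.mono hsub) fun h => h.mono hsub
  · intro j
    by_cases hj : j ∈ t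
    · exact ⟨_, Or.inl ⟨j, hj, rfl⟩, Subset.rfl⟩
    · obtain ⟨Q, hQ, hjQ⟩ := not_not.1 hj
      refine ⟨_, Or.inr ⟨Q, hQ, {k | k ∈ t ∧ q j ≤ p k}, fun k hk => hk.1, rfl⟩,
        subset_inter hjQ fun x hx => ⟨fun k hk => hx.2.le.trans hk.2, fun k hk => ?_⟩⟩
      have hne : j ≠ k := fun h => hj (h ▸ hk.1)
      have h1 := Ioo_disjoint_Ioo.1 (hf.disjoint hne)
      have h2 : ¬q j ≤ p k := fun h => hk.2 ⟨hk.1, h⟩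
      have h3 := hf.lt j
      have h4 := hf.lt k
      rcases le_max_iff.1 h1 with h | h <;> rcases min_le_iff.1 h with h | h
      · exact absurd h3 h.not_gt
      · exact h.trans hx.1.le
      · exact absurd h h2
      · exact absurd h4 h.not_gt

end BranchPartition

/-! ### Entropy of random variables with finitely many values. -/

section FiniteEntropy

variable {Ω Ω' α β κ : Type*} [MeasurableSpace Ω] [MeasurableSpace Ω'] [Fintype α] [Fintype β]
  [Fintype κ] {μ : Measure Ω}

lemma partitionEntropy_comp_injective (μ : Measure Ω) (X : Ω → α) {g : α → β}
    (hg : Function.Injective g) :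
    partitionEntropy μ (fun ω => g (X ω)) = partitionEntropy μ X := by
  refine (Fintype.sum_of_injective g hg _ _ (fun b hb => ?_) fun a => ?_).symm
  · have : (fun ω => g (X ω)) ⁻¹' {b} = ∅ := by
      ext ω
      simp only [mem_preimage, mem_singleton_iff, mem_empty_iff_false, iff_false]
      exact fun h => hb ⟨_, h⟩
    rw [this]
    simp
  · congr 2
    ext ω
    exact hg.eq_iff.symm

lemma partitionEntropy_congr_ae {X X' : Ω → α} (h : X =ᵐ[μ] X') :
    partitionEntropy μ X = partitionEntropy μ X' := by
  refine Finset.sum_congr rfl fun a _ => ?_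
  rw [measureReal_congr (s := X ⁻¹' {a}) (t := X' ⁻¹' {a})]
  filter_upwards [h] with ω hω
  exact propext (show X ω = a ↔ X' ω = a by rw [hω])

lemma partitionEntropy_comp_measurePreserving [MeasurableSpace α] [MeasurableSingletonClass α]
    {μ' : Measure Ω'} {T : Ω → Ω'} (hT : MeasurePreserving T μ μ') {X : Ω' → α}
    (hX : Measurable X) :
    partitionEntropy μ (fun ω => X (T ω)) = partitionEntropy μ' X := by
  refine Finset.sum_congr rfl fun a _ => ?_
  rw [← hT.measureReal_preimage (hX (measurableSet_singleton a)).nullMeasurableSet]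
  rfl

variable [IsProbabilityMeasure μ]

section

variable [MeasurableSpace α] [MeasurableSingletonClass α] [MeasurableSpace β]
  [MeasurableSingletonClass β] [MeasurableSpace κ] [MeasurableSingletonClass κ]

lemma sum_measureReal_inter_preimage {A : Set Ω} {Y : Ω → β} (hA : MeasurableSet A)
    (hY : Measurable Y) : ∑ y, μ.real (A ∩ Y ⁻¹' {y}) = μ.real A := by
  rw [← measureReal_biUnion_finset]
  · congr 1
    ext ω
    simp
  · exact fun y _ y' _ h => ((disjoint_singleton.2 h).preimage Y).mono inter_subset_right
      inter_subset_right
  · exact fun y _ => hA.inter (hY (measurableSet_singleton y))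

/-- The conditional entropy of `X` given `Y`, for random variables with finitely many values. -/
lemma partitionEntropy_prod_sub {X : Ω → α} {Y : Ω → β} (hX : Measurable X) (hY : Measurable Y) :
    partitionEntropy μ (fun ω => (X ω, Y ω)) - partitionEntropy μ Y =
      ∑ x, ∑ y, μ.real (Y ⁻¹' {y}) *
        Real.negMulLog (μ.real (X ⁻¹' {x} ∩ Y ⁻¹' {y}) / μ.real (Y ⁻¹' {y})) := by
  have h1 : ∀ y, Real.negMulLog (μ.real (Y ⁻¹' {y})) = ∑ x,
      -(μ.real (X ⁻¹' {x} ∩ Y ⁻¹' {y}) * Real.log (μ.real (Y ⁻¹' {y}))) := by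
    intro y
    rw [Finset.sum_neg_distrib, ← Finset.sum_mul, Real.negMulLog, neg_mul]
    have := sum_measureReal_inter_preimage (μ := μ) (hY (measurableSet_singleton y)) hX
    simp_rw [inter_comm (Y ⁻¹' {y})] at this
    rw [this]
  have h2 : ∀ x y, (fun ω => (X ω, Y ω)) ⁻¹' {(x, y)} = X ⁻¹' {x} ∩ Y ⁻¹' {y} := by
    intro x y
    ext ω
    simp
  rw [partitionEntropy, partitionEntropy, Fintype.sum_prod_type, Finset.sum_congr rfl
    fun y _ => h1 y, Finset.sum_comm (s := (Finset.univ : Finset β)), ← Finset.sum_sub_distrib]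
  refine Finset.sum_congr rfl fun x _ => ?_
  rw [← Finset.sum_sub_distrib]
  refine Finset.sum_congr rfl fun y _ => ?_
  rw [h2]
  set s := μ.real (Y ⁻¹' {y})
  set t := μ.real (X ⁻¹' {x} ∩ Y ⁻¹' {y}) with ht
  have hts : t ≤ s := measureReal_mono inter_subset_right
  have ht0 : 0 ≤ t := measureReal_nonneg
  rcases ht0.eq_or_lt with h0 | h0
  · simp [← h0]
  · have hs : 0 < s := h0.trans_le hts
    rw [Real.negMulLog, Real.negMulLog, Real.log_div h0.ne' hs.ne']
    field_simp
    ring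

lemma partitionEntropy_le_prod {X : Ω → α} {Y : Ω → β} (hX : Measurable X) (hY : Measurable Y) :
    partitionEntropy μ Y ≤ partitionEntropy μ (fun ω => (X ω, Y ω)) := by
  rw [← sub_nonneg, partitionEntropy_prod_sub hX hY]
  refine Finset.sum_nonneg fun x _ => Finset.sum_nonneg fun y _ => mul_nonneg measureReal_nonneg <|
    Real.negMulLog_nonneg (by positivity) (div_le_one_of_le₀ (measureReal_mono inter_subset_right)
      measureReal_nonneg)

/-- Conditioning reduces entropy. -/
lemma partitionEntropy_prod_sub_le {X : Ω → α} {Y : Ω → β} {Z : Ω → κ} (hX : Measurable X)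
    (hY : Measurable Y) (hZ : Measurable Z) :
    partitionEntropy μ (fun ω => (X ω, Y ω, Z ω)) - partitionEntropy μ (fun ω => (Y ω, Z ω)) ≤
      partitionEntropy μ (fun ω => (X ω, Y ω)) - partitionEntropy μ Y := by
  rw [partitionEntropy_prod_sub hX (hY.prodMk hZ), partitionEntropy_prod_sub hX hY]
  refine Finset.sum_le_sum fun x _ => ?_
  rw [Fintype.sum_prod_type]
  refine Finset.sum_le_sum fun y _ => ?_
  have h2 : ∀ z, (fun ω => (Y ω, Z ω)) ⁻¹' {(y, z)} = Y ⁻¹' {y} ∩ Z ⁻¹' {z} := by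
    intro z
    ext ω
    simp
  simp_rw [h2]
  set s := μ.real (Y ⁻¹' {y}) with hs
  have hYm := hY (measurableSet_singleton y)
  have hXm := hX (measurableSet_singleton x)
  have hsum := sum_measureReal_inter_preimage (μ := μ) hYm hZ
  rcases (measureReal_nonneg : 0 ≤ s).eq_or_lt with h0 | h0
  · have : ∀ z, μ.real (Y ⁻¹' {y} ∩ Z ⁻¹' {z}) = 0 := fun z =>
      le_antisymm ((measureReal_mono inter_subset_left).trans h0.symm.le) measureReal_nonneg
    rw [show s = 0 from h0.symm]
    simp [this]
  -- Jensen's inequality, with the conditional probabilities of `Z` given `Y = y` as weights.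
  · have hJ := Real.concaveOn_negMulLog.le_map_sum (t := Finset.univ)
      (w := fun z => μ.real (Y ⁻¹' {y} ∩ Z ⁻¹' {z}) / s)
      (p := fun z => μ.real (X ⁻¹' {x} ∩ (Y ⁻¹' {y} ∩ Z ⁻¹' {z})) /
        μ.real (Y ⁻¹' {y} ∩ Z ⁻¹' {z})) (fun z _ => by positivity)
      (by rw [← Finset.sum_div, hsum, div_self h0.ne']) (fun z _ => by
        rw [mem_Ici]; positivity)
    simp only [smul_eq_mul] at hJ
    have h3 : ∑ z, μ.real (Y ⁻¹' {y} ∩ Z ⁻¹' {z}) / s *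
        (μ.real (X ⁻¹' {x} ∩ (Y ⁻¹' {y} ∩ Z ⁻¹' {z})) / μ.real (Y ⁻¹' {y} ∩ Z ⁻¹' {z})) =
        μ.real (X ⁻¹' {x} ∩ Y ⁻¹' {y}) / s := by
      rw [← sum_measureReal_inter_preimage (μ := μ) (hXm.inter hYm) hZ, Finset.sum_div]
      refine Finset.sum_congr rfl fun z _ => ?_
      rw [inter_assoc]
      rcases eq_or_ne (μ.real (Y ⁻¹' {y} ∩ Z ⁻¹' {z})) 0 with h | h
      · have : μ.real (X ⁻¹' {x} ∩ (Y ⁻¹' {y} ∩ Z ⁻¹' {z})) = 0 :=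
          le_antisymm ((measureReal_mono inter_subset_right).trans h.le) measureReal_nonneg
        simp [this]
      · field_simp
    rw [h3] at hJ
    calc _ = s * ∑ z, μ.real (Y ⁻¹' {y} ∩ Z ⁻¹' {z}) / s * Real.negMulLog
          (μ.real (X ⁻¹' {x} ∩ (Y ⁻¹' {y} ∩ Z ⁻¹' {z})) / μ.real (Y ⁻¹' {y} ∩ Z ⁻¹' {z})) := by
          rw [Finset.mul_sum]
          refine Finset.sum_congr rfl fun z _ => ?_
          have hs0 : s ≠ 0 := h0.ne'
          field_simp
      _ ≤ _ := mul_le_mul_of_nonneg_left hJ h0.le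

/-- Conditioning on a finer partition reduces entropy. -/
lemma partitionEntropy_prod_sub_le_comp {X : Ω → α} {Z : Ω → κ} (hX : Measurable X)
    (hZ : Measurable Z) {g : κ → β} (hg : Measurable g) :
    partitionEntropy μ (fun ω => (X ω, Z ω)) - partitionEntropy μ Z ≤
      partitionEntropy μ (fun ω => (X ω, g (Z ω))) - partitionEntropy μ (fun ω => g (Z ω)) := by
  have h := partitionEntropy_prod_sub_le (μ := μ) hX (hg.comp hZ) hZ
  have e1 := partitionEntropy_comp_injective μ (fun ω => (X ω, Z ω))
    (g := fun w : α × κ => (w.1, g w.2, w.2)) fun w w' hw => by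
      simp only [Prod.mk.injEq] at hw
      exact Prod.ext hw.1 hw.2.2
  have e2 := partitionEntropy_comp_injective μ Z (g := fun z => (g z, z)) fun z z' hz => by
      simp only [Prod.mk.injEq] at hz
      exact hz.2
  simp only [Function.comp_apply] at h
  rwa [e1, e2] at h

end

end FiniteEntropy

/-! ### Conditional entropy given a σ-algebra and its continuity along filtrations. -/

section CondEntropy

variable {Ω α β κ : Type*} {mΩ : MeasurableSpace Ω} [Fintype α] [Fintype β] [Fintype κ]
  [MeasurableSpace α] [MeasurableSingletonClass α] [MeasurableSpace β]
  [MeasurableSingletonClass β] [MeasurableSpace κ] [MeasurableSingletonClass κ]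
  {μ : Measure Ω} [IsProbabilityMeasure μ]

/-- The conditional entropy of a random variable with finitely many values given a σ-algebra. -/
noncomputable def condEntropy (μ : Measure Ω) (X : Ω → α) (m : MeasurableSpace Ω) : ℝ :=
  ∑ x, ∫ ω, Real.negMulLog ((μ⟦X ⁻¹' {x} | m⟧) ω) ∂μ

omit [MeasurableSpace α] [MeasurableSingletonClass α] [Fintype α] in
lemma integral_comp_fintype {Y : Ω → β} (hY : Measurable Y) (h : β → ℝ) :
    ∫ ω, h (Y ω) ∂μ = ∑ y, μ.real (Y ⁻¹' {y}) * h y := by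
  have hh : Measurable h := measurable_of_finite h
  have := Measure.isProbabilityMeasure_map (μ := μ) hY.aemeasurable
  rw [← integral_map hY.aemeasurable hh.aestronglyMeasurable, integral_fintype (.of_finite)]
  refine Finset.sum_congr rfl fun y _ => ?_
  rw [map_measureReal_apply hY (measurableSet_singleton y), smul_eq_mul]

lemma condExp_indicator_mem_Icc {A : Set Ω} (hA : MeasurableSet A) (m : MeasurableSpace Ω) :
    ∀ᵐ ω ∂μ, (μ⟦A | m⟧) ω ∈ Icc (0 : ℝ) 1 := by
  by_cases hm : m ≤ mΩ
  · have hint : Integrable (A.indicator fun _ => (1 : ℝ)) μ := (integrable_const _).indicator hA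
    have h1 : 0 ≤ᵐ[μ] μ⟦A | m⟧ := condExp_nonneg <| .of_forall fun ω =>
      indicator_nonneg (fun _ _ => zero_le_one) ω
    have h2 : μ⟦A | m⟧ ≤ᵐ[μ] μ[fun _ => (1 : ℝ) | m] :=
      condExp_mono hint (integrable_const _) <| .of_forall fun ω =>
        indicator_le_self' (fun _ _ => zero_le_one) ω
    rw [condExp_const hm] at h2
    filter_upwards [h1, h2] with ω h h' using ⟨h, h'⟩
  · simp [condExp_of_not_le hm]

/-- Conditional probabilities given a random variable with finitely many values. -/
lemma condExp_comap_fintype {A : Set Ω} (hA : MeasurableSet A) {Y : Ω → β} (hY : Measurable Y) :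
    μ⟦A | MeasurableSpace.comap Y inferInstance⟧ =ᵐ[μ]
      fun ω => μ.real (A ∩ Y ⁻¹' {Y ω}) / μ.real (Y ⁻¹' {Y ω}) := by
  classical
  set c : β → ℝ := fun y => μ.real (A ∩ Y ⁻¹' {y}) / μ.real (Y ⁻¹' {y}) with hc
  have hcm : Measurable c := measurable_of_finite c
  have hcY : Integrable (fun ω => c (Y ω)) μ := by
    have := Measure.isProbabilityMeasure_map (μ := μ) hY.aemeasurable
    exact (Integrable.of_finite (μ := μ.map Y) (f := c)).comp_measurable hY
  refine (ae_eq_condExp_of_forall_setIntegral_eq hY.comap_le ((integrable_const _).indicator hA)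
    (fun s _ _ => hcY.integrableOn) ?_ ?_).symm
  · rintro _ ⟨t, ht, rfl⟩ -
    rw [← integral_indicator (hY ht), setIntegral_indicator hA, setIntegral_const, smul_eq_mul,
      mul_one]
    have : (Y ⁻¹' t).indicator (fun ω => c (Y ω)) = fun ω => t.indicator c (Y ω) := rfl
    rw [this, integral_comp_fintype hY, inter_comm, ← sum_measureReal_inter_preimage
      (hA.inter (hY ht)) hY]
    refine Finset.sum_congr rfl fun y _ => ?_
    by_cases hy : y ∈ t
    · rw [indicator_of_mem hy, hc]
      have e1 : A ∩ Y ⁻¹' t ∩ Y ⁻¹' {y} = A ∩ Y ⁻¹' {y} := by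
        rw [inter_assoc, ← preimage_inter, inter_eq_right.2 (singleton_subset_iff.2 hy)]
      rw [e1]
      rcases eq_or_ne (μ.real (Y ⁻¹' {y})) 0 with h | h
      · have : μ.real (A ∩ Y ⁻¹' {y}) = 0 :=
          le_antisymm ((measureReal_mono inter_subset_right).trans h.le) measureReal_nonneg
        simp [this]
      · field_simp
    · have e1 : A ∩ Y ⁻¹' t ∩ Y ⁻¹' {y} = ∅ := by
        rw [inter_assoc, ← preimage_inter, inter_singleton_eq_empty.2 hy, preimage_empty,
          inter_empty]
      rw [e1, indicator_of_notMem hy]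
      simp
  · exact (hcm.comp (comap_measurable Y)).aestronglyMeasurable

lemma partitionEntropy_prod_sub_eq_condEntropy {X : Ω → α} {Y : Ω → β} (hX : Measurable X)
    (hY : Measurable Y) :
    partitionEntropy μ (fun ω => (X ω, Y ω)) - partitionEntropy μ Y =
      condEntropy μ X (MeasurableSpace.comap Y inferInstance) := by
  rw [partitionEntropy_prod_sub hX hY]
  refine Finset.sum_congr rfl fun x _ => ?_
  rw [← integral_comp_fintype hY fun y =>
    Real.negMulLog (μ.real (X ⁻¹' {x} ∩ Y ⁻¹' {y}) / μ.real (Y ⁻¹' {y}))]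
  refine integral_congr_ae ?_
  filter_upwards [condExp_comap_fintype (hX (measurableSet_singleton x)) hY] with ω hω
  rw [hω]

lemma negMulLog_le_one {x : ℝ} (hx : x ∈ Icc (0 : ℝ) 1) : Real.negMulLog x ≤ 1 := by
  rcases hx.1.eq_or_lt with h | h
  · simp [← h]
  · have h1 := mul_le_mul_of_nonneg_left (Real.one_sub_inv_le_log_of_pos h) h.le
    rw [mul_sub, mul_inv_cancel₀ h.ne'] at h1
    rw [Real.negMulLog]
    linarith

lemma abs_negMulLog_le_one {x : ℝ} (hx : x ∈ Icc (0 : ℝ) 1) : |Real.negMulLog x| ≤ 1 := by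
  rw [abs_of_nonneg (Real.negMulLog_nonneg hx.1 hx.2)]
  exact negMulLog_le_one hx

/-- The σ-algebras generated by the first `n` terms of a sequence of random variables. -/
noncomputable def segmentFiltration (Z : ℕ → Ω → κ) (hZ : ∀ i, Measurable (Z i)) :
    Filtration ℕ mΩ where
  seq n := MeasurableSpace.comap (fun ω (i : Fin n) => Z i ω) inferInstance
  mono' n n' h := by
    have : (fun ω (i : Fin n) => Z i ω) =
        (fun (z : Fin n' → κ) (i : Fin n) => z (Fin.castLE h i)) ∘ fun ω (i : Fin n') => Z i ω := rfl
    change MeasurableSpace.comap _ _ ≤ MeasurableSpace.comap _ _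
    rw [this, ← MeasurableSpace.comap_comp]
    exact MeasurableSpace.comap_mono
      (measurable_pi_lambda _ fun i => measurable_pi_apply _).comap_le
  le' n := Measurable.comap_le (f := fun ω (i : Fin n) => Z i ω)
    (measurable_pi_lambda _ fun i => hZ i)

omit [Fintype κ] [MeasurableSingletonClass κ] in
lemma iSup_segmentFiltration (Z : ℕ → Ω → κ) (hZ : ∀ i, Measurable (Z i)) :
    ⨆ n, segmentFiltration Z hZ n = MeasurableSpace.comap (fun ω i => Z i ω) inferInstance := by
  refine le_antisymm (iSup_le fun n => ?_) ?_
  · have : (fun ω (i : Fin n) => Z i ω) =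
        (fun (z : ℕ → κ) (i : Fin n) => z i) ∘ fun ω i => Z i ω := rfl
    change MeasurableSpace.comap _ _ ≤ _
    rw [this, ← MeasurableSpace.comap_comp]
    exact MeasurableSpace.comap_mono
      (measurable_pi_lambda _ fun i => measurable_pi_apply _).comap_le
  · rw [MeasurableSpace.pi, MeasurableSpace.comap_iSup]
    refine iSup_le fun i => le_trans ?_ (le_iSup _ (i + 1))
    rw [MeasurableSpace.comap_comp]
    rintro _ ⟨t, ht, rfl⟩
    exact ⟨(fun z : Fin (i + 1) → κ => z (Fin.last i)) ⁻¹' t, measurable_pi_apply _ ht, rfl⟩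

/-- Lévy's upward theorem for the entropy. -/
lemma tendsto_partitionEntropy_prod_sub {X : Ω → α} (hX : Measurable X) {Z : ℕ → Ω → κ}
    (hZ : ∀ i, Measurable (Z i)) :
    Tendsto (fun n : ℕ => partitionEntropy μ (fun ω => (X ω, fun i : Fin n => Z i ω)) -
      partitionEntropy μ (fun ω => fun i : Fin n => Z i ω)) atTop
      (𝓝 (condEntropy μ X (MeasurableSpace.comap (fun ω i => Z i ω) inferInstance))) := by
  have h1 : ∀ n : ℕ, partitionEntropy μ (fun ω => (X ω, fun i : Fin n => Z i ω)) -
      partitionEntropy μ (fun ω => fun i : Fin n => Z i ω) =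
      condEntropy μ X (segmentFiltration Z hZ n) := fun n =>
    partitionEntropy_prod_sub_eq_condEntropy hX (measurable_pi_lambda _ fun i => hZ i)
  simp only [h1]
  rw [← iSup_segmentFiltration Z hZ]
  refine tendsto_finsetSum _ fun x _ => ?_
  have hA := hX (measurableSet_singleton x)
  -- The conditional probabilities converge as martingales, and `negMulLog` is bounded by `1` on
  -- `[0, 1]`.
  refine tendsto_integral_of_dominated_convergence (fun _ => (1 : ℝ)) (fun n => ?_)
    (integrable_const _) (fun n => ?_) ?_
  · exact Real.continuous_negMulLog.comp_aestronglyMeasurable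
      integrable_condExp.aestronglyMeasurable
  · filter_upwards [condExp_indicator_mem_Icc (μ := μ) hA (segmentFiltration Z hZ n)] with ω hω
    exact abs_negMulLog_le_one hω
  · filter_upwards [MeasureTheory.tendsto_ae_condExp (μ := μ) (ℱ := segmentFiltration Z hZ)
      ((X ⁻¹' {x}).indicator fun _ => (1 : ℝ))] with ω hω
    exact (Real.continuous_negMulLog.tendsto _).comp hω

end CondEntropy

/-! ### The Kolmogorov–Sinai theorem. -/

section KolmogorovSinai

variable {Ω : Type*} [MeasurableSpace Ω] {μ : Measure Ω} [IsProbabilityMeasure μ] {T : Ω → Ω}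
  {k l : ℕ}

/-- Entropy of `⋁_{i < n} T⁻ⁱ φ`. -/
noncomputable def blockEntropy (T : Ω → Ω) (μ : Measure Ω) (φ : Ω → Fin k) (n : ℕ) : ℝ :=
  partitionEntropy μ (fun x => fun i : Fin n => φ (T^[i] x))

lemma blockEntropy_zero (T : Ω → Ω) (φ : Ω → Fin k) : blockEntropy T μ φ 0 = 0 := by
  rw [blockEntropy, partitionEntropy, Fintype.sum_unique]
  have : (fun x => fun i : Fin 0 => φ (T^[i] x)) ⁻¹' {default} = univ := by
    ext x
    simp only [mem_preimage, mem_singleton_iff, mem_univ, iff_true]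
    exact Subsingleton.elim _ _
  rw [this]
  simp

lemma tendsto_blockEntropy_div {φ : Ω → Fin k} {c : ℝ}
    (h : Tendsto (fun n => blockEntropy T μ φ (n + 1) - blockEntropy T μ φ n) atTop (𝓝 c)) :
    Tendsto (fun n : ℕ => blockEntropy T μ φ n / n) atTop (𝓝 c) := by
  refine h.cesaro.congr fun n => ?_
  rw [Finset.sum_range_sub, blockEntropy_zero, sub_zero, div_eq_inv_mul]

omit [IsProbabilityMeasure μ] in
lemma mapPartitionEntropy_eq {φ : Ω → Fin k} {c : ℝ}
    (h : Tendsto (fun n : ℕ => blockEntropy T μ φ n / n) atTop (𝓝 c)) :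
    mapPartitionEntropy T μ φ = ENNReal.ofReal c :=
  (ENNReal.tendsto_ofReal h).limsup_eq

omit [MeasurableSpace Ω] in
lemma snoc_iterate (ψ : Ω → Fin l) (N : ℕ) (x : Ω) :
    (Fin.snoc (fun i : Fin N => ψ (T^[i] x)) (ψ (T^[N] x)) : Fin (N + 1) → Fin l) =
      fun i : Fin (N + 1) => ψ (T^[i] x) := by
  funext i
  refine Fin.lastCases ?_ (fun i => ?_) i
  · simp
  · simp

/-- The variables `ψ ∘ T^i`, `i < N`, are adjoined one at a time to the `φ`-block of length `N + n`.
Each adds at most its conditional entropy given the `φ`-block of length `n` starting at time `i`,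
which by invariance is the same number `d` for every `i`. -/
lemma blockEntropy_le (hT : MeasurePreserving T μ μ) {φ : Ω → Fin k} (hφ : Measurable φ)
    {ψ : Ω → Fin l} (hψ : Measurable ψ) (N n : ℕ) :
    blockEntropy T μ ψ N ≤ blockEntropy T μ φ (N + n) +
      N * (partitionEntropy μ (fun x => (ψ x, fun i : Fin n => φ (T^[i] x))) -
        blockEntropy T μ φ n) := by
  set d := partitionEntropy μ (fun x => (ψ x, fun i : Fin n => φ (T^[i] x))) -
    blockEntropy T μ φ n with hd
  have hTm := hT.measurable
  let Φ : Ω → Fin (N + n) → Fin k := fun x i => φ (T^[i] x)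
  have hΦ : Measurable Φ := measurable_pi_lambda _ fun i => hφ.comp (hTm.iterate _)
  have hΨ : ∀ N', Measurable fun x => fun i : Fin N' => ψ (T^[i] x) := fun N' =>
    measurable_pi_lambda _ fun i => hψ.comp (hTm.iterate _)
  have key : ∀ N' ≤ N, partitionEntropy μ (fun x => (Φ x, fun i : Fin N' => ψ (T^[i] x))) ≤
      partitionEntropy μ Φ + N' * d := by
    intro N' hN'
    induction N' with
    | zero =>
      have h1 := partitionEntropy_comp_injective μ Φ
        (g := fun z => (z, (finZeroElim : Fin 0 → Fin l))) fun z z' h => congrArg Prod.fst h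
      have h2 : (fun x => (Φ x, fun i : Fin 0 => ψ (T^[i] x))) =
          fun x => (Φ x, (finZeroElim : Fin 0 → Fin l)) :=
        funext fun x => Prod.ext rfl (Subsingleton.elim _ _)
      rw [h2, h1]
      simp
    | succ N' ih =>
      have h1 := partitionEntropy_comp_injective μ
        (fun x => (ψ (T^[N'] x), Φ x, fun i : Fin N' => ψ (T^[i] x)))
        (g := fun w => (w.2.1, (Fin.snoc w.2.2 w.1 : Fin (N' + 1) → Fin l))) fun w w' h => by
          obtain ⟨h1, h2⟩ := Prod.mk.inj h
          obtain ⟨h3, h4⟩ := Fin.snoc_inj.1 h2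
          exact Prod.ext h4 (Prod.ext h1 h3)
      simp only [snoc_iterate] at h1
      have h2 := partitionEntropy_prod_sub_le (μ := μ) (hψ.comp (hTm.iterate N')) hΦ (hΨ N')
      simp only [Function.comp_apply] at h2
      have h3 := partitionEntropy_prod_sub_le_comp (μ := μ) (hψ.comp (hTm.iterate N')) hΦ
        (g := fun z : Fin (N + n) → Fin k => fun i : Fin n => z ⟨i + N', by omega⟩)
        (measurable_pi_lambda _ fun i => measurable_pi_apply _)
      have h4 := partitionEntropy_comp_measurePreserving (hT.iterate N')
        (X := fun x => (ψ x, fun i : Fin n => φ (T^[i] x)))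
        (hψ.prodMk (measurable_pi_lambda _ fun i => hφ.comp (hTm.iterate _)))
      have h5 := partitionEntropy_comp_measurePreserving (hT.iterate N')
        (X := fun x => fun i : Fin n => φ (T^[i] x))
        (measurable_pi_lambda _ fun i => hφ.comp (hTm.iterate _))
      simp only [Function.comp_apply, Φ, Function.iterate_add_apply] at h3
      rw [h4, h5] at h3
      have h6 := ih (by omega)
      rw [h1]
      push_cast
      rw [hd, blockEntropy] at *
      linarith
  have h7 := partitionEntropy_le_prod (μ := μ) hΦ (hΨ N)
  exact h7.trans (key N le_rfl)

/-- The Kolmogorov–Sinai theorem. -/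
theorem entropy_eq_of_generating (hT : MeasurePreserving T μ μ) {φ : Ω → Fin k}
    (hφ : Measurable φ) {c : ℝ}
    (hc : Tendsto (fun n => blockEntropy T μ φ (n + 1) - blockEntropy T μ φ n) atTop (𝓝 c))
    (hgen : ∀ A, MeasurableSet A →
      ∃ B, MeasurableSet[MeasurableSpace.comap (fun x i => φ (T^[i] x)) inferInstance] B ∧
        A =ᵐ[μ] B) :
    entropy T μ = ENNReal.ofReal c := by
  have hblock := tendsto_blockEntropy_div hc
  have hm : MeasurableSpace.comap (fun x (i : ℕ) => φ (T^[i] x)) inferInstance ≤ ‹_› :=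
    Measurable.comap_le (measurable_pi_lambda _ fun i => hφ.comp (hT.measurable.iterate _))
  refine le_antisymm (iSup_le fun l => iSup_le fun ψ => iSup_le fun hψ => ?_) ?_
  · have hd := tendsto_partitionEntropy_prod_sub (μ := μ) hψ (Z := fun i x => φ (T^[i] x))
      fun i => hφ.comp (hT.measurable.iterate _)
    -- The fibres of `ψ` are determined by the itineraries, so their conditional probabilities are
    -- `0` or `1`, where `negMulLog` vanishes.
    have hzero : condEntropy μ ψ (MeasurableSpace.comap (fun x (i : ℕ) => φ (T^[i] x))
        inferInstance) = 0 := by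
      refine Finset.sum_eq_zero fun x _ => ?_
      obtain ⟨B, hB, hAB⟩ := hgen _ (hψ (measurableSet_singleton x))
      rw [integral_eq_zero_of_ae]
      have h1 : μ⟦ψ ⁻¹' {x} | MeasurableSpace.comap (fun x (i : ℕ) => φ (T^[i] x)) inferInstance⟧
          =ᵐ[μ] B.indicator fun _ => (1 : ℝ) := by
        refine (condExp_congr_ae (indicator_ae_eq_of_ae_eq_set hAB)).trans ?_
        rw [condExp_of_stronglyMeasurable hm ((stronglyMeasurable_const).indicator hB)
          ((integrable_const _).indicator (hm _ hB))]
      filter_upwards [h1] with ω hω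
      rw [hω]
      by_cases h : ω ∈ B <;> simp [h]
    rw [hzero] at hd
    -- `blockEntropy_le` is divided by `N` and `N → ∞`; the extra term tends to `0` afterwards, with
    -- `n`.
    have hle : ∀ n : ℕ, mapPartitionEntropy T μ ψ ≤ ENNReal.ofReal (c +
        (partitionEntropy μ (fun x => (ψ x, fun i : Fin n => φ (T^[i] x))) -
          partitionEntropy μ (fun x => fun i : Fin n => φ (T^[i] x)))) := by
      intro n
      set d := partitionEntropy μ (fun x => (ψ x, fun i : Fin n => φ (T^[i] x))) -
          partitionEntropy μ (fun x => fun i : Fin n => φ (T^[i] x)) with hd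
      have hlim : Tendsto (fun N : ℕ => blockEntropy T μ φ (N + n) / N + d) atTop
          (𝓝 (c + d)) := by
        refine Tendsto.add_const d ?_
        have h1 := hblock.comp (tendsto_add_atTop_nat n)
        have h2 : Tendsto (fun N : ℕ => 1 + (n : ℝ) / N) atTop (𝓝 (1 + 0)) :=
          (tendsto_const_div_atTop_nhds_zero_nat (n : ℝ)).const_add 1
        have h3 := h1.mul h2
        rw [add_zero, mul_one] at h3
        refine h3.congr' ?_
        filter_upwards [eventually_gt_atTop 0] with N hN
        have hN' : (0 : ℝ) < N := by exact_mod_cast hN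
        simp only [Function.comp_apply]
        push_cast
        field_simp
      rw [← (ENNReal.tendsto_ofReal hlim).limsup_eq]
      refine limsup_le_limsup ?_
      filter_upwards [eventually_gt_atTop 0] with N hN
      have hN' : (0 : ℝ) < N := by exact_mod_cast hN
      refine ENNReal.ofReal_le_ofReal ?_
      have h1 := blockEntropy_le hT hφ hψ N n
      rw [div_le_iff₀ hN', add_mul, div_mul_cancel₀ _ hN'.ne', mul_comm d]
      exact h1
    have h2 := ENNReal.tendsto_ofReal (hd.const_add c)
    rw [add_zero] at h2
    exact ge_of_tendsto' h2 hle
  · rw [← mapPartitionEntropy_eq hblock]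
    exact le_iSup_of_le k (le_iSup_of_le φ (le_iSup_of_le hφ le_rfl))

end KolmogorovSinai

/-! ### Entropy through conditional measures. -/

section CondKernel

variable {Ω : Type*} {m : MeasurableSpace Ω} [mΩ : MeasurableSpace Ω] [StandardBorelSpace Ω]
  {ν : Measure Ω} [IsProbabilityMeasure ν]

/-- The pull-out property of conditional probabilities. It takes extended nonnegative `g` because it
is applied to `-log` of a probability, which may be infinite. -/
lemma lintegral_indicator_eq_lintegral_condExpKernel_mul (hm : m ≤ mΩ) {A : Set Ω}
    (hA : MeasurableSet[mΩ] A) {g : Ω → ℝ≥0∞} (hg : Measurable[m] g) :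
    ∫⁻ y, A.indicator g y ∂ν = ∫⁻ y, condExpKernel ν m y A * g y ∂ν := by
  have hG : @Measurable (Ω × Ω) ℝ≥0∞ (m.prod mΩ) _
      fun w => A.indicator (fun _ => (1 : ℝ≥0∞)) w.2 * g w.1 :=
    ((measurable_const.indicator hA).comp (@measurable_snd Ω Ω m mΩ)).mul
      (hg.comp (@measurable_fst Ω Ω m mΩ))
  have hdiag : @Measurable Ω (Ω × Ω) mΩ (m.prod mΩ) Function.diag :=
    @Measurable.prodMk Ω mΩ Ω Ω m mΩ id id (measurable_id'' hm) measurable_id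
  have h1 := @Measure.lintegral_compProd Ω Ω m mΩ (ν.trim hm) (condExpKernel ν m) _ _ _ hG
  rw [compProd_trim_condExpKernel hm, @lintegral_map Ω (Ω × Ω) mΩ (m.prod mΩ) ν _ _ hG hdiag] at h1
  have h2 : ∀ y, ∫⁻ z, A.indicator (fun _ => (1 : ℝ≥0∞)) z * g y ∂(condExpKernel ν m y) =
      condExpKernel ν m y A * g y := by
    intro y
    rw [lintegral_mul_const _ (measurable_const.indicator hA), lintegral_indicator_const hA,
      one_mul]
  simp only [h2] at h1
  have hκg : Measurable[m] fun y => condExpKernel ν m y A * g y :=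
    (measurable_condExpKernel hA).mul hg
  rw [lintegral_trim hm hκg] at h1
  rw [← h1]
  refine lintegral_congr fun y => ?_
  by_cases hy : y ∈ A <;> simp [hy, Function.diag]

/-- At `p = 0` the logarithm is infinite, and `0 * ∞ = 0` agrees with the value of `negMulLog`
there. -/
lemma mul_neg_log_toENNReal {p : ℝ≥0∞} (hp : p ≤ 1) :
    p * (-(ENNReal.log p)).toENNReal = ENNReal.ofReal (Real.negMulLog p.toReal) := by
  rcases eq_or_ne p 0 with rfl | h0
  · simp
  · have htop : p ≠ ∞ := (hp.trans_lt ENNReal.one_lt_top).ne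
    rw [ENNReal.log_pos_real h0 htop, ← EReal.coe_neg, EReal.toENNReal_of_ne_top (EReal.coe_ne_top _),
      EReal.toReal_coe, Real.negMulLog, neg_mul_comm, ENNReal.ofReal_mul ENNReal.toReal_nonneg,
      ENNReal.ofReal_toReal htop]

variable {K : ℕ}

/-- The conditional entropy of a finite partition given a countably generated partition, in terms
of conditional expectations. -/
lemma condPartitionEntropy_eq_condEntropy {X : Ω → Fin K} (hX : Measurable X) {Z : ℕ → Ω → Fin K}
    {η ξ : Setoid Ω} (hξ : ∀ y y', ξ y y' ↔ ∀ i, Z i y = Z i y')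
    (hη : ∀ y y', η y y' ↔ X y = X y' ∧ ξ y y')
    (hm : m ≤ mΩ) (hZm : ∀ i, Measurable[m] (Z i)) (hσ : partitionSigma ξ = m) :
    condPartitionEntropy ν η ξ = ENNReal.ofReal (condEntropy ν X m) := by
  have hZ : ∀ i, Measurable (Z i) := fun i => (hZm i).mono hm le_rfl
  have hXx : ∀ x, MeasurableSet[mΩ] (X ⁻¹' {x}) := fun x => hX (measurableSet_singleton x)
  -- Each `Z i` is `m`-measurable, so almost every conditional measure is carried by the class of
  -- its base point under `ξ`. The class under `η` then has the same conditional measure as the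
  -- fibre of `X`.
  have hfib : ∀ᵐ y ∂ν, ∀ i, condExpKernel ν m y (Z i ⁻¹' {Z i y})ᶜ = 0 := by
    rw [ae_all_iff]
    intro i
    have h1 : ∀ᵐ y ∂ν, ∀ x, (condExpKernel ν m y).real (Z i ⁻¹' {x}) =
        (Z i ⁻¹' {x}).indicator (fun _ => (1 : ℝ)) y := by
      rw [ae_all_iff]
      intro x
      have hx : MeasurableSet[m] (Z i ⁻¹' {x}) := hZm i (measurableSet_singleton x)
      have h2 := condExpKernel_ae_eq_condExp (μ := ν) hm (hm _ hx)
      rw [condExp_of_stronglyMeasurable hm (stronglyMeasurable_const.indicator hx)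
        ((integrable_const _).indicator (hm _ hx))] at h2
      exact h2
    filter_upwards [h1] with y hy
    have h3 := hy (Z i y)
    rw [indicator_of_mem (by simp)] at h3
    rw [prob_compl_eq_zero_iff (hZ i (measurableSet_singleton _))]
    rw [measureReal_def] at h3
    exact (ENNReal.toReal_eq_one_iff _).1 h3
  let g : Fin K → Ω → ℝ≥0∞ := fun x y =>
    (-(ENNReal.log (condExpKernel ν m y (X ⁻¹' {x})))).toENNReal
  have hg : ∀ x, Measurable[m] (g x) := fun x =>
    ((ENNReal.measurable_log.comp (measurable_condExpKernel (hXx x))).neg).ereal_toENNReal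
  calc condPartitionEntropy ν η ξ
      = ∫⁻ y, ∑ x, (X ⁻¹' {x}).indicator (g x) y ∂ν := by
        rw [condPartitionEntropy, hσ]
        refine lintegral_congr_ae ?_
        filter_upwards [hfib] with y hy
        have hset : {y' | η y y'} = X ⁻¹' {X y} ∩ ⋂ i, Z i ⁻¹' {Z i y} := by
          ext y'
          simp only [mem_inter_iff, mem_iInter, mem_preimage, mem_singleton_iff]
          refine (hη y y').trans (and_congr eq_comm ((hξ y y').trans ?_))
          exact forall_congr' fun i => eq_comm
        have hnull : condExpKernel ν m y (⋂ i, Z i ⁻¹' {Z i y})ᶜ = 0 := by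
          rw [compl_iInter]
          exact measure_iUnion_null hy
        rw [hset, measure_inter_conull hnull, Finset.sum_eq_single (X y)]
        · rw [indicator_of_mem (by simp)]
        · intro x _ hx
          exact indicator_of_notMem (fun h => hx (by simpa using h.symm)) _
        · simp
    _ = ∑ x, ∫⁻ y, ENNReal.ofReal (Real.negMulLog ((ν⟦X ⁻¹' {x} | m⟧) y)) ∂ν := by
        rw [lintegral_finsetSum _ fun x _ => ((hg x).mono hm le_rfl).indicator (hXx x)]
        refine Finset.sum_congr rfl fun x _ => ?_
        rw [lintegral_indicator_eq_lintegral_condExpKernel_mul hm (hXx x) (hg x)]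
        refine lintegral_congr_ae ?_
        filter_upwards [condExpKernel_ae_eq_condExp (μ := ν) hm (hXx x)] with y hy
        rw [← hy]
        exact mul_neg_log_toENNReal prob_le_one
    _ = _ := by
        have hnn : ∀ x, 0 ≤ᵐ[ν] fun y => Real.negMulLog ((ν⟦X ⁻¹' {x} | m⟧) y) := by
          intro x
          filter_upwards [condExp_indicator_mem_Icc (μ := ν) (hXx x) m] with y hy
          exact Real.negMulLog_nonneg hy.1 hy.2
        have hint : ∀ x, Integrable (fun y => Real.negMulLog ((ν⟦X ⁻¹' {x} | m⟧) y)) ν := by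
          intro x
          refine Integrable.of_bound (Real.continuous_negMulLog.comp_aestronglyMeasurable
            integrable_condExp.aestronglyMeasurable) 1 ?_
          filter_upwards [condExp_indicator_mem_Icc (μ := ν) (hXx x) m] with y hy
          exact abs_negMulLog_le_one hy
        rw [condEntropy, ENNReal.ofReal_sum_of_nonneg fun x _ => integral_nonneg_of_ae (hnn x)]
        exact Finset.sum_congr rfl fun x _ =>
          (ofReal_integral_eq_lintegral_ofReal (hint x) (hnn x)).symm

end CondKernel

/-! ### The entropy formula for the Pesin partition. -/

section Pesin

variable {f : ℝ → ℝ} {P : Setoid ℝ} {K : ℕ} {φ : ℝ → Fin K}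

/-- The delicate inclusion: a Borel union of classes is the preimage of its image in the space of
itineraries, and this image is Borel. The latter is a descriptive-set-theoretic fact,
`measurableSet_preimage_iff_inter_range`; it needs a measurable range, which here is a product of
finite sets. -/
lemma partitionSigma_pesin (hφ : Measurable φ) (hP : ∀ x x', P x x' ↔ φ x = φ x') :
    partitionSigma (pesin P) =
      MeasurableSpace.comap (fun (y : ℕ → ℝ) i => φ (y i)) inferInstance := by
  have hΦ : Measurable fun (y : ℕ → ℝ) i => φ (y i) :=
    measurable_pi_lambda _ fun i => hφ.comp (measurable_pi_apply i)
  have hcls : ∀ y y', pesin P y y' ↔ (fun i => φ (y i)) = fun i => φ (y' i) := fun y y' => by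
    rw [pesin_iff, funext_iff]
    exact forall_congr' fun i => hP _ _
  refine le_antisymm ?_ ?_
  · rintro _ ⟨S, hS, rfl⟩
    have hS' : MeasurableSet (Quotient.mk (pesin P) ⁻¹' S) := hS
    set A := Quotient.mk (pesin P) ⁻¹' S with hA
    have hAΦ : (fun (y : ℕ → ℝ) i => φ (y i)) ⁻¹' ((fun (y : ℕ → ℝ) i => φ (y i)) '' A) = A := by
      refine Subset.antisymm ?_ (subset_preimage_image _ _)
      rintro y ⟨y', hy', hyy⟩
      rw [hA, mem_preimage] at hy' ⊢
      rwa [← Quotient.sound ((hcls y' y).2 hyy)]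
    have hrange : range (fun (y : ℕ → ℝ) i => φ (y i)) = univ.pi fun _ => range φ := by
      ext z
      simp only [mem_range, mem_univ_pi]
      exact ⟨fun ⟨y, hy⟩ i => ⟨y i, congrFun hy i⟩, fun h => by
        choose y hy using h
        exact ⟨y, funext hy⟩⟩
    have hrm : MeasurableSet (range (fun (y : ℕ → ℝ) i => φ (y i))) := by
      rw [hrange]
      exact .univ_pi fun _ => (toFinite _).measurableSet
    rw [← hAΦ, hΦ.measurableSet_preimage_iff_inter_range hrm,
      inter_eq_left.2 (image_subset_range _ _)] at hS'
    exact ⟨_, hS', hAΦ⟩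
  · rintro _ ⟨t, ht, rfl⟩
    set B := (fun (y : ℕ → ℝ) i => φ (y i)) ⁻¹' t with hB
    have hsat : Quotient.mk (pesin P) ⁻¹' (Quotient.mk (pesin P) '' B) = B := by
      refine Subset.antisymm ?_ (subset_preimage_image _ _)
      rintro y ⟨y', hy', hyy⟩
      rw [hB, mem_preimage] at hy' ⊢
      rwa [← (hcls y' y).1 (Quotient.exact hyy)]
    refine ⟨Quotient.mk (pesin P) '' B, ?_, hsat⟩
    change MeasurableSet (Quotient.mk (pesin P) ⁻¹' (Quotient.mk (pesin P) '' B))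
    rw [hsat]
    exact hΦ ht

/-- The measurable sets are, up to null sets, determined by the itineraries. -/
lemma IsGenerating.exists_comap {μ : Measure ℝ} (hfm : Measurable f) (hgen : IsGenerating f μ P)
    (hφ : Measurable φ) (hP : ∀ x x', P x x' ↔ φ x = φ x') (A : Set ℝ) (hA : MeasurableSet A) :
    ∃ B, MeasurableSet[MeasurableSpace.comap (fun x i => φ (f^[i] x)) inferInstance] B ∧
      A =ᵐ[μ] B := by
  obtain ⟨X, hX, hsep⟩ := hgen
  obtain ⟨N, hN, hNm, hN0⟩ := exists_measurable_superset_of_null (ae_iff.1 hX)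
  have hNX : ∀ x ∈ Nᶜ, x ∈ X := fun x hx => by
    by_contra hcon
    exact hx (hN hcon)
  have hΦ : Measurable fun x (i : ℕ) => φ (f^[i] x) :=
    measurable_pi_lambda _ fun i => hφ.comp (hfm.iterate i)
  have hinj : InjOn (fun x (i : ℕ) => φ (f^[i] x)) Nᶜ := fun x hx x' hx' h =>
    hsep x (hNX x hx) x' (hNX x' hx') fun n => (hP _ _).2 (congrFun h n)
  -- Off a null set the itinerary map is injective, so by the Lusin–Souslin theorem it maps Borel
  -- sets to Borel sets.
  refine ⟨_, ⟨_, (hA.inter hNm.compl).image_of_measurable_injOn hΦ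
    (hinj.mono inter_subset_right), rfl⟩, ?_⟩
  filter_upwards [measure_eq_zero_iff_ae_notMem.1 hN0] with x hx
  refine propext ⟨fun h => ⟨x, ⟨h, hx⟩, rfl⟩, ?_⟩
  rintro ⟨x', hx', h⟩
  rw [← hinj hx'.2 hx h]
  exact hx'.1

/-- The last `n` symbols of a backward orbit are the forward itinerary of `y (n - 1)` read in
reverse, and reversal does not change entropy. -/
lemma blockEntropy_eq_past {D : Set ℝ} {μ : Measure ℝ} {ν : Measure (ℕ → ℝ)}
    (hν : IsNaturalExtension D f μ ν) (hfm : Measurable f) (hφ : Measurable φ) (n : ℕ) :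
    partitionEntropy ν (fun y => fun i : Fin n => φ (y i)) = blockEntropy f μ φ n := by
  have h1 : (fun y : ℕ → ℝ => fun i : Fin n => φ (y i)) =ᵐ[ν]
      fun y => fun i : Fin n => φ (f^[(Fin.rev i : ℕ)] (y (n - 1))) := by
    filter_upwards [hν.supported] with y hy
    funext i
    have := iterate_apply_of_mem hy (Fin.rev i : ℕ) i
    rw [show (Fin.rev i : ℕ) + i = n - 1 by rw [Fin.val_rev]; omega] at this
    rw [this]
  rw [partitionEntropy_congr_ae h1, partitionEntropy_comp_measurePreserving
    (hν.measurePreserving_eval (n - 1)) (X := fun x => fun i : Fin n => φ (f^[(Fin.rev i : ℕ)] x))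
    (measurable_pi_lambda _ fun i => hφ.comp (hfm.iterate _))]
  exact partitionEntropy_comp_injective μ (fun x => fun i : Fin n => φ (f^[i] x))
    (g := fun z i => z (Fin.rev i)) fun z z' h => funext fun i => by
      simpa using congrFun h (Fin.rev i)

/-- The symbols of `f y₀, y₀, …, y (n-1)` are the first `n + 1` symbols of `F y`, so invariance of
`ν` reduces this to `blockEntropy_eq_past`. -/
lemma blockEntropy_succ_eq_past {D : Set ℝ} {μ : Measure ℝ} {ν : Measure (ℕ → ℝ)}
    (hν : IsNaturalExtension D f μ ν) (hfm : Measurable f) (hφ : Measurable φ) (n : ℕ) :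
    partitionEntropy ν (fun y => (φ (f (proj y)), fun i : Fin n => φ (y i))) =
      blockEntropy f μ φ (n + 1) := by
  rw [← blockEntropy_eq_past hν hfm hφ, ← partitionEntropy_comp_measurePreserving hν.invariant
    (X := fun y => fun i : Fin (n + 1) => φ (y i))
    (measurable_pi_lambda _ fun i => hφ.comp (measurable_pi_apply _)),
    ← partitionEntropy_comp_injective ν (fun y => (φ (f (proj y)), fun i : Fin n => φ (y i)))
      (g := fun w : Fin K × (Fin n → Fin K) => (Fin.cons w.1 w.2 : Fin (n + 1) → Fin K))
      fun w w' h => by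
        obtain ⟨h1, h2⟩ := Fin.cons_inj.1 h
        exact Prod.ext h1 h2]
  congr 1
  funext y i
  refine Fin.cases rfl (fun i => ?_) i
  simp [forth]

/-- Rokhlin's formula for the entropy in terms of the increasing generating partition. -/
theorem entropy_eq_condPartitionEntropy {D : Set ℝ} {μ : Measure ℝ} [IsProbabilityMeasure μ]
    {ν : Measure (ℕ → ℝ)} [IsProbabilityMeasure ν] (hν : IsNaturalExtension D f μ ν)
    (hf : MeasurePreserving f μ μ) (hgen : IsGenerating f μ P) (hφ : Measurable φ)
    (hP : ∀ x x', P x x' ↔ φ x = φ x') :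
    entropy f μ = condPartitionEntropy ν (pull f 1 (pesin P)) (pesin P) := by
  have hfm := hf.measurable
  have hX : Measurable fun y : ℕ → ℝ => φ (f (proj y)) := hφ.comp (hfm.comp measurable_proj)
  have hZ : ∀ i, Measurable fun y : ℕ → ℝ => φ (y i) := fun i => hφ.comp (measurable_pi_apply i)
  -- `F⁻¹ξ` refines `ξ` by the single symbol of `f y₀`. Hence `H(F⁻¹ξ | ξ)` is the entropy of the
  -- next symbol given the whole past, the limit of the increments of the block entropies.
  rw [condPartitionEntropy_eq_condEntropy hX
    (fun y y' => (pesin_iff P y y').trans (forall_congr' fun i => hP _ _)) ?_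
    (Measurable.comap_le (measurable_pi_lambda _ hZ))
    (fun i => (measurable_pi_apply i).comp (comap_measurable fun (y : ℕ → ℝ) i => φ (y i)))
    (partitionSigma_pesin hφ hP)]
  · refine entropy_eq_of_generating hf hφ ?_ (hgen.exists_comap hfm hφ hP)
    have h := tendsto_partitionEntropy_prod_sub (μ := ν) hX hZ
    simpa only [blockEntropy_succ_eq_past hν hfm hφ, blockEntropy_eq_past hν hfm hφ] using h
  · intro y y'
    have h1 : pull f 1 (pesin P) y y' ↔ pesin P (forth f y) (forth f y') := Iff.rfl
    rw [h1, pesin_iff, pesin_iff, ← hP]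
    refine ⟨fun h => ⟨h 0, fun i => h (i + 1)⟩, fun h i => ?_⟩
    cases i with
    | zero => exact h.1
    | succ i => exact h.2 i

end Pesin

/-- The partition `𝒫 = {U, I \ U} ∨ 𝒬` consists of the fibres of a measurable function with
finitely many values. -/
lemma IsBranchPartition.exists_code {ι : Type*} {p q : ι → ℝ} {f : ℝ → ℝ} {𝒬 : Set (Set ℝ)}
    (hQ : IsBranchPartition p q f 𝒬) (u v : ℝ) :
    ∃ (K : ℕ) (φ : ℝ → Fin K), Measurable φ ∧ ∀ x x', partP (Ioo u v) 𝒬 x x' ↔ φ x = φ x' := by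
  classical
  have := hQ.finite.to_subtype
  obtain ⟨K, ⟨E⟩⟩ := Finite.exists_equiv_fin (Prop × (𝒬 → Prop))
  have hm : Measurable fun x : ℝ => (x ∈ Ioo u v, fun Q : 𝒬 => x ∈ (Q : Set ℝ)) :=
    (measurable_mem.2 measurableSet_Ioo).prodMk <| measurable_pi_lambda _ fun Q =>
      measurable_mem.2 (hQ.interval Q Q.2).measurableSet
  refine ⟨K, fun x => E (x ∈ Ioo u v, fun Q => x ∈ (Q : Set ℝ)),
    (measurable_of_finite E).comp hm, fun x x' => ?_⟩
  rw [E.apply_eq_iff_eq, Prod.mk.injEq, eq_iff_iff, funext_iff, Subtype.forall]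
  simp only [eq_iff_iff]
  rfl

end CuspPesin

/-! ### Assembly of the proposition. -/

open CuspPesin in
theorem proposition31 {ι : Type*} [Countable ι] (a b : ℝ) (p q : ι → ℝ) (f : ℝ → ℝ) (C e : ℝ)
    (hf : IsCuspMap a b p q f C e) (hpm : PiecewiseMonotone (dom p q) f)
    (μ : Measure ℝ) [IsProbabilityMeasure μ] (hdom : ∀ᵐ x ∂μ, x ∈ dom p q) (herg : Ergodic f μ)
    (hint : Integrable (fun x => Real.log |deriv f x|) μ) (hpos : 0 < lyapunov f μ) :
    ∃ (ν : Measure (ℕ → ℝ)) (_ : IsProbabilityMeasure ν),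
      IsNaturalExtension (dom p q) f μ ν ∧
      (∃ 𝒬, IsBranchPartition p q f 𝒬) ∧
      ∀ 𝒬, IsBranchPartition p q f 𝒬 → ∀ η : ℝ, 0 < η → η < lyapunov f μ →
        -- existence of the partition
        ((∀ x, μ {x} = 0) → ∃ (α ρ γ : (ℕ → ℝ) → ℝ) (V : (ℕ → ℝ) → Set (ℕ → ℝ)) (u v K ε : ℝ),
          IsUnstableFamily (dom p q) f e (lyapunov f μ) η ν α ρ γ V ∧
          IsGoodPartition a b (dom p q) f μ ν 𝒬 e (lyapunov f μ) η α ρ γ V u v K ε) ∧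
        -- properties of every such partition
        ∀ (α ρ γ : (ℕ → ℝ) → ℝ) (V : (ℕ → ℝ) → Set (ℕ → ℝ)) (u v K ε : ℝ),
          IsUnstableFamily (dom p q) f e (lyapunov f μ) η ν α ρ γ V →
          IsGoodPartition a b (dom p q) f μ ν 𝒬 e (lyapunov f μ) η α ρ γ V u v K ε →
          ∀ ξ : Setoid (ℕ → ℝ), ξ = pesin (partP (Ioo u v) 𝒬) →
            -- increasing
            pull f 1 ξ ≤ ξ ∧
            -- generating
            (∃ N : Set (ℕ → ℝ), (∀ᵐ y ∂ν, y ∈ N) ∧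
              ∀ y ∈ N, ∀ y' ∈ N, (∀ n : ℕ, pull f n ξ y y') → y = y') ∧
            -- entropy
            entropy f μ = condPartitionEntropy ν (pull f 1 ξ) ξ ∧
            -- injective projections into intervals of monotonicity
            (∀ᵐ y ∂ν, ∀ k : ℕ, InjOn proj (back^[k] '' atom (dom p q) f ξ y) ∧
              ∃ Q ∈ 𝒬, MapsTo proj (back^[k] '' atom (dom p q) f ξ y) Q) ∧
            -- the densities are well defined, with positive finite integrals
            (∀ᵐ y ∂ν,
              (∀ y' ∈ atom (dom p q) f ξ y,
                Tendsto (deltaSeq f y y') atTop (𝓝 (delta f y y')) ∧ 0 < delta f y y') ∧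
              0 < ∫⁻ y', ENNReal.ofReal (delta f y y')
                ∂(leafLebesgue (atom (dom p q) f ξ y)) ∧
              ∫⁻ y', ENNReal.ofReal (delta f y y')
                ∂(leafLebesgue (atom (dom p q) f ξ y)) < ∞) ∧
            -- full projections from the good set
            ∀ y ∈ goodSet (dom p q) f e (lyapunov f μ) η α ρ γ V u v K ε,
              proj '' atom (dom p q) f ξ y = Ioo u v := by
  have hb := hf.toIsBasicCuspMap
  obtain ⟨ν, hνp, hν⟩ := exists_isNaturalExtension isOpen_dom.measurableSet μ
    herg.toMeasurePreserving hdom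
  refine ⟨ν, hνp, hν, exists_isBranchPartition hb hpm, fun 𝒬 hQ η hη hηχ => ⟨fun hna => ?_, ?_⟩⟩
  · obtain ⟨α, ρ, γ, V, hfam, hdist⟩ := exists_isUnstableFamily hf hν herg hint hη hηχ
    obtain ⟨u, v, K, ε, hgood⟩ := exists_isGoodPartition hb hQ hν herg hdom hna hηχ hfam hdist
    exact ⟨α, ρ, γ, V, u, v, K, ε, hfam, hgood⟩
  · rintro α ρ γ V u v K ε hfam hgood _ rfl
    refine ⟨pull_pesin_le f _, exists_generating hν hgood.generating, ?_, ?_,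
      hQ.ae_densities hb hν herg hfam hgood, fun y hy =>
        hQ.proj_atom_of_mem_goodSet hb hgood.returning hgood.mem_partition hy⟩
    · obtain ⟨k, φ, hφ, hP⟩ := hQ.exists_code u v
      exact entropy_eq_condPartitionEntropy hν herg.toMeasurePreserving hgood.generating hφ hP
    · filter_upwards [ae_all_iff.2 fun k =>
        (hν.measurePreserving_eval k).quasiMeasurePreserving.ae hdom] with y hy
      exact fun k => ⟨hQ.injOn_proj_atom hb y k, hQ.mapsTo_proj_atom (hy k)⟩
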